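/- Let $\mathbf e_1=(1,0)$, $\mathbf e_2=(0,1)$, and let $\mathcal B=[-\tfrac12,\tfrac12]^2$ be the unit cell with left, right, bottom and top walls $L$, $R=L+\mathbf e_1$, $D$, $U=D+\mathbf e_2$; the normals on $L,R$ point right and those on $D,U$ point up. Let $\Omega=\bigcup_{i=1}^K\Omega_i$ be a finite union of inclusions, each $\Omega_i$ being a bounded open set whose boundary is a regular simple closed $C^2$ curve, with $\overline{\Omega_i}$ contained in the open $3\times3$ super-cell $(-\tfrac32,\tfrac32)^2$, such that the sets $\overline{\Omega_i}+m\mathbf e_1+n\mathbf e_2$ ($1\le i\le K$, $m,n\in\mathbb Z$) are pairwise disjoint; let $\Omega_\Lambda$ be the union of all translates $\Omega_i+m\mathbf e_1+n\mathbf e_2$. The inclusions may intersect the walls of $\mathcal B$; if $\overline\Omega$ lies in the interior of $\mathcal B$, then $\mathcal B\setminus\overline{\Omega_\Lambda}=\mathcal B\setminus\overline\Omega$ and $L\setminus\overline{\Omega_\Lambda}=L$. Let $G(x,y)=\frac1{2\pi}\log\frac1{\|x-y\|}$, let $\tau$ be a continuous real function on $\partial\Omega$, let $\xi\in\mathbb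 R^M$, and let $\phi_1,\dots,\phi_M$ be real functions that are harmonic in a neighbourhood of $\mathcal B$ (for instance proxy sources $\phi_j=G(\cdot,y_j)$ with $y_j$ on a circle about the origin of radius larger than $1/\sqrt2$). Let $$u(x)=\sum_{m,n\in\{-1,0,1\}}\int_{\partial\Omega}G(x,y+m\mathbf e_1+n\mathbf e_2)\,\tau(y)\,ds_y+\sum_{j=1}^M\xi_j\phi_j(x).$$ Suppose that, for some real $p_1,p_2$, $u$ is a classical solution of the periodic Neumann problem on the cell: $\Delta u=0$ in the interior of $\mathcal B$ minus $\overline{\Omega_\Lambda}$; $\nabla u$ (taken there) extends continuously to the points of $\partial\Omega_\Lambda\cap\mathcal B$, and the normal derivative $u_n$ is $0$ at these points; $u(x+\mathbf e_1)-u(x)=p_1$ and $u_n(x+\mathbf e_1)-u_n(x)=0$ for $x\in L\setminus\overline{\Omega_\Lambda}$; $u(x+\mathbf e_2)-u(x)=p_2$ and $u_n(x+\mathbf e_2)-u_n(x)=0$ for $x\in D\setminus\overline{\Omega_\Lambda}$. Put $v(x)=\int_{\partial\Omega}G(x,y)\,\tau(y)\,ds_y$. Then $u_n$ is integrable over $L\setminus\overline{\Omega_\Lambda}$,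 and the horizontal flux $J_1:=\int_{L\setminus\overline{\Omega_\Lambda}}u_n\,ds$ is $$J_1=\sum_{m\in\{-1,0,1\}}(m+2)\Bigl(\int_{U+m\mathbf e_1+\mathbf e_2}v_n\,ds-\int_{D+m\mathbf e_1-\mathbf e_2}v_n\,ds\Bigr)+3\sum_{n\in\{-1,0,1\}}\int_{R+\mathbf e_1+n\mathbf e_2}v_n\,ds+\int_L\sum_{j=1}^M\frac{\partial\phi_j}{\partial n}\,\xi_j\,ds .$$ -/

import Mathlib

/-! The plane `ℝ²` is modelled by `ℂ` as a real vector space with its Euclidean norm, with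
`e₁ = 1` and `e₂ = I`.  The gradient of `w : ℂ → ℝ` at `x` is `fderiv ℝ w x`, and its
component along a vector `n` is `fderiv ℝ w x n`. -/

open scoped Topology
open Complex InnerProductSpace

noncomputable section

namespace PeriodicNeumann

/-- The closed unit cell, centred at the origin. -/
def closedCell : Set ℂ := {x | |x.re| ≤ 1 / 2 ∧ |x.im| ≤ 1 / 2}

/-- The open unit cell. -/
def openCell : Set ℂ := {x | |x.re| < 1 / 2 ∧ |x.im| < 1 / 2}

/-- The open `3 × 3` super-cell, i.e. the open square of side `3` centred at the origin. -/
def superCell : Set ℂ := {x | |x.re| < 3 / 2 ∧ |x.im| < 3 / 2}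

/-- The lattice vector `m e₁ + n e₂`. -/
def latticeVec (m n : ℤ) : ℂ := (m : ℂ) + (n : ℂ) * I

/-- The four walls of the unit cell, parametrized by arc length over `[-1/2, 1/2]`. -/
def wallL (t : ℝ) : ℂ := -(1 / 2 : ℂ) + (t : ℂ) * I
def wallR (t : ℝ) : ℂ := (1 / 2 : ℂ) + (t : ℂ) * I
def wallD (t : ℝ) : ℂ := (t : ℂ) - (1 / 2 : ℂ) * I
def wallU (t : ℝ) : ℂ := (t : ℂ) + (1 / 2 : ℂ) * I

/-- The flux `∫_{W + c} ∂w/∂n ds` through the wall `W`, translated by `c`, with unit normal `n`. -/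
def wallFlux (w : ℂ → ℝ) (W : ℝ → ℂ) (c n : ℂ) : ℝ :=
  ∫ t in (-(1 / 2) : ℝ)..(1 / 2), fderiv ℝ w (W t + c) n

/-- The fundamental solution `G(x, y) = (1 / 2π) log (1 / ‖x - y‖)`. -/
def greenG (x y : ℂ) : ℝ := 1 / (2 * Real.pi) * Real.log (1 / ‖x - y‖)

/-- `K` inclusions `Ω i` per period.  Each one is bounded by a simple closed regular `C²` curve
`γ i` (so it is the interior of a Jordan curve), lies inside the open `3 × 3` super-cell, and no
closed inclusion meets a lattice translate of another one or a nontrivial translate of itself.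
The inclusions may intersect the walls of the unit cell. -/
structure Inclusions (K : ℕ) where
  Ω : Fin K → Set ℂ
  γ : Fin K → ℝ → ℂ
  isOpen : ∀ i, IsOpen (Ω i)
  contDiff : ∀ i, ContDiff ℝ 2 (γ i)
  periodic : ∀ i, Function.Periodic (γ i) (2 * Real.pi)
  simple : ∀ i, Set.InjOn (γ i) (Set.Ico 0 (2 * Real.pi))
  regular : ∀ i t, deriv (γ i) t ≠ 0
  frontier_eq : ∀ i, frontier (Ω i) = Set.range (γ i)
  subset_superCell : ∀ i, closure (Ω i) ⊆ superCell
  disjoint : ∀ (i j : Fin K) (m n : ℤ), (i, (0 : ℤ), (0 : ℤ)) ≠ (j, m, n) →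
    Disjoint (closure (Ω i)) ((fun x => x + latticeVec m n) '' closure (Ω j))

namespace Inclusions

variable {K : ℕ} (S : Inclusions K)

/-- The union `∂Ω` of the boundary curves of the inclusions. -/
def bdry : Set ℂ := ⋃ i, frontier (S.Ω i)

/-- The infinite lattice of inclusions `Ω_Λ`. -/
def lattice : Set ℂ := ⋃ (i : Fin K) (m : ℤ) (n : ℤ), (fun x => x + latticeVec m n) '' S.Ω i

/-- The unit normal to `∂Ω i` at `γ i t` obtained by turning the unit tangent clockwise: the
outward one if `γ i` runs counterclockwise, the inward one otherwise.  It is used only to say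
that a normal derivative vanishes, so that the sign does not matter. -/
def normal (i : Fin K) (t : ℝ) : ℂ := -I * (deriv (S.γ i) t / (‖deriv (S.γ i) t‖ : ℂ))

/-- The arc length integral `∫_{∂Ω} f ds`. -/
def arcIntegral (f : ℂ → ℝ) : ℝ :=
  ∑ i, ∫ t in (0 : ℝ)..(2 * Real.pi), f (S.γ i t) * ‖deriv (S.γ i) t‖

/-- The single-layer potential `v = S_{∂Ω} τ`. -/
def singleLayer (τ : ℂ → ℝ) (x : ℂ) : ℝ := S.arcIntegral fun y => greenG x y * τ y

/-- The sum of the single-layer potentials of the `3 × 3` nearest images. -/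
def nearLayer (τ : ℂ → ℝ) (x : ℂ) : ℝ :=
  ∑ m ∈ Finset.Icc (-1 : ℤ) 1, ∑ n ∈ Finset.Icc (-1 : ℤ) 1,
    S.arcIntegral fun y => greenG x (y + latticeVec m n) * τ y

/-- The representation `u = S^near τ + ∑ j, ξ j φ j`. -/
def rep (τ : ℂ → ℝ) {M : ℕ} (φ : Fin M → ℂ → ℝ) (ξ : Fin M → ℝ) (x : ℂ) : ℝ :=
  S.nearLayer τ x + ∑ j, ξ j * φ j x

/-- `u` is a classical solution, with driving `(p₁, p₂)`, of the Neumann problem on the unit cell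
with coupled data on opposite walls.  Where inclusions or their translates intersect the cell or
its walls, all conditions refer to the part outside the closure of `Ω_Λ`; if the closed
inclusions lie in the open unit cell, then this part of the cell is the cell without the closed
inclusions and the walls are not affected. -/
structure SolvesCellBVP (u : ℂ → ℝ) (p₁ p₂ : ℝ) : Prop where
  /-- `Δu = 0` in the cell outside the closed inclusions. -/
  harmonic : HarmonicOnNhd u (openCell \ closure S.lattice)
  /-- `u_n = 0` on the inclusion boundaries: at each boundary point in the cell the gradient
  has a limit from the part of the cell outside the inclusions, whose normal part is zero. -/
  neumann : ∀ (i : Fin K) (t : ℝ) (m n : ℤ), S.γ i t + latticeVec m n ∈ closedCell →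
    ∃ A : ℂ →L[ℝ] ℝ,
      Filter.Tendsto (fderiv ℝ u)
        (𝓝[openCell \ closure S.lattice] (S.γ i t + latticeVec m n)) (𝓝 A) ∧
      A (S.normal i t) = 0
  /-- `u_R - u_L = p₁`. -/
  jump_LR : ∀ t ∈ Set.Icc (-(1 / 2) : ℝ) (1 / 2), wallL t ∉ closure S.lattice →
    u (wallR t) - u (wallL t) = p₁
  /-- `u_{nR} - u_{nL} = 0`. -/
  flux_LR : ∀ t ∈ Set.Icc (-(1 / 2) : ℝ) (1 / 2), wallL t ∉ closure S.lattice →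
    fderiv ℝ u (wallR t) 1 - fderiv ℝ u (wallL t) 1 = 0
  /-- `u_U - u_D = p₂`. -/
  jump_DU : ∀ t ∈ Set.Icc (-(1 / 2) : ℝ) (1 / 2), wallD t ∉ closure S.lattice →
    u (wallU t) - u (wallD t) = p₂
  /-- `u_{nU} - u_{nD} = 0`. -/
  flux_DU : ∀ t ∈ Set.Icc (-(1 / 2) : ℝ) (1 / 2), wallD t ∉ closure S.lattice →
    fderiv ℝ u (wallU t) I - fderiv ℝ u (wallD t) I = 0

/-- The parameters of the part of the wall `L` outside the closed inclusions. -/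
def openL : Set ℝ := {t | t ∈ Set.Icc (-(1 / 2) : ℝ) (1 / 2) ∧ wallL t ∉ closure S.lattice}

/-- The horizontal flux `J₁ = ∫_L u_n ds`. -/
def fluxJ₁ (u : ℂ → ℝ) : ℝ := ∫ t in S.openL, fderiv ℝ u (wallL t) 1

end Inclusions

/-- Proxy sources `G(·, y)` located outside the closed unit cell are harmonic in a neighbourhood
of it; in particular this applies to all sources on a circle about the origin of radius greater
than `1 / √2`. -/
theorem harmonicOnNhd_proxy {y : ℂ} (hy : y ∉ closedCell) :
    HarmonicOnNhd (fun x => greenG x y) closedCell := by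
  intro x hx
  have hne : x - y ≠ 0 := fun h => hy (sub_eq_zero.mp h ▸ hx)
  have h : HarmonicAt (fun z : ℂ => Real.log ‖z - y‖) x :=
    AnalyticAt.harmonicAt_log_norm (f := fun z => z - y) (by fun_prop) hne
  have h2 := h.const_smul (c := -(1 / (2 * Real.pi)))
  convert h2 using 1
  funext z
  simp [greenG, Real.log_inv]

end PeriodicNeumann

end

noncomputable section

namespace PeriodicNeumann

open MeasureTheory Set Filter Metric
open scoped ComplexConjugate ContDiff Manifold

/-! ### Smooth cutoff functions and real-linear pairings -/

/-! Let g = u_x - i u_y be the complex gradient of u. It is the sum of the nine translates of V, the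
complex gradient of v, plus the proxy part, and it is holomorphic in the cell off the closed
inclusions. The pairing `fderiv ℝ ψ x (conj (g x))` is the real scalar product of ∇ψ and ∇u.

Periodicity. In g(x + e₁) - g(x) the nine images telescope to two columns of sources that are
regular near the whole wall L. The jump and flux conditions make this difference vanish on the part
of L outside the inclusions, which is never empty. By the identity theorem it vanishes near all of
L, inside inclusions as well; the same holds for D. So g continues periodically to a function G on
the plane, and near the closure of `Ω i` the function G differs from the layer gradient of `∂Ω i` by
a holomorphic function (`eventually_periodicGrad_eq`, `analyticAt_periodicGrad_sub_curveGrad`).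

Sources. The layer gradient has distributional divergence minus its density, a holomorphic remainder
has none, and the exterior of `Ω i` contributes nothing because of the Neumann condition. Hence the
integral of ∇ψ · G over `Ω i` equals the integral of τψ over `∂Ω i` (`setIntegral_inclusion`), a
weak jump relation that needs no boundary values from the inside.

Flux. The walls may cut the inclusions, so the integral over L is replaced by an area integral with
a weight of mass one concentrating at L. On the super-cell the weight is the derivative of a
staircase rising by one just right of each of the lines x = -3/2, -1/2, 1/2. The divergence theorem
for V against the staircase gives source terms on the curves plus a flux through the boundary of the
super-cell. Folding onto the unit cell turns the left side into the weighted integral of Re g over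
the whole cell; by the weak jump relation its part inside the inclusions equals exactly the source
terms, which cancel (`setIntegral_exterior_repGrad`). As the weight concentrates, the staircase
takes the value m + 2 on column m, 0 on the left side and 3 on the right side: these are the
coefficients in the formula. The left side tends to J₁ because, at almost every height where L meets
an inclusion boundary, the normal is horizontal and the Neumann condition kills u_x
(`tendsto_exteriorDeriv_wallL`). -/

theorem exists_smooth_cutoff {K U : Set ℂ} (hK : IsCompact K) (hU : IsOpen U) (hKU : K ⊆ U) :
    ∃ χ : ℂ → ℝ, ContDiff ℝ ∞ χ ∧ HasCompactSupport χ ∧ tsupport χ ⊆ U ∧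
      (∀ᶠ x in 𝓝ˢ K, χ x = 1) ∧ ∀ x, χ x ∈ Icc (0 : ℝ) 1 := by
  obtain ⟨K', hK', hKK', hK'U⟩ := exists_compact_between hK hU hKU
  obtain ⟨f, h1, h0, h2⟩ := exists_contMDiffMap_one_nhds_of_subset_interior 𝓘(ℝ, ℂ) (n := (⊤ : ℕ∞))
    hK.isClosed hKK'
  have hsub : tsupport f ⊆ K' := by
    refine closure_minimal (fun x hx => ?_) hK'.isClosed
    by_contra h
    exact hx (h0 x h)
  exact ⟨f, f.contMDiff.contDiff, hK'.of_isClosed_subset (isClosed_tsupport _) hsub,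
    hsub.trans hK'U, h1, h2⟩

theorem clm_conj_apply (A : ℂ →L[ℝ] ℝ) (z : ℂ) : A (conj z) = z.re * A 1 - z.im * A I := by
  have : conj z = z.re • (1 : ℂ) + (-z.im) • I := by
    apply Complex.ext <;> simp
  rw [this, map_add, map_smul, map_smul]
  simp
  ring

/-! ### Single-layer potentials along a curve and their complex gradients -/

/-- The complex gradient `v_x - i v_y` of the single-layer potential `v` with density `ρ` with
respect to the parameter of the curve `γ`. -/
def layerGrad (γ : ℝ → ℂ) (ρ : ℝ → ℝ) (x : ℂ) : ℂ :=
  ∫ t in (0 : ℝ)..(2 * Real.pi), (ρ t : ℂ) * (-(1 / (2 * Real.pi)) * (x - γ t)⁻¹)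

section Layer

variable {γ : ℝ → ℂ} {ρ : ℝ → ℝ}

theorem exists_ball_dist_le {x₀ : ℂ} (h : x₀ ∉ closure (range γ)) :
    ∃ r > 0, ∀ x ∈ ball x₀ r, ∀ t, r ≤ ‖x - γ t‖ := by
  obtain ⟨r, hr, hr'⟩ := Metric.isOpen_iff.1 isClosed_closure.isOpen_compl x₀ h
  refine ⟨r / 2, by positivity, fun x hx t => ?_⟩
  by_contra! hlt
  refine hr' (a := γ t) ?_ (subset_closure (mem_range_self t))
  rw [mem_ball, dist_eq_norm] at hx ⊢
  calc ‖γ t - x₀‖ = ‖(x - x₀) - (x - γ t)‖ := by congr 1; ring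
    _ ≤ ‖x - x₀‖ + ‖x - γ t‖ := norm_sub_le _ _
    _ < r := by linarith

theorem differentiableAt_layerGrad (hγ : Continuous γ) (hρ : Continuous ρ) {x₀ : ℂ}
    (h : x₀ ∉ closure (range γ)) : DifferentiableAt ℂ (layerGrad γ ρ) x₀ := by
  obtain ⟨r, hr, hr'⟩ := exists_ball_dist_le h
  have hne : ∀ x ∈ ball x₀ r, ∀ t, x - γ t ≠ 0 := fun x hx t =>
    norm_pos_iff.1 (hr.trans_le (hr' x hx t))
  have hcont : ∀ x ∈ ball x₀ r,
      Continuous fun t => (ρ t : ℂ) * (-(1 / (2 * Real.pi)) * (x - γ t)⁻¹) := fun x hx =>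
    (continuous_ofReal.comp hρ).mul
      (continuous_const.mul ((continuous_const.sub hγ).inv₀ (hne x hx)))
  have := intervalIntegral.hasDerivAt_integral_of_dominated_loc_of_deriv_le (𝕜 := ℂ)
    (μ := volume) (a := 0) (b := 2 * Real.pi)
    (F := fun x t => (ρ t : ℂ) * (-(1 / (2 * Real.pi)) * (x - γ t)⁻¹))
    (F' := fun x t => (ρ t : ℂ) * (-(1 / (2 * Real.pi)) * (-1 / (x - γ t) ^ 2)))
    (x₀ := x₀) (s := ball x₀ r)
    (bound := fun t => |ρ t| * (1 / (2 * Real.pi) * (1 / r ^ 2)))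
    (ball_mem_nhds _ hr)
    (by filter_upwards [ball_mem_nhds x₀ hr] with x hx using (hcont x hx).aestronglyMeasurable)
    ((hcont x₀ (mem_ball_self hr)).intervalIntegrable _ _)
    (by
      refine Continuous.aestronglyMeasurable ((continuous_ofReal.comp hρ).mul
        (continuous_const.mul (Continuous.div₀ continuous_const
          ((continuous_const.sub hγ).pow 2) fun t => pow_ne_zero 2 (hne x₀ (mem_ball_self hr) t)))))
    (by
      refine ae_of_all _ fun t _ x hx => ?_
      have h1 := hr' x hx t
      have h2 : r ^ 2 ≤ ‖x - γ t‖ ^ 2 := pow_le_pow_left₀ hr.le h1 2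
      simp only [norm_mul, norm_neg, norm_div, norm_one, norm_pow, Complex.norm_real,
        Real.norm_eq_abs, abs_of_pos Real.pi_pos, Complex.norm_ofNat]
      gcongr)
    ((hρ.abs.mul continuous_const).intervalIntegrable _ _)
    (by
      refine ae_of_all _ fun t _ x hx => ?_
      have := ((hasDerivAt_id x).sub_const (γ t)).inv (hne x hx t)
      simpa using (this.const_mul (-(1 / (2 * Real.pi) : ℂ))).const_mul (ρ t : ℂ))
  exact this.2.differentiableAt

theorem analyticAt_layerGrad (hγ : Continuous γ) (hρ : Continuous ρ) {x₀ : ℂ}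
    (h : x₀ ∉ closure (range γ)) : AnalyticAt ℂ (layerGrad γ ρ) x₀ :=
  DifferentiableOn.analyticAt (s := (closure (range γ))ᶜ)
    (fun _ hx => (differentiableAt_layerGrad hγ hρ hx).differentiableWithinAt)
    (isClosed_closure.isOpen_compl.mem_nhds h)

theorem hasFDerivAt_greenG {x y : ℂ} (h : x ≠ y) :
    HasFDerivAt (fun x => greenG x y)
      (reCLM ∘L (ContinuousLinearMap.mul ℝ ℂ (-(1 / (2 * Real.pi)) * (x - y)⁻¹))) x := by
  have hpos : 0 < normSq (x - y) := normSq_pos.2 (sub_ne_zero.2 h)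
  -- The logarithm of the squared norm is differentiated instead; this halves the factor 1/(2π).
  have heq : (fun x => greenG x y) =
      fun x => -(1 / (4 * Real.pi)) * Real.log (((x - y).re) ^ 2 + ((x - y).im) ^ 2) := by
    funext x
    have : ((x - y).re) ^ 2 + ((x - y).im) ^ 2 = ‖x - y‖ ^ 2 := by
      rw [← normSq_eq_norm_sq, normSq_apply]; ring
    rw [this, greenG, one_div ‖x - y‖, Real.log_inv, Real.log_pow]
    field_simp
    ring
  rw [heq]
  have hsub : HasFDerivAt (fun x : ℂ => x - y) (ContinuousLinearMap.id ℝ ℂ) x :=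
    (hasFDerivAt_id x).sub_const y
  have hre := (reCLM.hasFDerivAt (x := x - y)).comp x hsub
  have him := (imCLM.hasFDerivAt (x := x - y)).comp x hsub
  have hs : ((x - y).re) ^ 2 + ((x - y).im) ^ 2 ≠ 0 := by
    rw [normSq_apply] at hpos; nlinarith
  have := (((hre.pow 2).add (him.pow 2)).log (by simpa using hs)).const_mul (-(1 / (4 * Real.pi)))
  refine (this.congr_fderiv ?_)
  ext w
  have hn : normSq (x - y) = (x - y).re ^ 2 + (x - y).im ^ 2 := by rw [normSq_apply]; ring
  have e1 : (-(1 / (2 * Real.pi)) * (x - y)⁻¹ : ℂ) = ((-(1 / (2 * Real.pi)) : ℝ) : ℂ) * (x - y)⁻¹ := by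
    push_cast; ring
  simp only [FunLike.coe_smul, Pi.smul_apply, ContinuousLinearMap.coe_comp,
    Function.comp_apply, add_apply, reCLM_apply, imCLM_apply,
    ContinuousLinearMap.mul_apply', e1, mul_assoc, mul_re, inv_re, inv_im, hn,
    smul_eq_mul, ContinuousLinearMap.coe_id', id, Pi.add_apply]
  have hpi := Real.pi_ne_zero
  field_simp
  simp
  field_simp
  ring

theorem hasFDerivAt_layer (hγ : Continuous γ) (hρ : Continuous ρ) {x₀ : ℂ}
    (h : x₀ ∉ closure (range γ)) :
    HasFDerivAt (fun x => ∫ t in (0 : ℝ)..(2 * Real.pi), greenG x (γ t) * ρ t)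
      (reCLM ∘L (ContinuousLinearMap.mul ℝ ℂ (layerGrad γ ρ x₀))) x₀ := by
  obtain ⟨r, hr, hr'⟩ := exists_ball_dist_le h
  have hne : ∀ x ∈ ball x₀ r, ∀ t, x - γ t ≠ 0 := fun x hx t =>
    norm_pos_iff.1 (hr.trans_le (hr' x hx t))
  have hcont : ∀ x ∈ ball x₀ r, Continuous fun t => greenG x (γ t) * ρ t := fun x hx => by
    refine Continuous.mul (continuous_const.mul (Continuous.log ?_ fun t => ?_)) hρ
    · exact continuous_const.div (continuous_const.sub hγ).norm
        fun t => norm_ne_zero_iff.2 (hne x hx t)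
    · exact one_div_ne_zero (norm_ne_zero_iff.2 (hne x hx t))
  have hcoef : ∀ x ∈ ball x₀ r,
      Continuous fun t => (ρ t : ℂ) * (-(1 / (2 * Real.pi)) * (x - γ t)⁻¹) := fun x hx =>
    (continuous_ofReal.comp hρ).mul
      (continuous_const.mul ((continuous_const.sub hγ).inv₀ (hne x hx)))
  let Λ : ℂ →L[ℝ] (ℂ →L[ℝ] ℝ) :=
    (ContinuousLinearMap.compL ℝ ℂ ℂ ℝ reCLM) ∘L (ContinuousLinearMap.mul ℝ ℂ)
  have hΛ : ∀ z, Λ z = reCLM ∘L (ContinuousLinearMap.mul ℝ ℂ z) := fun z => rfl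
  have := intervalIntegral.hasFDerivAt_integral_of_dominated_of_fderiv_le (𝕜 := ℝ)
    (μ := volume) (a := 0) (b := 2 * Real.pi)
    (F := fun x t => greenG x (γ t) * ρ t)
    (F' := fun x t => Λ ((ρ t : ℂ) * (-(1 / (2 * Real.pi)) * (x - γ t)⁻¹)))
    (x₀ := x₀) (s := ball x₀ r)
    (bound := fun t => ‖Λ‖ * (|ρ t| * (1 / (2 * Real.pi) * (1 / r))))
    (ball_mem_nhds _ hr)
    (by filter_upwards [ball_mem_nhds x₀ hr] with x hx using (hcont x hx).aestronglyMeasurable)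
    ((hcont x₀ (mem_ball_self hr)).intervalIntegrable _ _)
    (Λ.continuous.comp (hcoef x₀ (mem_ball_self hr))).aestronglyMeasurable
    (by
      refine ae_of_all _ fun t _ x hx => (Λ.le_opNorm _).trans ?_
      have h1 := hr' x hx t
      simp only [norm_mul, norm_neg, norm_inv, Complex.norm_real,
        Real.norm_eq_abs, abs_of_pos Real.pi_pos, Complex.norm_ofNat, one_div]
      gcongr)
    ((continuous_const.mul (hρ.abs.mul continuous_const)).intervalIntegrable _ _)
    (by
      refine ae_of_all _ fun t _ x hx => ?_
      have := (hasFDerivAt_greenG (sub_ne_zero.1 (hne x hx t))).mul_const (ρ t)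
      refine this.congr_fderiv ?_
      ext w
      simp only [hΛ, FunLike.coe_smul, Pi.smul_apply, ContinuousLinearMap.coe_comp,
        Function.comp_apply, reCLM_apply, ContinuousLinearMap.mul_apply', smul_eq_mul]
      rw [mul_assoc (ρ t : ℂ), re_ofReal_mul])
  refine this.congr_fderiv ?_
  rw [← hΛ, layerGrad, ← Λ.intervalIntegral_comp_comm]
  exact (hcoef x₀ (mem_ball_self hr)).intervalIntegrable _ _

/-! ### Local integrability -/

theorem locallyIntegrable_norm_inv : LocallyIntegrable (fun z : ℂ => ‖z‖⁻¹) volume := by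
  refine locallyIntegrable_of_norm_le_rpow (C := 1) (α := 1) ?_ ?_ ?_ ?_
  · simp [Complex.finrank_real_complex]
  · simp [Complex.finrank_real_complex]
  · refine ae_of_all _ fun x => ?_
    rw [Real.rpow_neg (norm_nonneg _)]; simp
  · exact (measurable_norm.inv).aestronglyMeasurable

theorem measurable_layer_kernel (hγ : Continuous γ) (hρ : Continuous ρ) :
    Measurable fun p : ℂ × ℝ => (ρ p.2 : ℂ) * (-(1 / (2 * Real.pi)) * (p.1 - γ p.2)⁻¹) :=
  (continuous_ofReal.comp (hρ.comp continuous_snd)).measurable.mul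
    (measurable_const.mul ((continuous_fst.sub (hγ.comp continuous_snd)).measurable.inv))

/-- For fixed t the kernel is a multiple of 1/|x - γ t|, which is integrable in the plane; the bound
is uniform in t because translation by γ t, with |γ t| ≤ B, keeps the ball of radius R inside that
of radius R + B. Joint integrability justifies Fubini and makes the layer gradient locally
integrable across the curve itself, where its pointwise values are irrelevant. -/
theorem integrable_layer_kernel (hγ : Continuous γ) (hρ : Continuous ρ) (R : ℝ) :
    Integrable (fun p : ℂ × ℝ => (ρ p.2 : ℂ) * (-(1 / (2 * Real.pi)) * (p.1 - γ p.2)⁻¹))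
      ((volume.restrict (ball 0 R)).prod (volume.restrict (Ioc 0 (2 * Real.pi)))) := by
  obtain ⟨B, hB⟩ := (isCompact_Icc (a := (0 : ℝ)) (b := 2 * Real.pi)).exists_bound_of_continuousOn
    hγ.continuousOn
  obtain ⟨D, hD⟩ := (isCompact_Icc (a := (0 : ℝ)) (b := 2 * Real.pi)).exists_bound_of_continuousOn
    hρ.continuousOn
  have hloc : ∀ y : ℂ, LocallyIntegrable (fun x : ℂ => ‖x - y‖⁻¹) volume := by
    intro y
    rw [locallyIntegrable_iff]
    intro k hk
    have h1 := (locallyIntegrable_iff.1 locallyIntegrable_norm_inv)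
      (k := (fun x => x - y) '' k) (hk.image (by fun_prop))
    have h2 := ((measurePreserving_sub_right volume y).integrableOn_comp_preimage
      (measurableEmbedding_subRight y) (f := fun z : ℂ => ‖z‖⁻¹)
      (s := (fun x => x - y) '' k)).2 h1
    refine h2.mono_set (subset_preimage_image _ _)
  have hball : ∀ y : ℂ, IntegrableOn (fun x : ℂ => ‖x - y‖⁻¹) (ball 0 R) := fun y =>
    ((hloc y).integrableOn_isCompact (isCompact_closedBall 0 R)).mono_set ball_subset_closedBall
  have hmeas := measurable_layer_kernel hγ hρ
  rw [integrable_prod_iff' hmeas.aestronglyMeasurable]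
  have hnorm : ∀ (x : ℂ) (t : ℝ), ‖(ρ t : ℂ) * (-(1 / (2 * Real.pi)) * (x - γ t)⁻¹)‖ =
      (|ρ t| * (1 / (2 * Real.pi))) * ‖x - γ t‖⁻¹ := by
    intro x t
    simp only [norm_mul, norm_neg, norm_div, norm_one, norm_inv, Complex.norm_real,
        Real.norm_eq_abs, abs_of_pos Real.pi_pos, Complex.norm_ofNat, mul_assoc]
  refine ⟨ae_of_all _ fun t => ?_, ?_⟩
  · refine (((hball (γ t)).const_mul (|ρ t| * (1 / (2 * Real.pi))))).mono
      (hmeas.comp (measurable_id.prodMk measurable_const)).aestronglyMeasurable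
      (ae_of_all _ fun x => ?_)
    rw [hnorm, Real.norm_of_nonneg (by positivity)]
  · refine Measure.integrableOn_of_bounded (s := Ioc 0 (2 * Real.pi)) (M := D * (1 / (2 * Real.pi)) *
      ∫ z in ball (0 : ℂ) (R + B), ‖z‖⁻¹) (by simp [ENNReal.mul_eq_top]) ?_ ?_
    · exact (hmeas.norm.aestronglyMeasurable.prod_swap.integral_prod_right' (μ := volume)
        (ν := volume.restrict (ball 0 R)))
    · refine (ae_restrict_iff' measurableSet_Ioc).2 (ae_of_all _ fun t ht => ?_)
      have ht' := Ioc_subset_Icc_self ht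
      have hD' : |ρ t| ≤ D := hD t ht'
      rw [Real.norm_of_nonneg (integral_nonneg fun _ => norm_nonneg _)]
      simp only [hnorm, integral_const_mul]
      have hle : ∫ x in ball (0 : ℂ) R, ‖x - γ t‖⁻¹ ≤ ∫ z in ball (0 : ℂ) (R + B), ‖z‖⁻¹ := by
        rw [← (measurePreserving_sub_right volume (γ t)).setIntegral_preimage_emb
          (measurableEmbedding_subRight (γ t)) (fun z : ℂ => ‖z‖⁻¹)]
        refine setIntegral_mono_set ?_ (ae_of_all _ fun _ => by simp) ?_
        · refine ((measurePreserving_sub_right volume (γ t)).integrableOn_comp_preimage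
            (measurableEmbedding_subRight (γ t)) (f := fun z : ℂ => ‖z‖⁻¹)).2 ?_
          exact (locallyIntegrable_norm_inv.integrableOn_isCompact
            (isCompact_closedBall 0 (R + B))).mono_set ball_subset_closedBall
        · refine LE.le.eventuallyLE fun x hx => ?_
          have := hB t ht'
          simp only [mem_ball, dist_zero_right, mem_preimage] at hx ⊢
          exact (norm_sub_le _ _).trans_lt (by linarith)
      have hD0 : 0 ≤ D := (abs_nonneg _).trans hD'
      have : 0 ≤ ∫ z in ball (0 : ℂ) R, ‖z - γ t‖⁻¹ := integral_nonneg fun _ => by positivity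
      gcongr

theorem locallyIntegrable_layerGrad (hγ : Continuous γ) (hρ : Continuous ρ) :
    LocallyIntegrable (layerGrad γ ρ) volume := by
  rw [locallyIntegrable_iff]
  intro k hk
  obtain ⟨R, _, hR⟩ := hk.isBounded.exists_pos_norm_lt
  have : IntegrableOn (layerGrad γ ρ) (ball 0 R) := by
    have := (integrable_layer_kernel hγ hρ R).integral_prod_left
    refine this.congr (ae_of_all _ fun x => ?_)
    rw [layerGrad, intervalIntegral.integral_of_le (by positivity)]
  exact this.mono_set fun x hx => by simpa using hR x hx

end Layer

/-! ### The distributional divergence of a layer gradient -/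

/-- This is -ΔG(·, y) = δ_y. In polar coordinates about y the conjugated kernel is radial of size
1/r, the Jacobian cancels it, and the integrand is -(1/2π) times the radial derivative of ψ. Every
ray then contributes the same multiple of ψ(y). -/
theorem integral_fderiv_kernel {ψ : ℂ → ℝ} (hψ : ContDiff ℝ 1 ψ) (hc : HasCompactSupport ψ)
    (y : ℂ) :
    ∫ x, fderiv ℝ ψ x (conj (-(1 / (2 * Real.pi)) * (x - y)⁻¹)) = ψ y := by
  have h1 : ∫ x, fderiv ℝ ψ x (conj (-(1 / (2 * Real.pi)) * (x - y)⁻¹)) =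
      ∫ z, fderiv ℝ ψ (y + z) (conj (-(1 / (2 * Real.pi)) * z⁻¹)) := by
    rw [← integral_add_left_eq_self _ y]
    simp
  rw [h1, ← Complex.integral_comp_polarCoord_symm]
  have hpolar : ∀ p ∈ polarCoord.target,
      p.1 • fderiv ℝ ψ (y + Complex.polarCoord.symm p)
        (conj (-(1 / (2 * Real.pi)) * (Complex.polarCoord.symm p)⁻¹)) =
      -(1 / (2 * Real.pi)) * fderiv ℝ ψ (y + p.1 * exp (p.2 * I)) (exp (p.2 * I)) := by
    rintro ⟨r, θ⟩ ⟨hr, -⟩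
    simp only [mem_Ioi] at hr
    have he : Complex.polarCoord.symm (r, θ) = r * exp (θ * I) := by
      rw [Complex.polarCoord_symm_apply, exp_mul_I]; simp
    have hcj : conj (-(1 / (2 * Real.pi)) * (r * exp (θ * I))⁻¹) =
        (-(1 / (2 * Real.pi)) * r⁻¹ : ℝ) • exp (θ * I) := by
      have : conj (exp (θ * I)) = (exp (θ * I))⁻¹ := by
        rw [← exp_conj, ← exp_neg]; simp
      simp only [map_mul, map_neg, map_div₀, map_one, map_inv₀, conj_ofReal, this, mul_inv,
        inv_inv, real_smul, map_ofNat]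
      push_cast; ring
    simp only [he, hcj, map_smul, smul_eq_mul]
    field_simp
  rw [setIntegral_congr_fun polarCoord.open_target.measurableSet hpolar, integral_const_mul]
  have hcd : Continuous (fderiv ℝ ψ) := hψ.continuous_fderiv one_ne_zero
  have hcont : Continuous fun p : ℝ × ℝ =>
      fderiv ℝ ψ (y + p.1 * exp (p.2 * I)) (exp (p.2 * I)) := by fun_prop
  obtain ⟨R, hR0, hR⟩ := hc.isCompact.isBounded.exists_pos_norm_lt
  -- The bound is on |r| since each ray is later extended to a full line, on which the restricted
  -- function must have compact support.
  have hzero : ∀ r : ℝ, R + ‖y‖ ≤ |r| → ∀ θ : ℝ, y + r * exp (θ * I) ∉ tsupport ψ := by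
    intro r hr θ hmem
    have h2 := hR _ hmem
    have h3 : ‖(r : ℂ) * exp (θ * I)‖ = |r| := by simp [norm_exp_ofReal_mul_I]
    have h4 : ‖(r : ℂ) * exp (θ * I)‖ ≤ ‖y + r * exp (θ * I)‖ + ‖y‖ := by
      calc ‖(r : ℂ) * exp (θ * I)‖ = ‖(y + r * exp (θ * I)) - y‖ := by congr 1; ring
        _ ≤ _ := norm_sub_le _ _
    linarith
  have hderiv0 : ∀ x, x ∉ tsupport ψ → fderiv ℝ ψ x = 0 := fun x hx =>
    image_eq_zero_of_notMem_tsupport fun h => hx (tsupport_fderiv_subset ℝ h)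
  have hint : IntegrableOn (fun p : ℝ × ℝ =>
      fderiv ℝ ψ (y + p.1 * exp (p.2 * I)) (exp (p.2 * I)))
      (Ioi 0 ×ˢ Ioo (-Real.pi) Real.pi) := by
    have h5 : IntegrableOn (fun p : ℝ × ℝ =>
        fderiv ℝ ψ (y + p.1 * exp (p.2 * I)) (exp (p.2 * I)))
        (Icc 0 (R + ‖y‖) ×ˢ Icc (-Real.pi) Real.pi) :=
      hcont.continuousOn.integrableOn_compact (isCompact_Icc.prod isCompact_Icc)
    refine h5.of_forall_sdiff_eq_zero (measurableSet_Ioi.prod measurableSet_Ioo) ?_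
    rintro ⟨r, θ⟩ ⟨⟨hr, hθ⟩, hn⟩
    simp only [mem_prod, mem_Icc, mem_Ioi, mem_Ioo, not_and] at hr hθ hn
    rw [hderiv0 _ (hzero r ?_ θ)]
    · rfl
    · by_contra! hlt
      rw [abs_of_pos hr] at hlt
      exact hn ⟨hr.le, hlt.le⟩ hθ.1.le hθ.2.le
  have hray : ∀ θ : ℝ, ∫ r in Ioi (0 : ℝ),
      fderiv ℝ ψ (y + r * exp (θ * I)) (exp (θ * I)) = -ψ y := by
    intro θ
    have hd : ∀ r : ℝ, HasDerivAt (fun r : ℝ => ψ (y + r * exp (θ * I)))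
        (fderiv ℝ ψ (y + r * exp (θ * I)) (exp (θ * I))) r := by
      intro r
      have h6 : HasDerivAt (fun r : ℝ => y + r * exp (θ * I)) (exp (θ * I)) r := by
        simpa using ((ofRealCLM.hasDerivAt (x := r)).mul_const (exp (θ * I))).const_add y
      exact ((hψ.differentiable one_ne_zero _).hasFDerivAt).comp_hasDerivAt r h6
    have h7 := HasCompactSupport.integral_Ioi_deriv_eq (f := fun r : ℝ => ψ (y + r * exp (θ * I)))
      (hψ.comp (contDiff_const.add (ofRealCLM.contDiff.mul contDiff_const))) (HasCompactSupport.intro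
        (isCompact_Icc (a := -(R + ‖y‖)) (b := R + ‖y‖)) fun r hr =>
          image_eq_zero_of_notMem_tsupport (hzero r (by
            by_contra! hlt
            exact hr ⟨(abs_lt.1 hlt).1.le, (abs_lt.1 hlt).2.le⟩) θ)) 0
    rw [ofReal_zero, zero_mul, add_zero] at h7
    rw [← h7]
    exact integral_congr_ae (ae_of_all _ fun r => (hd r).deriv.symm)
  rw [IntegrableOn, Measure.volume_eq_prod, ← Measure.prod_restrict] at hint
  rw [polarCoord_target, Measure.volume_eq_prod, ← Measure.prod_restrict, integral_prod_symm _ hint]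
  simp only [hray]
  rw [setIntegral_const, measureReal_def, Real.volume_Ioo, ENNReal.toReal_ofReal
    (by linarith [Real.pi_pos]), smul_eq_mul]
  have := Real.pi_ne_zero
  field_simp
  ring

theorem integral_fderiv_layerGrad {γ : ℝ → ℂ} {ρ : ℝ → ℝ} (hγ : Continuous γ) (hρ : Continuous ρ)
    {ψ : ℂ → ℝ} (hψ : ContDiff ℝ 1 ψ) (hc : HasCompactSupport ψ) :
    ∫ x, fderiv ℝ ψ x (conj (layerGrad γ ρ x)) =
      ∫ t in (0 : ℝ)..(2 * Real.pi), ρ t * ψ (γ t) := by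
  obtain ⟨R, hR0, hR⟩ := hc.isCompact.isBounded.exists_pos_norm_lt
  have hderiv0 : ∀ x, x ∉ tsupport ψ → fderiv ℝ ψ x = 0 := fun x hx =>
    image_eq_zero_of_notMem_tsupport fun h => hx (tsupport_fderiv_subset ℝ h)
  have hball : ∀ (f : ℂ → ℂ), ∫ x, fderiv ℝ ψ x (f x) = ∫ x in ball 0 R, fderiv ℝ ψ x (f x) := by
    intro f
    refine (setIntegral_eq_integral_of_forall_compl_eq_zero fun x hx => ?_).symm
    rw [hderiv0 x fun h => hx (by simpa using hR x h)]; rfl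
  have hcd : Continuous (fderiv ℝ ψ) := hψ.continuous_fderiv one_ne_zero
  obtain ⟨C, hC⟩ := hcd.bounded_above_of_compact_support (hc.fderiv ℝ)
  have hk := integrable_layer_kernel hγ hρ R
  have hmeas := measurable_layer_kernel hγ hρ
  have hint : Integrable (fun p : ℂ × ℝ => fderiv ℝ ψ p.1
      (conj ((ρ p.2 : ℂ) * (-(1 / (2 * Real.pi)) * (p.1 - γ p.2)⁻¹))))
      ((volume.restrict (ball 0 R)).prod (volume.restrict (Ioc 0 (2 * Real.pi)))) := by
    refine (hk.norm.const_mul C).mono' ?_ (ae_of_all _ fun p => ?_)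
    · simp only [clm_conj_apply]
      have h1 : Measurable fun p : ℂ × ℝ => fderiv ℝ ψ p.1 1 :=
        (by fun_prop : Continuous fun p : ℂ × ℝ => fderiv ℝ ψ p.1 1).measurable
      have h2 : Measurable fun p : ℂ × ℝ => fderiv ℝ ψ p.1 I :=
        (by fun_prop : Continuous fun p : ℂ × ℝ => fderiv ℝ ψ p.1 I).measurable
      exact (((measurable_re.comp hmeas).mul h1).sub
        ((measurable_im.comp hmeas).mul h2)).aestronglyMeasurable
    · refine ((fderiv ℝ ψ p.1).le_opNorm _).trans ?_
      rw [norm_conj]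
      gcongr
      exact hC _
  rw [hball]
  calc ∫ x in ball 0 R, fderiv ℝ ψ x (conj (layerGrad γ ρ x))
      = ∫ x in ball 0 R, ∫ t in Ioc 0 (2 * Real.pi), fderiv ℝ ψ x
          (conj ((ρ t : ℂ) * (-(1 / (2 * Real.pi)) * (x - γ t)⁻¹))) := by
        refine integral_congr_ae ?_
        filter_upwards [hk.prod_right_ae] with x hx
        rw [layerGrad, intervalIntegral.integral_of_le (by positivity)]
        exact (ContinuousLinearMap.integral_comp_comm
          ((fderiv ℝ ψ x) ∘L (conjCLE : ℂ →L[ℝ] ℂ)) hx).symm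
    _ = ∫ t in Ioc 0 (2 * Real.pi), ∫ x in ball 0 R, fderiv ℝ ψ x
          (conj ((ρ t : ℂ) * (-(1 / (2 * Real.pi)) * (x - γ t)⁻¹))) :=
        integral_integral_swap hint
    _ = ∫ t in Ioc 0 (2 * Real.pi), ρ t * ψ (γ t) := by
        refine integral_congr_ae (ae_of_all _ fun t => ?_)
        simp only
        rw [← hball, ← integral_fderiv_kernel hψ hc (γ t), ← integral_const_mul]
        refine integral_congr_ae (ae_of_all _ fun x => ?_)
        simp only [map_mul (starRingEnd ℂ) (ρ t : ℂ), conj_ofReal]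
        rw [← real_smul, map_smul, smul_eq_mul]
    _ = _ := by rw [intervalIntegral.integral_of_le (by positivity)]

/-! ### Integration by parts against a holomorphic function -/

/-- By the Cauchy–Riemann equations the vector field conj H is divergence-free, so integrating by
parts moves the derivative from η to θ with no extra term. The factor η is only Lipschitz because it
will be a function of the distance to an inclusion; Rademacher's theorem gives its gradient almost
everywhere. -/
theorem integral_lipschitz_pairing {H : ℂ → ℂ} {U : Set ℂ} (hU : IsOpen U)
    (hH : DifferentiableOn ℂ H U) {η θ : ℂ → ℝ} {C : NNReal} (hη : LipschitzWith C η)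
    (hθ : ContDiff ℝ ∞ θ) (hc : HasCompactSupport θ) (hsub : tsupport θ ∩ tsupport η ⊆ U) :
    ∫ x, θ x * fderiv ℝ η x (conj (H x)) = -∫ x, η x * fderiv ℝ θ x (conj (H x)) := by
  -- The cutoff makes θ χ H globally smooth while changing nothing where both θ and η are active.
  obtain ⟨χ, hχ, hχc, hχU, hχ1, -⟩ := exists_smooth_cutoff
    (hc.isCompact.inter_right (isClosed_tsupport η)) hU hsub
  have hHan : ∀ x ∈ U, AnalyticAt ℂ H x := fun x hx => hH.analyticAt (hU.mem_nhds hx)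
  have hsm : ∀ L : ℂ →L[ℝ] ℝ, ContDiff ℝ ∞ fun x => θ x * (χ x * L (H x)) := by
    intro L
    refine hθ.mul (contDiff_iff_contDiffAt.2 fun x => ?_)
    by_cases hx : x ∈ U
    · exact hχ.contDiffAt.mul
        (L.contDiff.contDiffAt.comp x ((hHan x hx).contDiffAt.restrict_scalars ℝ))
    · have : (fun x => χ x * L (H x)) =ᶠ[𝓝 x] fun _ => 0 := by
        filter_upwards [notMem_tsupport_iff_eventuallyEq.1 fun h => hx (hχU h)] with z hz
        simp [hz]
      exact contDiffAt_const.congr_of_eventuallyEq this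
  have hcs : ∀ L : ℂ →L[ℝ] ℝ, HasCompactSupport fun x => θ x * (χ x * L (H x)) :=
    fun L => hc.mul_right
  have hlip : ∀ L : ℂ →L[ℝ] ℝ, ∃ D, LipschitzWith D fun x => θ x * (χ x * L (H x)) := fun L =>
    ContDiff.lipschitzWith_of_hasCompactSupport (hcs L) ((hsm L)) (by simp)
  have hparts : ∀ (L : ℂ →L[ℝ] ℝ) (v : ℂ),
      ∫ x, lineDeriv ℝ η x v * (θ x * (χ x * L (H x))) =
        -∫ x, fderiv ℝ (fun x => θ x * (χ x * L (H x))) x v * η x := by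
    intro L v
    obtain ⟨D, hD⟩ := hlip L
    rw [LipschitzWith.integral_lineDeriv_mul_eq hη hD (hcs L) v, ← integral_neg]
    congr 1
    funext x
    rw [((hsm L).differentiable (by simp) x).lineDeriv_eq_fderiv]
    simp
  have hLHS : (fun x => θ x * fderiv ℝ η x (conj (H x))) =ᵐ[volume] fun x =>
      lineDeriv ℝ η x 1 * (θ x * (χ x * reCLM (H x))) -
        lineDeriv ℝ η x I * (θ x * (χ x * imCLM (H x))) := by
    filter_upwards [hη.ae_differentiableAt] with x hx
    rw [hx.lineDeriv_eq_fderiv, hx.lineDeriv_eq_fderiv, clm_conj_apply]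
    by_cases h1 : x ∈ tsupport θ
    · by_cases h2 : x ∈ tsupport η
      · have : χ x = 1 := hχ1.self_of_nhdsSet x ⟨h1, h2⟩
        simp only [this, reCLM_apply, imCLM_apply]; ring
      · have : fderiv ℝ η x = 0 :=
          image_eq_zero_of_notMem_tsupport fun h => h2 (tsupport_fderiv_subset ℝ h)
        simp [this]
    · simp [image_eq_zero_of_notMem_tsupport h1]
  have hint1 : ∀ (L : ℂ →L[ℝ] ℝ) (v : ℂ),
      Integrable fun x => lineDeriv ℝ η x v * (θ x * (χ x * L (H x))) := by
    intro L v
    refine (((hsm L).continuous.integrable_of_hasCompactSupport (hcs L)).bdd_mul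
      (c := C * ‖v‖) (measurable_lineDeriv hη.continuous).aestronglyMeasurable
      (ae_of_all _ fun x => norm_lineDeriv_le_of_lipschitz ℝ hη))
  have hint2 : ∀ (L : ℂ →L[ℝ] ℝ) (v : ℂ),
      Integrable fun x => fderiv ℝ (fun x => θ x * (χ x * L (H x))) x v * η x := by
    intro L v
    have h1 : Continuous fun x => fderiv ℝ (fun x => θ x * (χ x * L (H x))) x v * η x :=
      (((hsm L).continuous_fderiv (by simp)).clm_apply continuous_const).mul hη.continuous
    refine h1.integrable_of_hasCompactSupport ?_
    exact (((hcs L).fderiv_apply ℝ v)).mul_right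
  rw [integral_congr_ae hLHS, integral_sub (hint1 _ _) (hint1 _ _), hparts, hparts,
    neg_sub_neg, ← neg_sub, ← integral_sub (hint2 _ _) (hint2 _ _), neg_inj]
  congr 1
  funext x
  by_cases h2 : x ∈ tsupport η
  swap
  · simp [image_eq_zero_of_notMem_tsupport h2]
  by_cases h1 : x ∈ tsupport θ
  swap
  · have h0 : θ =ᶠ[𝓝 x] fun _ => 0 := notMem_tsupport_iff_eventuallyEq.1 h1
    have h0' : ∀ L : ℂ →L[ℝ] ℝ, (fun x => θ x * (χ x * L (H x))) =ᶠ[𝓝 x] fun _ => 0 :=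
      fun L => by filter_upwards [h0] with z hz; simp [hz]
    rw [(h0' _).fderiv_eq, (h0' _).fderiv_eq, h0.fderiv_eq]
    simp
  have hx1 : ∀ᶠ z in 𝓝 x, χ z = 1 := eventually_nhdsSet_iff_forall.1 hχ1 x ⟨h1, h2⟩
  have hxU : x ∈ U := hsub ⟨h1, h2⟩
  have hd := (hHan x hxU).differentiableAt.hasDerivAt
  have hfd : HasFDerivAt H ((ContinuousLinearMap.mul ℝ ℂ) (deriv H x)) x := by
    refine (hd.hasFDerivAt.restrictScalars ℝ).congr_fderiv ?_
    ext w
    simp [mul_comm]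
  have hloc : ∀ L : ℂ →L[ℝ] ℝ, (fun x => θ x * (χ x * L (H x))) =ᶠ[𝓝 x]
      fun x => θ x * L (H x) := fun L => by
    filter_upwards [hx1] with z hz; simp [hz]
  have hL : ∀ L : ℂ →L[ℝ] ℝ, fderiv ℝ (fun x => θ x * (χ x * L (H x))) x =
      θ x • (L ∘L ContinuousLinearMap.mul ℝ ℂ (deriv H x)) + L (H x) • fderiv ℝ θ x := by
    intro L
    rw [(hloc L).fderiv_eq]
    exact (((hθ.differentiable (by simp) x).hasFDerivAt).mul
      (L.hasFDerivAt.comp x hfd)).fderiv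
  -- The two terms containing the derivative of H are both θ Re H' and cancel: this is the
  -- Cauchy–Riemann step.
  rw [hL, hL, clm_conj_apply]
  simp
  ring

/-! ### A smooth ramp -/

/-- A smooth ramp from `0` (left of `1 / 2`) to `1` (right of `1`). -/
def ramp (t : ℝ) : ℝ := Real.smoothTransition (2 * t - 1)

theorem contDiff_ramp : ContDiff ℝ ∞ ramp :=
  Real.smoothTransition.contDiff.comp (by fun_prop)

theorem ramp_of_le {t : ℝ} (h : t ≤ 1 / 2) : ramp t = 0 :=
  Real.smoothTransition.zero_of_nonpos (by linarith)

theorem ramp_of_ge {t : ℝ} (h : 1 ≤ t) : ramp t = 1 :=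
  Real.smoothTransition.one_of_one_le (by linarith)

theorem ramp_mem_Icc (t : ℝ) : ramp t ∈ Icc (0 : ℝ) 1 :=
  ⟨Real.smoothTransition.nonneg _, Real.smoothTransition.le_one _⟩

theorem hasDerivAt_ramp (t : ℝ) : HasDerivAt ramp (deriv ramp t) t :=
  (contDiff_ramp.differentiable (by simp) t).hasDerivAt

theorem continuous_deriv_ramp : Continuous (deriv ramp) :=
  contDiff_ramp.continuous_deriv (by simp)

theorem deriv_ramp_of_le {t : ℝ} (h : t ≤ 1 / 2) : deriv ramp t = 0 := by
  have h1 : EqOn (deriv ramp) 0 (Iio (1 / 2)) := fun s hs => by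
    have : ramp =ᶠ[𝓝 s] fun _ => 0 := by
      filter_upwards [Iio_mem_nhds hs] with x hx using ramp_of_le (le_of_lt hx)
    simp [this.deriv_eq]
  have h2 := h1.closure continuous_deriv_ramp continuous_zero
  rw [closure_Iio] at h2
  exact h2 h

theorem deriv_ramp_of_ge {t : ℝ} (h : 1 ≤ t) : deriv ramp t = 0 := by
  have h1 : EqOn (deriv ramp) 0 (Ioi 1) := fun s hs => by
    have : ramp =ᶠ[𝓝 s] fun _ => 1 := by
      filter_upwards [Ioi_mem_nhds hs] with x hx using ramp_of_ge (le_of_lt hx)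
    simp [this.deriv_eq]
  have h2 := h1.closure continuous_deriv_ramp continuous_zero
  rw [closure_Ioi] at h2
  exact h2 h

theorem exists_deriv_ramp_bound : ∃ C : NNReal, ∀ t, ‖deriv ramp t‖ ≤ C := by
  obtain ⟨C, hC⟩ := continuous_deriv_ramp.bounded_above_of_compact_support
    (HasCompactSupport.intro (isCompact_Icc (a := (1 / 2 : ℝ)) (b := 1)) fun t ht => by
      rcases le_total t (1 / 2) with h | h
      · exact deriv_ramp_of_le h
      · rcases le_total 1 t with h' | h'
        · exact deriv_ramp_of_ge h'
        · exact absurd ⟨h, h'⟩ ht)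
  exact ⟨⟨C, (norm_nonneg _).trans (hC 0)⟩, hC⟩

/-! ### Neighbourhoods of a curve and the distance function -/

/-- About 1/δ parameters at spacing at most Tδ suffice: by the Lipschitz bound B, balls of radius
δ(1 + BT) around the corresponding points cover the tube, and each has area of order δ². -/
theorem exists_volume_tube_le {γ : ℝ → ℂ} (hγ : ContDiff ℝ 1 γ) {T : ℝ} (hT : 0 < T) :
    ∃ C : ℝ, 0 ≤ C ∧ ∀ δ ∈ Ioc (0 : ℝ) 1,
      volume (⋃ t ∈ Icc 0 T, ball (γ t) δ) ≤ ENNReal.ofReal (C * δ) := by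
  obtain ⟨B, hB⟩ := hγ.contDiffOn.exists_lipschitzOnWith (s := Icc 0 T) one_ne_zero
    (convex_Icc 0 T) isCompact_Icc
  -- The factor 3 bounds (N + 1)δ, since N < 1/δ + 1 and δ ≤ 1.
  refine ⟨3 * (Real.pi * (1 + B * T) ^ 2), by positivity, fun δ hδ => ?_⟩
  obtain ⟨hδ0, hδ1⟩ := hδ
  set N := ⌈1 / δ⌉₊ with hN
  have hNpos : 0 < N := Nat.ceil_pos.2 (by positivity)
  have hN1 : 1 / δ ≤ N := Nat.le_ceil _
  have hN2 : (N : ℝ) < 1 / δ + 1 := Nat.ceil_lt_add_one (by positivity)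
  have hNpos' : (0 : ℝ) < N := by exact_mod_cast hNpos
  have hNδ : 1 / (N : ℝ) ≤ δ := by
    rw [div_le_iff₀ hNpos']; rw [div_le_iff₀ hδ0] at hN1; linarith
  have hcover : (⋃ t ∈ Icc 0 T, ball (γ t) δ) ⊆
      ⋃ j ∈ Finset.range (N + 1), ball (γ (T * j / N)) (δ * (1 + B * T)) := by
    intro x hx
    simp only [mem_iUnion, exists_prop] at hx ⊢
    obtain ⟨t, ht, hxt⟩ := hx
    have hj0 : 0 ≤ t / T * N := by have := ht.1; positivity
    have hj1 : t / T * N ≤ N := mul_le_of_le_one_left hNpos'.le ((div_le_one hT).2 ht.2)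
    have hfl := Nat.floor_le hj0
    have hfl2 := Nat.lt_floor_add_one (t / T * N)
    set j := ⌊t / T * N⌋₊
    have hjN : (j : ℝ) ≤ N := hfl.trans hj1
    refine ⟨j, Finset.mem_range.2 (Nat.lt_succ_of_le (by exact_mod_cast hjN)), ?_⟩
    have ht' : T * j / N ∈ Icc 0 T :=
      ⟨by positivity, by rw [div_le_iff₀ hNpos']; gcongr⟩
    have hdist : dist t (T * j / N) ≤ T * δ := by
      have e : t - T * j / N = T / N * (t / T * N - j) := by field_simp
      rw [Real.dist_eq, e, abs_mul, abs_of_pos (by positivity : 0 < T / N)]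
      have : |t / T * N - j| ≤ 1 := by rw [abs_le]; constructor <;> linarith
      calc T / N * |t / T * N - j| ≤ T / N * 1 := by gcongr
        _ = T * (1 / N) := by ring
        _ ≤ T * δ := by gcongr
    have h1 := hB.dist_le_mul t ht _ ht'
    rw [mem_ball] at hxt ⊢
    calc dist x (γ (T * j / N)) ≤ dist x (γ t) + dist (γ t) (γ (T * j / N)) := dist_triangle _ _ _
      _ < δ + B * (T * δ) := by
        have : (B : ℝ) * dist t (T * j / N) ≤ B * (T * δ) := by gcongr
        linarith
      _ = _ := by ring
  calc volume (⋃ t ∈ Icc 0 T, ball (γ t) δ)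
      ≤ ∑ j ∈ Finset.range (N + 1), volume (ball (γ (T * j / N)) (δ * (1 + B * T))) :=
        (measure_mono hcover).trans (measure_biUnion_finset_le _ _)
    _ = ENNReal.ofReal ((N + 1) * ((δ * (1 + B * T)) ^ 2 * Real.pi)) := by
        simp only [Complex.volume_ball, Finset.sum_const, Finset.card_range, nsmul_eq_mul]
        rw [ENNReal.ofReal_mul (p := (N : ℝ) + 1) (by positivity),
          ENNReal.ofReal_mul (p := (δ * (1 + B * T)) ^ 2) (by positivity),
          ENNReal.ofReal_pow (by positivity), ← ENNReal.ofReal_natCast]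
        congr 2
        · push_cast; rfl
        · rw [← NNReal.coe_real_pi, ENNReal.ofReal_coe_nnreal]
    _ ≤ _ := by
        refine ENNReal.ofReal_le_ofReal ?_
        have : ((N : ℝ) + 1) * δ ≤ 3 := by
          have : (N : ℝ) * δ ≤ (1 / δ + 1) * δ := by gcongr
          rw [add_mul, one_div_mul_cancel hδ0.ne'] at this
          linarith
        calc ((N : ℝ) + 1) * ((δ * (1 + B * T)) ^ 2 * Real.pi)
            = (((N : ℝ) + 1) * δ) * (Real.pi * (1 + B * T) ^ 2) * δ := by ring
          _ ≤ 3 * (Real.pi * (1 + B * T) ^ 2) * δ := by gcongr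

theorem volume_range_eq_zero {γ : ℝ → ℂ} (hγ : ContDiff ℝ 1 γ) {T : ℝ} (hT : 0 < T)
    (hper : Function.Periodic γ T) : volume (range γ) = 0 := by
  obtain ⟨C, hC0, hC⟩ := exists_volume_tube_le hγ hT
  have hle : ∀ δ ∈ Ioc (0 : ℝ) 1, volume (range γ) ≤ ENNReal.ofReal (C * δ) := fun δ hδ => by
    refine (measure_mono ?_).trans (hC δ hδ)
    rw [← hper.image_Icc hT 0, zero_add]
    rintro _ ⟨t, ht, rfl⟩
    exact mem_iUnion₂.2 ⟨t, ht, mem_ball_self hδ.1⟩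
  have hlim : Tendsto (fun δ : ℝ => ENNReal.ofReal (C * δ)) (𝓝[>] 0) (𝓝 0) := by
    have : Tendsto (fun δ : ℝ => ENNReal.ofReal (C * δ)) (𝓝 0) (𝓝 (ENNReal.ofReal (C * 0))) :=
      (ENNReal.continuous_ofReal.comp (continuous_const.mul continuous_id)).tendsto 0
    rw [mul_zero, ENNReal.ofReal_zero] at this
    exact this.mono_left nhdsWithin_le_nhds
  refine le_antisymm (ge_of_tendsto hlim ?_) zero_le
  filter_upwards [Ioc_mem_nhdsGT zero_lt_one] with δ hδ using hle δ hδ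

/-- Moving from x straight towards a nearest point p decreases the distance at unit rate, which
fixes the derivative along x - p. As the distance is 1-Lipschitz, nothing is left for the orthogonal
direction. -/
theorem fderiv_infDist_apply {K : Set ℂ} {x p : ℂ} (hp : p ∈ K) (hxp : x ≠ p)
    (hdist : infDist x K = ‖x - p‖) (hd : DifferentiableAt ℝ (fun x => infDist x K) x) (w : ℂ) :
    fderiv ℝ (fun x => infDist x K) x w = (conj ((x - p) / (‖x - p‖ : ℂ)) * w).re := by
  set A := fderiv ℝ (fun x => infDist x K) x with hA
  have hpos : 0 < ‖x - p‖ := norm_pos_iff.2 (sub_ne_zero.2 hxp)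
  have hnorm : ‖A‖ ≤ 1 := by
    simpa using norm_fderiv_le_of_lipschitz ℝ (lipschitz_infDist_pt K) (x₀ := x)
  set e := (x - p) / (‖x - p‖ : ℂ) with he
  have hne : (‖x - p‖ : ℂ) ≠ 0 := by exact_mod_cast hpos.ne'
  have hxe : x - p = ‖x - p‖ • e := by rw [real_smul, he]; field_simp
  have hnorme : ‖e‖ = 1 := by rw [he, norm_div, norm_real, norm_norm, div_self hpos.ne']
  have hAe : A e = 1 := by
    have h1 : HasDerivAt (fun s : ℝ => infDist (x - s • (x - p)) K) (A (-(x - p))) 0 := by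
      have h2 : HasDerivAt (fun s : ℝ => x - s • (x - p)) (-(x - p)) 0 := by
        simpa using ((hasDerivAt_id (0 : ℝ)).smul_const (x - p)).const_sub x
      have h3 : HasFDerivAt (fun x => infDist x K) A (x - (0 : ℝ) • (x - p)) := by
        simpa using hd.hasFDerivAt
      exact h3.comp_hasDerivAt 0 h2
    have h4 : HasDerivAt (fun s : ℝ => (1 - s) * ‖x - p‖) (-‖x - p‖) 0 := by
      simpa using ((hasDerivAt_id (0 : ℝ)).const_sub 1).mul_const ‖x - p‖
    have h5 : EqOn (fun s : ℝ => infDist (x - s • (x - p)) K) (fun s => (1 - s) * ‖x - p‖)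
        (Icc 0 1) := by
      intro s hs
      refine le_antisymm ?_ ?_
      · refine (infDist_le_dist_of_mem hp).trans_eq ?_
        rw [dist_eq_norm, show x - s • (x - p) - p = (1 - s) • (x - p) by module, norm_smul,
          Real.norm_of_nonneg (by linarith [hs.2])]
      · have := infDist_le_infDist_add_dist (s := K) (x := x) (y := x - s • (x - p))
        rw [hdist, dist_eq_norm, sub_sub_cancel, norm_smul, Real.norm_of_nonneg hs.1] at this
        simp only; linarith
    -- The explicit formula for the distance is available only on the segment, so derivatives at its
    -- endpoint 0 are compared within [0, 1].
    have h6 := h1.hasDerivWithinAt (s := Icc 0 1)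
    have h7 := (h4.hasDerivWithinAt (s := Icc 0 1)).congr h5 (h5 ⟨le_rfl, zero_le_one⟩)
    have h8 := (uniqueDiffOn_Icc zero_lt_one (0 : ℝ) ⟨le_rfl, zero_le_one⟩).eq_deriv _ h6 h7
    rw [hxe, map_neg, map_smul, norm_smul, hnorme] at h8
    simp only [norm_norm, smul_eq_mul, mul_one, neg_inj] at h8
    exact mul_left_cancel₀ hpos.ne' (h8.trans (mul_one _).symm)
  have hAIe : A (I * e) = 0 := by
    -- Testing the operator bound on e + c (I e) gives (1 + c²)² ≤ 1 + c², hence c = 0.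
    set c := A (I * e)
    have h1 : |A (e + c • (I * e))| ≤ ‖e + c • (I * e)‖ :=
      (A.le_opNorm _).trans (mul_le_of_le_one_left (norm_nonneg _) hnorm)
    have h2 : e + c • (I * e) = (1 + c * I) * e := by rw [real_smul]; ring
    have h3 : ‖(1 + c * I : ℂ)‖ ^ 2 = 1 + c ^ 2 := by
      rw [← normSq_eq_norm_sq, normSq_apply]; simp; ring
    rw [map_add, map_smul, hAe, h2, norm_mul, hnorme, mul_one] at h1
    have h4 := pow_le_pow_left₀ (abs_nonneg _) h1 2
    rw [h3, sq_abs, smul_eq_mul] at h4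
    have : c ^ 2 ≤ 0 := by nlinarith [sq_nonneg c]
    exact pow_eq_zero_iff two_ne_zero |>.1 (le_antisymm this (sq_nonneg c))
  have hee : e * conj e = 1 := by rw [mul_conj, normSq_eq_norm_sq, hnorme]; simp
  have hw : w = (conj e * w).re • e + (conj e * w).im • (I * e) := by
    calc w = (conj e * w) * e := by rw [mul_right_comm, mul_comm (conj e), hee, one_mul]
      _ = _ := by
        conv_lhs => rw [← re_add_im (conj e * w)]
        rw [real_smul, real_smul]; ring
  conv_lhs => rw [hw]
  rw [map_add, map_smul, map_smul, hAe, hAIe]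
  simp

/-- The first-order condition at the minimum makes x - γ t orthogonal to the tangent, so its
direction is plus or minus the normal; absolute values absorb the unknown sign. -/
theorem nearest_point_normal {γ : ℝ → ℂ} {x : ℂ} {t : ℝ} (hγ : DifferentiableAt ℝ γ t)
    (hreg : deriv γ t ≠ 0) (hx : x ≠ γ t) (hmin : ∀ s, ‖x - γ t‖ ≤ ‖x - γ s‖) (z : ℂ) :
    |(z * ((x - γ t) / (‖x - γ t‖ : ℂ))).re| =
      |(z * (-I * (deriv γ t / (‖deriv γ t‖ : ℂ)))).re| := by
  have hpos : 0 < ‖x - γ t‖ := norm_pos_iff.2 (sub_ne_zero.2 hx)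
  have hpos' : 0 < ‖deriv γ t‖ := norm_pos_iff.2 hreg
  have hd : HasDerivAt (fun s => ‖x - γ s‖ ^ 2) (2 * inner ℝ (x - γ t) (-deriv γ t)) t :=
    (hγ.hasDerivAt.const_sub x).norm_sq
  have hloc : IsLocalMin (fun s => ‖x - γ s‖ ^ 2) t :=
    Eventually.of_forall fun s => pow_le_pow_left₀ (norm_nonneg _) (hmin s) 2
  have h0 := hloc.hasDerivAt_eq_zero hd
  set a := (x - γ t) / (‖x - γ t‖ : ℂ) with ha
  set b := deriv γ t / (‖deriv γ t‖ : ℂ) with hb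
  have hna : ‖a‖ = 1 := by rw [ha, norm_div, norm_real, norm_norm, div_self hpos.ne']
  have hnb : ‖b‖ = 1 := by rw [hb, norm_div, norm_real, norm_norm, div_self hpos'.ne']
  have hab : (a * conj b).re = 0 := by
    rw [inner_neg_right] at h0
    have h1 : inner ℝ (x - γ t) (deriv γ t) = 0 := by linarith
    rw [Complex.inner] at h1
    have : a * conj b = ((‖x - γ t‖ * ‖deriv γ t‖)⁻¹ : ℝ) * ((x - γ t) * conj (deriv γ t)) := by
      rw [ha, hb, map_div₀, conj_ofReal]; push_cast; field_simp
    rw [this, re_ofReal_mul]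
    have h2 : ((x - γ t) * conj (deriv γ t)).re = 0 := by
      rw [← h1]; simp [mul_re]; try ring
    rw [h2, mul_zero]
  have hbb : conj b * b = 1 := by rw [mul_comm, mul_conj, normSq_eq_norm_sq, hnb]; simp
  have hc : a = ((a * conj b).im : ℂ) * I * b := by
    have h3 : a = (a * conj b) * b := by rw [mul_assoc, hbb, mul_one]
    conv_lhs => rw [h3, ← re_add_im (a * conj b), hab]
    simp
  set c := (a * conj b).im
  have hcabs : |c| = 1 := by
    have := congrArg norm hc
    rw [norm_mul, norm_mul, hna, hnb, norm_I, norm_real, Real.norm_eq_abs] at this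
    linarith
  rw [hc, show z * ((c : ℂ) * I * b) = ((-c : ℝ) : ℂ) * (z * (-I * b)) by push_cast; ring,
    re_ofReal_mul, abs_mul, abs_neg, hcabs, one_mul]

/-! ### Weak form of the exterior Neumann condition -/

/-- Pointwise decay of the normal component becomes uniform by compactness of the parameter
interval. Along a violating sequence the parameters converge to some t₀; since H is bounded near γ
t₀ and the normal is continuous, the normal at t may be replaced by the normal at t₀, contradicting
the limit there. -/
theorem uniform_normal_component {γ : ℝ → ℂ} (hγ : ContDiff ℝ 1 γ) {T : ℝ}
    (hreg : ∀ t, deriv γ t ≠ 0) {E : Set ℂ} {H : ℂ → ℂ}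
    (hbd : ∀ t, ∃ C, ∀ᶠ x in 𝓝[E] (γ t), ‖H x‖ ≤ C)
    (hN : ∀ t, Tendsto (fun x => (H x * (-I * (deriv γ t / (‖deriv γ t‖ : ℂ)))).re)
      (𝓝[E] (γ t)) (𝓝 0)) {ε : ℝ} (hε : 0 < ε) :
    ∃ δ > 0, ∀ x ∈ E, ∀ t ∈ Icc 0 T, ‖x - γ t‖ < δ →
      |(H x * (-I * (deriv γ t / (‖deriv γ t‖ : ℂ)))).re| ≤ ε := by
  by_contra! hcon
  choose x hxE t ht hxt hgt using fun k : ℕ => hcon (1 / ((k : ℝ) + 1)) (by positivity)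
  obtain ⟨t₀, ht₀, σ, hσ, hlim⟩ := isCompact_Icc.tendsto_subseq ht
  set n : ℝ → ℂ := fun t => -I * (deriv γ t / (‖deriv γ t‖ : ℂ)) with hn
  have hncont : Continuous n := by
    have h1 : Continuous (deriv γ) := hγ.continuous_deriv le_rfl
    exact continuous_const.mul (h1.div₀ (continuous_ofReal.comp h1.norm) fun t => by
      exact_mod_cast (norm_ne_zero_iff.2 (hreg t)))
  have hσ' : Tendsto σ atTop atTop := hσ.tendsto_atTop
  have hdiff : Tendsto (fun k => x (σ k) - γ (t (σ k))) atTop (𝓝 0) := by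
    have h1 : Tendsto (fun k => x k - γ (t k)) atTop (𝓝 0) :=
      squeeze_zero_norm (fun k => (hxt k).le) tendsto_one_div_add_atTop_nhds_zero_nat
    exact h1.comp hσ'
  have hγlim : Tendsto (fun k => γ (t (σ k))) atTop (𝓝 (γ t₀)) :=
    (hγ.continuous.tendsto t₀).comp hlim
  have hxlim : Tendsto (fun k => x (σ k)) atTop (𝓝[E] (γ t₀)) := by
    refine tendsto_nhdsWithin_iff.2 ⟨?_, Eventually.of_forall fun k => hxE _⟩
    simpa using hdiff.add hγlim
  have h1 : Tendsto (fun k => (H (x (σ k)) * n t₀).re) atTop (𝓝 0) := (hN t₀).comp hxlim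
  obtain ⟨C, hC⟩ := hbd t₀
  have h2 : Tendsto (fun k => (H (x (σ k)) * (n (t (σ k)) - n t₀)).re) atTop (𝓝 0) := by
    have h3 : Tendsto (fun k => C * ‖n (t (σ k)) - n t₀‖) atTop (𝓝 0) := by
      have h4 : Tendsto (fun k => n (t (σ k)) - n t₀) atTop (𝓝 (n t₀ - n t₀)) :=
        ((hncont.tendsto t₀).comp hlim).sub_const _
      rw [sub_self] at h4
      simpa using h4.norm.const_mul C
    refine squeeze_zero_norm' ?_ h3
    filter_upwards [hxlim.eventually hC] with k hk
    refine (abs_re_le_norm _).trans ?_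
    rw [norm_mul]
    gcongr
  have h5 : Tendsto (fun k => |(H (x (σ k)) * n (t (σ k))).re|) atTop (𝓝 0) := by
    have := (h1.add h2).abs
    simp only [add_zero, abs_zero] at this
    refine this.congr fun k => ?_
    rw [← add_re, ← mul_add, add_sub_cancel]
  have h6 := ge_of_tendsto h5 (Eventually.of_forall fun k => (hgt (σ k)).le)
  linarith

/-- The integrand is cut off with η = ramp(d/δ), where d is the distance to the closed inclusion K,
and the derivative is moved from θ to η. The gradient of η has size O(1/δ), lives in a tube of area
O(δ), and points along the normal at the nearest boundary point, where the normal component of H is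
at most ε. The result is O(ε); neither tubular coordinates nor boundary traces are needed. -/
theorem integral_compl_closure_pairing_eq_zero {Ω : Set ℂ} {γ : ℝ → ℂ} (hγ : ContDiff ℝ 1 γ)
    {T : ℝ} (hT : 0 < T) (hper : Function.Periodic γ T) (hreg : ∀ t, deriv γ t ≠ 0)
    (hfr : frontier Ω = range γ)
    {O : Set ℂ} (hO : IsOpen O) {H : ℂ → ℂ}
    (hH : DifferentiableOn ℂ H (O \ closure Ω))
    (hbd : ∀ t, ∃ C, ∀ᶠ x in 𝓝[(closure Ω)ᶜ] (γ t), ‖H x‖ ≤ C)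
    (hN : ∀ t, Tendsto (fun x => (H x * (-I * (deriv γ t / (‖deriv γ t‖ : ℂ)))).re)
      (𝓝[(closure Ω)ᶜ] (γ t)) (𝓝 0))
    {θ : ℂ → ℝ} (hθ : ContDiff ℝ ∞ θ) (hc : HasCompactSupport θ) (hsub : tsupport θ ⊆ O)
    (hint : IntegrableOn (fun x => fderiv ℝ θ x (conj (H x))) (closure Ω)ᶜ) :
    ∫ x in (closure Ω)ᶜ, fderiv ℝ θ x (conj (H x)) = 0 := by
  set K := closure Ω with hKdef
  set d : ℂ → ℝ := fun x => infDist x K with hd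
  have hKcl : IsClosed K := isClosed_closure
  have hKne : K.Nonempty := by
    have : γ 0 ∈ frontier Ω := hfr ▸ mem_range_self 0
    exact ⟨γ 0, frontier_subset_closure this⟩
  have hKuniv : Kᶜ ≠ univ := by
    rw [Ne, compl_univ_iff]; exact hKne.ne_empty
  have hdlip : LipschitzWith 1 d := lipschitz_infDist_pt K
  have hd0 : ∀ x ∈ K, d x = 0 := fun x hx => infDist_zero_of_mem hx
  have hdpos : ∀ x ∉ K, 0 < d x := fun x hx => (hKcl.notMem_iff_infDist_pos hKne).1 hx
  have hnear : ∀ x ∉ K, ∃ t ∈ Icc 0 T, d x = ‖x - γ t‖ ∧ γ t ∈ K := by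
    -- A nearest point of K to an outside point lies on the frontier of K, hence on the curve.
    intro x hx
    obtain ⟨y, hy, hxy⟩ := exists_mem_frontier_infDist_compl_eq_dist (s := Kᶜ) hx hKuniv
    rw [compl_compl] at hxy
    rw [frontier_compl] at hy
    have hy' : y ∈ frontier Ω := frontier_closure_subset hy
    rw [hfr, ← hper.image_Icc hT 0, zero_add] at hy'
    obtain ⟨t, ht, rfl⟩ := hy'
    exact ⟨t, ht, by rw [← dist_eq_norm]; exact hxy, hKcl.frontier_subset hy⟩
  have hγK : ∀ s, γ s ∈ K := fun s => frontier_subset_closure (hfr ▸ mem_range_self s)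
  obtain ⟨Cr, hCr⟩ := exists_deriv_ramp_bound
  obtain ⟨Ct, hCt0, hCt⟩ := exists_volume_tube_le hγ hT
  obtain ⟨Cθ, hCθ⟩ := hθ.continuous.bounded_above_of_compact_support hc
  have hCθ0 : 0 ≤ Cθ := (norm_nonneg _).trans (hCθ 0)
  have hramp_lip : LipschitzWith Cr ramp :=
    lipschitzWith_of_nnnorm_deriv_le (contDiff_ramp.differentiable (by simp)) hCr
  let η : ℝ → ℂ → ℝ := fun δ x => ramp (d x / δ)
  have hηlip : ∀ δ > 0, ∃ C, LipschitzWith C (η δ) := by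
    intro δ hδ
    have : LipschitzWith (Real.toNNReal δ⁻¹) fun x => d x / δ := by
      refine LipschitzWith.of_dist_le_mul fun x y => ?_
      rw [Real.coe_toNNReal _ (by positivity), Real.dist_eq, ← sub_div, abs_div, abs_of_pos hδ,
        div_eq_inv_mul]
      have := hdlip.dist_le_mul x y
      rw [NNReal.coe_one, one_mul, Real.dist_eq] at this
      gcongr
    exact ⟨_, hramp_lip.comp this⟩
  -- Because the ramp vanishes up to 1/2 and not only up to 0, the support keeps a distance δ/2 from
  -- K.
  have hηsupp : ∀ δ > 0, tsupport (η δ) ⊆ Kᶜ := by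
    intro δ hδ
    have h1 : tsupport (η δ) ⊆ {x | δ / 2 ≤ d x} := by
      refine closure_minimal (fun x hx => ?_) (isClosed_le continuous_const hdlip.continuous)
      by_contra h
      refine hx (ramp_of_le ?_)
      rw [mem_ofPred_eq, not_le] at h
      rw [div_le_iff₀ hδ]; linarith
    intro x hx hxK
    have h2 := h1 hx
    rw [mem_ofPred_eq, hd0 x hxK] at h2
    linarith
  have hparts : ∀ δ > 0, ∫ x in Kᶜ, η δ x * fderiv ℝ θ x (conj (H x)) =
      -∫ x, θ x * fderiv ℝ (η δ) x (conj (H x)) := by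
    intro δ hδ
    obtain ⟨C, hC⟩ := hηlip δ hδ
    rw [integral_lipschitz_pairing (hO.sdiff hKcl) hH hC hθ hc
      (fun x hx => ⟨hsub hx.1, hηsupp δ hδ hx.2⟩), neg_neg]
    refine setIntegral_eq_integral_of_forall_compl_eq_zero fun x hx => ?_
    rw [show η δ x = 0 from ramp_of_le (by
      rw [hd0 x (not_not.1 hx)]; norm_num), zero_mul]
  have hgrad : ∀ δ > 0, ∀ᵐ x, (x ∈ K ∨ δ ≤ d x → fderiv ℝ (η δ) x = 0) ∧
      (x ∉ K → ∀ t, d x = ‖x - γ t‖ → γ t ∈ K → ∀ z, |fderiv ℝ (η δ) x (conj z)| ≤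
        Cr / δ * |(z * (-I * (deriv γ t / (‖deriv γ t‖ : ℂ)))).re|) := by
    intro δ hδ
    filter_upwards [hdlip.ae_differentiableAt] with x hx
    have hη : HasFDerivAt (η δ) (deriv ramp (d x / δ) • (δ⁻¹ • fderiv ℝ d x)) x := by
      have h1 : HasFDerivAt (fun x => d x / δ) (δ⁻¹ • fderiv ℝ d x) x := by
        simpa [div_eq_inv_mul] using hx.hasFDerivAt.const_mul δ⁻¹
      exact (hasDerivAt_ramp (d x / δ)).comp_hasFDerivAt (f := fun x => d x / δ) x h1
    rw [hη.fderiv]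
    refine ⟨?_, fun hxK t hdt htK z => ?_⟩
    · rintro (h | h)
      · rw [hd0 x h, deriv_ramp_of_le (by norm_num), zero_smul]
      · rw [deriv_ramp_of_ge ((one_le_div hδ).2 h), zero_smul]
    · have hne : x ≠ γ t := fun h => hxK (h ▸ htK)
      have h2 := fderiv_infDist_apply htK hne hdt hx (conj z)
      rw [FunLike.coe_smul, FunLike.coe_smul, Pi.smul_apply, Pi.smul_apply, h2, ← map_mul,
        conj_re, mul_comm _ z, smul_eq_mul, smul_eq_mul, abs_mul, abs_mul,
        nearest_point_normal (hγ.differentiable one_ne_zero t) (hreg t) hne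
          (fun s => by rw [← hdt, ← dist_eq_norm]; exact infDist_le_dist_of_mem (hγK s)) z,
        ← mul_assoc, abs_of_pos (inv_pos.2 hδ)]
      refine mul_le_mul_of_nonneg_right ?_ (abs_nonneg _)
      rw [div_eq_mul_inv (Cr : ℝ)]
      exact mul_le_mul_of_nonneg_right (hCr _) (inv_nonneg.2 hδ.le)
  have hsmall : ∀ ε > 0, ∀ᶠ δ in 𝓝[>] (0 : ℝ),
      |∫ x, θ x * fderiv ℝ (η δ) x (conj (H x))| ≤ Cθ * Cr * ε * Ct := by
    intro ε hε
    obtain ⟨δ₀, hδ₀, hunif⟩ := uniform_normal_component (T := T) hγ hreg hbd hN hε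
    filter_upwards [Ioo_mem_nhdsGT hδ₀, Ioc_mem_nhdsGT zero_lt_one] with δ hδ hδ'
    set S := ⋃ t ∈ Icc 0 T, ball (γ t) δ with hS
    have hSmeas : MeasurableSet S :=
      (isOpen_biUnion fun _ _ => isOpen_ball).measurableSet
    have hzero : ∀ᵐ x, x ∉ S → θ x * fderiv ℝ (η δ) x (conj (H x)) = 0 := by
      filter_upwards [hgrad δ hδ.1] with x hx hxS
      rw [hx.1 ?_]
      · simp
      · by_contra! h
        obtain ⟨t, ht, hdt, -⟩ := hnear x h.1
        exact hxS (mem_iUnion₂.2 ⟨t, ht, by rw [mem_ball, dist_eq_norm, ← hdt]; exact h.2⟩)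
    rw [← setIntegral_eq_integral_of_ae_compl_eq_zero hzero]
    have hbound : ∀ᵐ x, x ∈ S → ‖θ x * fderiv ℝ (η δ) x (conj (H x))‖ ≤ Cθ * (Cr / δ * ε) := by
      filter_upwards [hgrad δ hδ.1] with x hx _
      by_cases h : x ∈ K ∨ δ ≤ d x
      · rw [hx.1 h]
        simp only [zero_apply, mul_zero, norm_zero]
        have := hδ.1
        positivity
      · push Not at h
        obtain ⟨t, ht, hdt, htK⟩ := hnear x h.1
        rw [norm_mul]
        have h1 := hx.2 h.1 t hdt htK (H x)
        have h2 := hunif x h.1 t ht (by rw [← hdt]; exact h.2.trans hδ.2)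
        have h3 : ‖fderiv ℝ (η δ) x (conj (H x))‖ ≤ Cr / δ * ε :=
          h1.trans (mul_le_mul_of_nonneg_left h2 (div_nonneg Cr.2 hδ.1.le))
        exact mul_le_mul (hCθ x) h3 (norm_nonneg _) hCθ0
    have hvol := hCt δ hδ'
    have hfin : volume S < ⊤ := hvol.trans_lt ENNReal.ofReal_lt_top
    have h1 := norm_setIntegral_le_of_norm_le_const_ae' hfin hbound
    refine h1.trans ?_
    have h2 : volume.real S ≤ Ct * δ :=
      ENNReal.toReal_le_of_le_ofReal (mul_nonneg hCt0 hδ.1.le) hvol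
    have hδpos := hδ.1
    calc Cθ * (Cr / δ * ε) * volume.real S ≤ Cθ * (Cr / δ * ε) * (Ct * δ) := by gcongr
      _ = _ := by field_simp
  have hlim : Tendsto (fun δ => ∫ x in Kᶜ, η δ x * fderiv ℝ θ x (conj (H x))) (𝓝[>] 0)
      (𝓝 (∫ x in Kᶜ, fderiv ℝ θ x (conj (H x)))) := by
    refine tendsto_integral_filter_of_dominated_convergence
      (fun x => ‖fderiv ℝ θ x (conj (H x))‖) ?_ ?_ hint.norm ?_
    · filter_upwards [self_mem_nhdsWithin] with δ hδ
      obtain ⟨C, hC⟩ := hηlip δ hδ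
      exact hC.continuous.aestronglyMeasurable.mul hint.aestronglyMeasurable
    · refine Eventually.of_forall fun δ => ae_of_all _ fun x => ?_
      rw [norm_mul, Real.norm_of_nonneg (ramp_mem_Icc _).1]
      exact mul_le_of_le_one_left (norm_nonneg _) (ramp_mem_Icc _).2
    · refine (ae_restrict_iff' hKcl.measurableSet.compl).2 (ae_of_all _ fun x hx => ?_)
      refine tendsto_const_nhds.congr' ?_
      filter_upwards [Ioc_mem_nhdsGT (hdpos x hx)] with δ hδ
      rw [show η δ x = 1 from ramp_of_ge ((one_le_div hδ.1).2 hδ.2), one_mul]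
  have hlim0 : Tendsto (fun δ => ∫ x in Kᶜ, η δ x * fderiv ℝ θ x (conj (H x))) (𝓝[>] 0)
      (𝓝 0) := by
    refine Metric.tendsto_nhds.2 fun e he => ?_
    have hpos : 0 < Cθ * Cr * Ct + 1 := by positivity
    filter_upwards [hsmall (e / (Cθ * Cr * Ct + 1)) (by positivity), self_mem_nhdsWithin]
      with δ h1 hδ
    rw [hparts δ hδ, Real.dist_eq, sub_zero, abs_neg]
    refine h1.trans_lt ?_
    calc Cθ * Cr * (e / (Cθ * Cr * Ct + 1)) * Ct
        = e * ((Cθ * Cr * Ct) / (Cθ * Cr * Ct + 1)) := by ring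
      _ < e * 1 := by
        gcongr
        rw [div_lt_one hpos]; linarith
      _ = e := mul_one e
  exact tendsto_nhds_unique hlim hlim0

/-! ### Geometry of the lattice -/

theorem latticeVec_re (m n : ℤ) : (latticeVec m n).re = m := by simp [latticeVec]

theorem latticeVec_im (m n : ℤ) : (latticeVec m n).im = n := by simp [latticeVec]

theorem latticeVec_add (m n m' n' : ℤ) :
    latticeVec m n + latticeVec m' n' = latticeVec (m + m') (n + n') := by
  simp only [latticeVec]; push_cast; ring

theorem latticeVec_neg (m n : ℤ) : -latticeVec m n = latticeVec (-m) (-n) := by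
  simp only [latticeVec]; push_cast; ring

theorem latticeVec_zero : latticeVec 0 0 = 0 := by simp [latticeVec]

theorem closedCell_subset_superCell : closedCell ⊆ superCell := fun _ hx =>
  ⟨hx.1.trans_lt (by norm_num), hx.2.trans_lt (by norm_num)⟩

theorem isOpen_openCell : IsOpen openCell :=
  (isOpen_lt continuous_re.abs continuous_const).inter
    (isOpen_lt continuous_im.abs continuous_const)

theorem isClosed_closedCell : IsClosed closedCell :=
  (isClosed_le continuous_re.abs continuous_const).inter
    (isClosed_le continuous_im.abs continuous_const)

theorem isOpen_superCell : IsOpen superCell :=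
  (isOpen_lt continuous_re.abs continuous_const).inter
    (isOpen_lt continuous_im.abs continuous_const)

theorem isBounded_superCell : Bornology.IsBounded superCell := by
  refine isBounded_iff_forall_norm_le.2 ⟨3, fun x hx => ?_⟩
  refine (norm_le_abs_re_add_abs_im x).trans ?_
  linarith [hx.1, hx.2]

theorem isCompact_closedCell : IsCompact closedCell :=
  isCompact_of_isClosed_isBounded isClosed_closedCell
    (isBounded_superCell.subset closedCell_subset_superCell)

theorem openCell_subset_closedCell : openCell ⊆ closedCell := fun _ hx => ⟨hx.1.le, hx.2.le⟩

theorem closedCell_subset_closure_openCell : closedCell ⊆ closure openCell := by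
  intro x hx
  have hlim : Tendsto (fun s : ℝ => s • x) (𝓝[<] 1) (𝓝 x) := by
    have : Tendsto (fun s : ℝ => s • x) (𝓝 1) (𝓝 ((1 : ℝ) • x)) :=
      (continuous_id.smul continuous_const).tendsto 1
    rw [one_smul] at this
    exact this.mono_left nhdsWithin_le_nhds
  refine mem_closure_of_tendsto hlim ?_
  filter_upwards [Ioo_mem_nhdsLT (zero_lt_one' ℝ)] with s hs
  have key : ∀ a : ℝ, |a| ≤ 1 / 2 → |s * a| < 1 / 2 := fun a ha => by
    rw [abs_mul, abs_of_pos hs.1]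
    nlinarith [abs_nonneg a, hs.1, hs.2]
  exact ⟨by simpa using key _ hx.1, by simpa using key _ hx.2⟩

theorem mem_translate_iff {A : Set ℂ} {x : ℂ} {m n : ℤ} :
    x ∈ (fun x => x + latticeVec m n) '' A ↔ x - latticeVec m n ∈ A := by
  constructor
  · rintro ⟨y, hy, rfl⟩
    simpa using hy
  · exact fun h => ⟨_, h, by simp⟩

theorem locallyFinite_translates {ι : Type*} [Finite ι] {A : ι → Set ℂ}
    (hA : ∀ i, A i ⊆ superCell) :
    LocallyFinite fun p : ι × ℤ × ℤ => (fun x => x + latticeVec p.2.1 p.2.2) '' A p.1 := by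
  intro x₀
  refine ⟨ball x₀ 1, ball_mem_nhds _ one_pos, ?_⟩
  have key : ∀ (a b : ℝ) (m : ℤ), |b - m| < 3 / 2 → |b - a| < 1 →
      -- Any margin would do; the hypotheses give |m - a| < 5/2.
      m ∈ Icc (⌊a⌋ - 5) (⌊a⌋ + 5) := by
    intro a b m h1 h2
    rw [abs_lt] at h1 h2
    have h3 := Int.floor_le a
    have h4 := Int.lt_floor_add_one a
    constructor
    · have : ((⌊a⌋ - 5 : ℤ) : ℝ) ≤ m := by push_cast; linarith
      exact_mod_cast this
    · have : (m : ℝ) ≤ ((⌊a⌋ + 5 : ℤ) : ℝ) := by push_cast; linarith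
      exact_mod_cast this
  refine ((finite_univ (α := ι)).prod ((finite_Icc (⌊x₀.re⌋ - 5) (⌊x₀.re⌋ + 5)).prod
    (finite_Icc (⌊x₀.im⌋ - 5) (⌊x₀.im⌋ + 5)))).subset ?_
  rintro ⟨i, m, n⟩ ⟨z, hz, hzb⟩
  have hz' := hA i (mem_translate_iff.1 hz)
  simp only [superCell, mem_ofPred_eq, sub_re, sub_im, latticeVec_re, latticeVec_im] at hz'
  rw [mem_ball, dist_eq_norm] at hzb
  refine ⟨mem_univ _, key _ _ _ hz'.1 ?_, key _ _ _ hz'.2 ?_⟩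
  · exact (abs_re_le_norm (z - x₀)).trans_lt hzb
  · exact (abs_im_le_norm (z - x₀)).trans_lt hzb

theorem isClosed_translate {A : Set ℂ} (hA : IsClosed A) (c : ℂ) :
    IsClosed ((fun x => x + c) '' A) :=
  (Homeomorph.addRight c).isClosedMap _ hA

/-- The closed cells form a locally finite closed family, so near x₀ no cells appear other than
those through x₀. A property checked in these finitely many cells then holds in a full
neighbourhood. -/
theorem eventually_mem_cells (x₀ : ℂ) : ∀ᶠ x in 𝓝 x₀, ∀ m n : ℤ,
    x - latticeVec m n ∈ closedCell → x₀ - latticeVec m n ∈ closedCell := by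
  have h := (locallyFinite_translates (ι := Unit) (A := fun _ => closedCell)
    fun _ => closedCell_subset_superCell).eventually_subset
    (fun _ => isClosed_translate isClosed_closedCell _) x₀
  filter_upwards [h] with x hx m n hmn
  exact mem_translate_iff.1 (hx (a := ((), m, n)) (mem_translate_iff.2 hmn))

theorem finite_cells (x₀ : ℂ) :
    {p : ℤ × ℤ | x₀ - latticeVec p.1 p.2 ∈ closedCell}.Finite := by
  have h := (locallyFinite_translates (ι := Unit) (A := fun _ => closedCell)
    fun _ => closedCell_subset_superCell).point_finite x₀
  refine (h.image Prod.snd).subset ?_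
  rintro ⟨m, n⟩ hp
  exact ⟨((), m, n), mem_translate_iff.2 hp, rfl⟩

theorem sub_round_mem_closedCell (x : ℂ) :
    x - latticeVec (round x.re) (round x.im) ∈ closedCell := by
  refine ⟨?_, ?_⟩
  · rw [sub_re, latticeVec_re]; exact abs_sub_round _
  · rw [sub_im, latticeVec_im]; exact abs_sub_round _

namespace Inclusions

variable {K : ℕ} (S : Inclusions K)

theorem closure_lattice : closure S.lattice =
    ⋃ p : Fin K × ℤ × ℤ, (fun x => x + latticeVec p.2.1 p.2.2) '' closure (S.Ω p.1) := by
  have h1 : S.lattice =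
      ⋃ p : Fin K × ℤ × ℤ, (fun x => x + latticeVec p.2.1 p.2.2) '' S.Ω p.1 := by
    simp only [lattice, iUnion_prod']
  rw [h1, (locallyFinite_translates fun i =>
    subset_closure.trans (S.subset_superCell i)).closure_iUnion]
  congr 1
  funext p
  exact ((Homeomorph.addRight (latticeVec p.2.1 p.2.2)).image_closure _).symm

theorem mem_closure_lattice {x : ℂ} :
    x ∈ closure S.lattice ↔ ∃ i m n, x - latticeVec m n ∈ closure (S.Ω i) := by
  rw [closure_lattice, mem_iUnion]
  constructor
  · rintro ⟨⟨i, m, n⟩, h⟩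
    exact ⟨i, m, n, mem_translate_iff.1 h⟩
  · rintro ⟨i, m, n, h⟩
    exact ⟨(i, m, n), mem_translate_iff.2 h⟩

theorem mem_lattice {x : ℂ} : x ∈ S.lattice ↔ ∃ i m n, x - latticeVec m n ∈ S.Ω i := by
  simp only [lattice, mem_iUnion, mem_translate_iff]

theorem sub_latticeVec_mem_closure_lattice {x : ℂ} (m n : ℤ) :
    x - latticeVec m n ∈ closure S.lattice ↔ x ∈ closure S.lattice := by
  rw [mem_closure_lattice, mem_closure_lattice]
  constructor
  · rintro ⟨i, m', n', h⟩
    refine ⟨i, m + m', n + n', ?_⟩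
    rwa [← latticeVec_add, ← sub_sub]
  · rintro ⟨i, m', n', h⟩
    refine ⟨i, m' - m, n' - n, ?_⟩
    rwa [sub_sub, latticeVec_add, add_sub_cancel, add_sub_cancel]

theorem isOpen_lattice : IsOpen S.lattice := by
  refine isOpen_iUnion fun i => isOpen_iUnion fun m => isOpen_iUnion fun n => ?_
  exact (Homeomorph.addRight (latticeVec m n)).isOpenMap _ (S.isOpen i)

/-- The complement of all closed inclusions of the lattice other than `Ω i` itself. -/
def isolatingNhd (i : Fin K) : Set ℂ :=
  (⋃ p : {p : Fin K × ℤ × ℤ // p ≠ (i, 0, 0)},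
    (fun x => x + latticeVec p.1.2.1 p.1.2.2) '' closure (S.Ω p.1.1))ᶜ

theorem mem_isolatingNhd {i : Fin K} {x : ℂ} : x ∈ S.isolatingNhd i ↔
    ∀ j m n, (j, m, n) ≠ (i, (0 : ℤ), (0 : ℤ)) → x - latticeVec m n ∉ closure (S.Ω j) := by
  simp only [isolatingNhd, mem_compl_iff, mem_iUnion, mem_translate_iff, Subtype.exists,
    Prod.exists, not_exists]

theorem isOpen_isolatingNhd (i : Fin K) : IsOpen (S.isolatingNhd i) := by
  rw [isolatingNhd, isOpen_compl_iff]
  have h := (locallyFinite_translates S.subset_superCell).comp_injective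
    (Subtype.val_injective (p := fun p : Fin K × ℤ × ℤ => p ≠ (i, 0, 0)))
  exact h.isClosed_iUnion fun p => isClosed_translate isClosed_closure _

theorem closure_subset_isolatingNhd (i : Fin K) : closure (S.Ω i) ⊆ S.isolatingNhd i := by
  intro x hx
  rw [mem_isolatingNhd]
  intro j m n hne hx'
  exact (S.disjoint i j m n hne.symm).le_bot ⟨hx, mem_translate_iff.2 hx'⟩

theorem isolatingNhd_diff_closure (i : Fin K) :
    S.isolatingNhd i \ closure (S.Ω i) = (closure S.lattice)ᶜ := by
  ext x
  rw [Set.mem_sdiff, mem_isolatingNhd, mem_compl_iff, mem_closure_lattice]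
  constructor
  · rintro ⟨h1, h2⟩ ⟨j, m, n, h⟩
    by_cases he : (j, m, n) = (i, (0 : ℤ), (0 : ℤ))
    · simp only [Prod.mk.injEq] at he
      obtain ⟨rfl, rfl, rfl⟩ := he
      rw [latticeVec_zero, sub_zero] at h
      exact h2 h
    · exact h1 j m n he h
  · refine fun h => ⟨fun j m n _ hx => h ⟨j, m, n, hx⟩, fun hx => h ⟨i, 0, 0, ?_⟩⟩
    rwa [latticeVec_zero, sub_zero]

theorem isCompact_closure (i : Fin K) : IsCompact (closure (S.Ω i)) :=
  isCompact_of_isClosed_isBounded isClosed_closure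
    (isBounded_superCell.subset (S.subset_superCell i))

theorem γ_mem_frontier (i : Fin K) (t : ℝ) : S.γ i t ∈ frontier (S.Ω i) :=
  S.frontier_eq i ▸ mem_range_self t

theorem notMem_closure_range {i : Fin K} {x : ℂ} (h : x ∉ closure (S.Ω i)) :
    x ∉ closure (range (S.γ i)) := by
  rw [← S.frontier_eq, isClosed_frontier.closure_eq]
  exact fun hx => h (frontier_subset_closure hx)

/-- A segment joining two lattice-equivalent points is not covered by closed inclusions. -/
theorem exists_notMem_closure_lattice {W : ℝ → ℂ} (hW : Continuous W) {m n : ℤ}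
    (hmn : (m, n) ≠ (0, 0)) (hper : W (1 / 2) = W (-(1 / 2)) + latticeVec m n) :
    ∃ t ∈ Icc (-(1 / 2) : ℝ) (1 / 2), W t ∉ closure S.lattice := by
  by_contra! hcov
  have h0 : (-(1 / 2) : ℝ) ∈ Icc (-(1 / 2) : ℝ) (1 / 2) := ⟨le_rfl, by norm_num⟩
  have h1 : (1 / 2 : ℝ) ∈ Icc (-(1 / 2) : ℝ) (1 / 2) := ⟨by norm_num, le_rfl⟩
  obtain ⟨i, k, l, hi⟩ := S.mem_closure_lattice.1 (hcov _ h0)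
  have hpre : IsPreconnected ((fun t => W t - latticeVec k l) '' Icc (-(1 / 2) : ℝ) (1 / 2)) :=
    isPreconnected_Icc.image _ (hW.sub continuous_const).continuousOn
  -- If the segment were covered, connectedness would put it entirely in the one closed inclusion
  -- containing its start. Its end would then lie both in that inclusion and in a nontrivial
  -- translate of it, against disjointness.
  have hor := isPreconnected_iff_subset_of_disjoint_closed.1 hpre (closure (S.Ω i))
    (S.isolatingNhd i)ᶜ isClosed_closure (S.isOpen_isolatingNhd i).isClosed_compl
    (by
      rintro _ ⟨t, ht, rfl⟩
      by_contra hn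
      simp only [mem_union, mem_compl_iff, not_or, not_not] at hn
      have : W t - latticeVec k l ∈ (closure S.lattice)ᶜ := by
        rw [← S.isolatingNhd_diff_closure i]; exact ⟨hn.2, hn.1⟩
      exact this ((S.sub_latticeVec_mem_closure_lattice k l).2 (hcov t ht)))
    (by
      rw [eq_empty_iff_forall_notMem]
      rintro x ⟨-, hx, hx'⟩
      exact hx' (S.closure_subset_isolatingNhd i hx))
  rcases hor with hor | hor
  · have h2 : W (1 / 2) - latticeVec k l ∈ closure (S.Ω i) := hor ⟨_, h1, rfl⟩
    have h3 := S.mem_isolatingNhd.1 (S.closure_subset_isolatingNhd i h2) i m n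
      (fun h => hmn (by simpa using h))
    refine h3 ?_
    rw [hper]
    convert hi using 1
    ring
  · exact hor ⟨_, h0, rfl⟩ (S.closure_subset_isolatingNhd i hi)

end Inclusions

/-- A function that is analytic along a segment and vanishes on the part of its interior outside a
closed set not containing the segment vanishes near the segment. -/
theorem eventually_eq_zero_of_segment {F : ℂ → ℂ} {W : ℝ → ℂ} {C : Set ℂ} (hC : IsClosed C)
    (hW : Continuous W) (hinj : Function.Injective W)
    (hF : ∀ t ∈ Icc (-(1 / 2) : ℝ) (1 / 2), AnalyticAt ℂ F (W t))
    (hne : ∃ t ∈ Icc (-(1 / 2) : ℝ) (1 / 2), W t ∉ C)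
    (h0 : ∀ t ∈ Ioo (-(1 / 2) : ℝ) (1 / 2), W t ∉ C → F (W t) = 0) :
    ∀ t ∈ Icc (-(1 / 2) : ℝ) (1 / 2), ∀ᶠ x in 𝓝 (W t), F x = 0 := by
  have hlim : ∀ t, Tendsto W (𝓝[≠] t) (𝓝[≠] (W t)) := fun t =>
    (hW.tendsto t).mono_left nhdsWithin_le_nhds |> fun h =>
      tendsto_nhdsWithin_iff.2 ⟨h, by
        filter_upwards [self_mem_nhdsWithin] with s hs using fun he => hs (hinj he)⟩
  obtain ⟨t₀, ht₀, ht₀C⟩ := hne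
  have hopen : IsOpen {t | W t ∉ C} := hC.isOpen_compl.preimage hW
  have hmem : t₀ ∈ closure (Ioo (-(1 / 2) : ℝ) (1 / 2)) := by
    rwa [closure_Ioo (by norm_num)]
  -- The given uncovered point may be an endpoint; since being uncovered is an open condition, it
  -- can be moved into the interior.
  obtain ⟨t₁, ht₁C, ht₁⟩ := mem_closure_iff.1 hmem _ hopen ht₀C
  have ht₁' := Ioo_subset_Icc_self ht₁
  have hz : ∀ᶠ x in 𝓝 (W t₁), F x = 0 := by
    rw [← (hF t₁ ht₁').frequently_zero_iff_eventually_zero]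
    refine (hlim t₁).frequently (Eventually.frequently ?_)
    filter_upwards [nhdsWithin_le_nhds (hopen.mem_nhds ht₁C),
      nhdsWithin_le_nhds (isOpen_Ioo.mem_nhds ht₁)] with s hs hs' using h0 s hs' hs
  have hEq : EqOn F 0 (W '' Icc (-(1 / 2) : ℝ) (1 / 2)) :=
    AnalyticOnNhd.eqOn_zero_of_preconnected_of_eventuallyEq_zero
      (by rintro _ ⟨t, ht, rfl⟩; exact hF t ht)
      (isPreconnected_Icc.image _ hW.continuousOn) ⟨t₁, ht₁', rfl⟩ hz
  intro t ht
  rw [← (hF t ht).frequently_zero_iff_eventually_zero]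
  refine (hlim t).frequently ?_
  -- Accumulation within the closed interval also covers the endpoints, so F vanishes in full
  -- neighbourhoods of the corners.
  have hacc : (𝓝[Icc (-(1 / 2) : ℝ) (1 / 2) \ {t}] t).NeBot := by
    exact accPt_principal_iff_nhdsWithin.1
      (uniqueDiffOn_Icc (by norm_num) t ht).accPt
  have : ∃ᶠ s in 𝓝[Icc (-(1 / 2) : ℝ) (1 / 2) \ {t}] t, F (W s) = 0 := by
    refine Eventually.frequently ?_
    filter_upwards [self_mem_nhdsWithin] with s hs using hEq ⟨s, hs.1, rfl⟩
  exact this.filter_mono (nhdsWithin_mono _ fun s hs => hs.2)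

/-! ### Complex gradients of the representation -/

/-- The real-linear form `a ↦ Re (z a)`, i.e. the differential of a function with complex
gradient `z`. -/
def gradCLM : ℂ →L[ℝ] ℂ →L[ℝ] ℝ :=
  (ContinuousLinearMap.compL ℝ ℂ ℂ ℝ reCLM) ∘L (ContinuousLinearMap.mul ℝ ℂ)

theorem gradCLM_apply (z a : ℂ) : gradCLM z a = (z * a).re := rfl

theorem eq_complex_partial (A : ℂ →L[ℝ] ℝ) : A = gradCLM (A 1 - I * A I) := by
  ext w
  have hw : w = w.re • (1 : ℂ) + w.im • I := by apply Complex.ext <;> simp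
  conv_lhs => rw [hw]
  rw [map_add, map_smul, map_smul, gradCLM_apply]
  simp [mul_re]
  ring

/-- The complex gradient of `∑ j, ξ j * φ j`. -/
def proxyGrad {M : ℕ} (φ : Fin M → ℂ → ℝ) (ξ : Fin M → ℝ) (x : ℂ) : ℂ :=
  ∑ j, (ξ j : ℂ) * (fderiv ℝ (φ j) x 1 - I * fderiv ℝ (φ j) x I)

section Proxy

variable {M : ℕ} {φ : Fin M → ℂ → ℝ} (hφ : ∀ j, HarmonicOnNhd (φ j) closedCell) (ξ : Fin M → ℝ)

include hφ in
theorem analyticAt_proxyGrad {x : ℂ} (hx : x ∈ closedCell) : AnalyticAt ℂ (proxyGrad φ ξ) x :=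
  Finset.analyticAt_fun_sum _ fun j _ =>
    analyticAt_const.mul (HarmonicAt.analyticAt_complex_partial (hφ j x hx))

include hφ in
theorem hasFDerivAt_proxy {x : ℂ} (hx : x ∈ closedCell) :
    HasFDerivAt (fun x => ∑ j, ξ j * φ j x) (gradCLM (proxyGrad φ ξ x)) x := by
  have h1 : ∀ j, HasFDerivAt (φ j) (fderiv ℝ (φ j) x) x := fun j =>
    ((hφ j x hx).1.differentiableAt (by norm_num)).hasFDerivAt
  refine (HasFDerivAt.fun_sum fun j (_ : j ∈ Finset.univ) =>
    (h1 j).const_mul (ξ j)).congr_fderiv ?_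
  rw [proxyGrad, map_sum]
  refine Finset.sum_congr rfl fun j _ => ?_
  rw [← real_smul, map_smul, ← eq_complex_partial]

end Proxy

namespace Inclusions

variable {K : ℕ} (S : Inclusions K) (τ : ℂ → ℝ)

/-- The density of the single layer on `∂Ω i` with respect to the parameter of `γ i`. -/
def density (i : Fin K) (t : ℝ) : ℝ := τ (S.γ i t) * ‖deriv (S.γ i) t‖

/-- The complex gradient of the single-layer potential of `∂Ω i`. -/
def curveGrad (i : Fin K) : ℂ → ℂ := layerGrad (S.γ i) (S.density τ i)

/-- The complex gradient of the representation `u`. -/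
def repGrad {M : ℕ} (φ : Fin M → ℂ → ℝ) (ξ : Fin M → ℝ) (x : ℂ) : ℂ :=
  (∑ m ∈ Finset.Icc (-1 : ℤ) 1, ∑ n ∈ Finset.Icc (-1 : ℤ) 1, ∑ i,
    S.curveGrad τ i (x - latticeVec m n)) + proxyGrad φ ξ x

theorem continuous_γ (i : Fin K) : Continuous (S.γ i) := (S.contDiff i).continuous

theorem contDiff_one_γ (i : Fin K) : ContDiff ℝ 1 (S.γ i) := (S.contDiff i).of_le (by norm_num)

variable {τ}

theorem continuous_density (hτ : ContinuousOn τ S.bdry) (i : Fin K) :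
    Continuous (S.density τ i) := by
  refine Continuous.mul ?_ ((S.contDiff_one_γ i).continuous_deriv le_rfl).norm
  exact hτ.comp_continuous (S.continuous_γ i) fun t => mem_iUnion.2 ⟨i, S.γ_mem_frontier i t⟩

theorem analyticAt_curveGrad (hτ : ContinuousOn τ S.bdry) {i : Fin K} {x : ℂ}
    (hx : x ∉ closure (S.Ω i)) : AnalyticAt ℂ (S.curveGrad τ i) x :=
  analyticAt_layerGrad (S.continuous_γ i) (S.continuous_density hτ i) (S.notMem_closure_range hx)

theorem analyticAt_curveGrad_sub (hτ : ContinuousOn τ S.bdry) {i : Fin K} {x c : ℂ}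
    (hx : x - c ∉ closure (S.Ω i)) :
    AnalyticAt ℂ (fun x => S.curveGrad τ i (x - c)) x :=
  (S.analyticAt_curveGrad hτ hx).fun_comp (f := fun x => x - c)
    (analyticAt_id.sub analyticAt_const)

theorem singleLayer_eq (x : ℂ) : S.singleLayer τ x =
    ∑ i, ∫ t in (0 : ℝ)..(2 * Real.pi), greenG x (S.γ i t) * S.density τ i t := by
  simp only [singleLayer, arcIntegral, density, mul_assoc]

theorem nearLayer_eq (x : ℂ) : S.nearLayer τ x =
    ∑ m ∈ Finset.Icc (-1 : ℤ) 1, ∑ n ∈ Finset.Icc (-1 : ℤ) 1,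
      S.singleLayer τ (x - latticeVec m n) := by
  have hG : ∀ (x y c : ℂ), greenG x (y + c) = greenG (x - c) y := fun x y c => by
    simp only [greenG]
    congr 4
    ring
  simp only [nearLayer, singleLayer, hG]

theorem hasFDerivAt_singleLayer (hτ : ContinuousOn τ S.bdry) {x : ℂ}
    (hx : ∀ i, x ∉ closure (S.Ω i)) :
    HasFDerivAt (S.singleLayer τ) (gradCLM (∑ i, S.curveGrad τ i x)) x := by
  have h1 : S.singleLayer τ = fun x =>
      ∑ i, ∫ t in (0 : ℝ)..(2 * Real.pi), greenG x (S.γ i t) * S.density τ i t :=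
    funext S.singleLayer_eq
  rw [h1, map_sum]
  exact HasFDerivAt.fun_sum fun i _ => hasFDerivAt_layer (S.continuous_γ i)
    (S.continuous_density hτ i) (S.notMem_closure_range (hx i))

theorem sub_notMem_closure {x : ℂ} (hx : x ∉ closure S.lattice) (m n : ℤ) (i : Fin K) :
    x - latticeVec m n ∉ closure (S.Ω i) :=
  fun h => hx (S.mem_closure_lattice.2 ⟨i, m, n, h⟩)

theorem sum_shift_sub (f : ℤ → ℂ) : (∑ n ∈ Finset.Icc (-1 : ℤ) 1, f (n - 1)) -
    ∑ n ∈ Finset.Icc (-1 : ℤ) 1, f n = f (-2) - f 1 := by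
  rw [show Finset.Icc (-1 : ℤ) 1 = {-1, 0, 1} from rfl]
  norm_num
  ring

/-- A shift by one period permutes the images except for the outermost columns. For x on L the
surviving arguments x - (m e₁ + n e₂), with m = -2 or m = 1, have real part 3/2 or -3/2, just
outside the open super-cell, so the remaining layers are analytic along the whole wall. -/
theorem repGrad_add_one_sub {M : ℕ} (φ : Fin M → ℂ → ℝ) (ξ : Fin M → ℝ) (x : ℂ) :
    S.repGrad τ φ ξ (x + 1) - S.repGrad τ φ ξ x =
      ((∑ n ∈ Finset.Icc (-1 : ℤ) 1, ∑ i, S.curveGrad τ i (x - latticeVec (-2) n)) -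
        ∑ n ∈ Finset.Icc (-1 : ℤ) 1, ∑ i, S.curveGrad τ i (x - latticeVec 1 n)) +
        (proxyGrad φ ξ (x + 1) - proxyGrad φ ξ x) := by
  have hs : ∀ m n : ℤ, x + 1 - latticeVec m n = x - latticeVec (m - 1) n := fun m n => by
    simp only [latticeVec]; push_cast; ring
  simp only [repGrad, hs]
  rw [add_sub_add_comm, sum_shift_sub fun m => ∑ n ∈ Finset.Icc (-1 : ℤ) 1, ∑ i,
    S.curveGrad τ i (x - latticeVec m n)]

theorem repGrad_add_I_sub {M : ℕ} (φ : Fin M → ℂ → ℝ) (ξ : Fin M → ℝ) (x : ℂ) :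
    S.repGrad τ φ ξ (x + I) - S.repGrad τ φ ξ x =
      ((∑ m ∈ Finset.Icc (-1 : ℤ) 1, ∑ i, S.curveGrad τ i (x - latticeVec m (-2))) -
        ∑ m ∈ Finset.Icc (-1 : ℤ) 1, ∑ i, S.curveGrad τ i (x - latticeVec m 1)) +
        (proxyGrad φ ξ (x + I) - proxyGrad φ ξ x) := by
  have hs : ∀ m n : ℤ, x + I - latticeVec m n = x - latticeVec m (n - 1) := fun m n => by
    simp only [latticeVec]; push_cast; ring
  simp only [repGrad, hs]
  rw [add_sub_add_comm, ← Finset.sum_sub_distrib, ← Finset.sum_sub_distrib]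
  congr 1
  exact Finset.sum_congr rfl fun m _ =>
    sum_shift_sub fun n => ∑ i, S.curveGrad τ i (x - latticeVec m n)

section Rep

variable (hτ : ContinuousOn τ S.bdry) {M : ℕ} {φ : Fin M → ℂ → ℝ}
  (hφ : ∀ j, HarmonicOnNhd (φ j) closedCell) (ξ : Fin M → ℝ)

include hτ hφ

theorem analyticAt_repGrad {x : ℂ} (hx : x ∈ closedCell) (hx' : x ∉ closure S.lattice) :
    AnalyticAt ℂ (S.repGrad τ φ ξ) x := by
  refine AnalyticAt.add ?_ (analyticAt_proxyGrad hφ ξ hx)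
  exact Finset.analyticAt_fun_sum _ fun m _ => Finset.analyticAt_fun_sum _ fun n _ =>
    Finset.analyticAt_fun_sum _ fun i _ =>
      S.analyticAt_curveGrad_sub hτ (S.sub_notMem_closure hx' m n i)

theorem hasFDerivAt_rep {x : ℂ} (hx : x ∈ closedCell) (hx' : x ∉ closure S.lattice) :
    HasFDerivAt (S.rep τ φ ξ) (gradCLM (S.repGrad τ φ ξ x)) x := by
  have h1 : S.rep τ φ ξ = fun x => (∑ m ∈ Finset.Icc (-1 : ℤ) 1, ∑ n ∈ Finset.Icc (-1 : ℤ) 1,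
      S.singleLayer τ (x - latticeVec m n)) + ∑ j, ξ j * φ j x := by
    funext x
    rw [rep, nearLayer_eq]
  rw [h1, repGrad, map_add]
  refine HasFDerivAt.add ?_ (hasFDerivAt_proxy hφ ξ hx)
  simp only [map_sum (gradCLM) _ (Finset.Icc (-1 : ℤ) 1)]
  refine HasFDerivAt.fun_sum fun m _ => HasFDerivAt.fun_sum fun n _ => ?_
  have h2 := S.hasFDerivAt_singleLayer hτ fun i => S.sub_notMem_closure hx' m n i
  exact h2.comp x ((hasFDerivAt_id x).sub_const (latticeVec m n))

theorem fderiv_rep {x : ℂ} (hx : x ∈ closedCell) (hx' : x ∉ closure S.lattice) (a : ℂ) :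
    fderiv ℝ (S.rep τ φ ξ) x a = (S.repGrad τ φ ξ x * a).re := by
  rw [(S.hasFDerivAt_rep hτ hφ ξ hx hx').fderiv, gradCLM_apply]

end Rep

end Inclusions

/-! ### Wall conditions and the periodic continuation of the gradient -/

namespace Inclusions

variable {K : ℕ} (S : Inclusions K) {τ : ℂ → ℝ} (hτ : ContinuousOn τ S.bdry) {M : ℕ}
  {φ : Fin M → ℂ → ℝ} (hφ : ∀ j, HarmonicOnNhd (φ j) closedCell) (ξ : Fin M → ℝ)

theorem notMem_closure_of_notMem_superCell {i : Fin K} {x : ℂ} (hx : x ∉ superCell) :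
    x ∉ closure (S.Ω i) := fun h => hx (S.subset_superCell i h)

theorem wallL_mem {t : ℝ} (ht : t ∈ Icc (-(1 / 2) : ℝ) (1 / 2)) : wallL t ∈ closedCell := by
  refine ⟨?_, ?_⟩
  · simp [wallL, abs_of_pos]
  · simpa [wallL] using abs_le.2 ht

theorem wallR_mem {t : ℝ} (ht : t ∈ Icc (-(1 / 2) : ℝ) (1 / 2)) : wallR t ∈ closedCell := by
  refine ⟨?_, ?_⟩
  · simp [wallR, abs_of_pos]
  · simpa [wallR] using abs_le.2 ht

theorem wallD_mem {t : ℝ} (ht : t ∈ Icc (-(1 / 2) : ℝ) (1 / 2)) : wallD t ∈ closedCell := by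
  refine ⟨?_, ?_⟩
  · simpa [wallD] using abs_le.2 ht
  · simp [wallD, abs_of_pos]

theorem wallU_mem {t : ℝ} (ht : t ∈ Icc (-(1 / 2) : ℝ) (1 / 2)) : wallU t ∈ closedCell := by
  refine ⟨?_, ?_⟩
  · simpa [wallU] using abs_le.2 ht
  · simp [wallU, abs_of_pos]

theorem wallL_add_one (t : ℝ) : wallL t + 1 = wallR t := by simp only [wallL, wallR]; ring

theorem wallD_add_I (t : ℝ) : wallD t + I = wallU t := by simp only [wallD, wallU]; ring

theorem continuous_wallL : Continuous wallL := by unfold wallL; fun_prop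

theorem continuous_wallD : Continuous wallD := by unfold wallD; fun_prop

theorem wallL_injective : Function.Injective wallL := fun s t h => by
  simpa [wallL] using congrArg Complex.im h

theorem wallD_injective : Function.Injective wallD := fun s t h => by
  simpa [wallD] using congrArg Complex.re h

theorem hasDerivAt_wallL (t : ℝ) : HasDerivAt wallL I t := by
  have h := ((ofRealCLM.hasDerivAt (x := t)).mul_const I).const_add (-(1 / 2 : ℂ))
  rw [ofRealCLM_apply, ofReal_one, one_mul] at h
  exact h

theorem hasDerivAt_wallD (t : ℝ) : HasDerivAt wallD 1 t := by
  have h := (ofRealCLM.hasDerivAt (x := t)).sub_const ((1 / 2 : ℂ) * I)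
  rw [ofRealCLM_apply, ofReal_one] at h
  exact h

theorem add_mem_closure_lattice {x : ℂ} (m n : ℤ) :
    x + latticeVec m n ∈ closure S.lattice ↔ x ∈ closure S.lattice := by
  rw [← S.sub_latticeVec_mem_closure_lattice m n (x := x + latticeVec m n), add_sub_cancel_right]

theorem latticeVec_one_zero : latticeVec 1 0 = 1 := by simp [latticeVec]

theorem latticeVec_zero_one : latticeVec 0 1 = I := by simp [latticeVec]

include hτ hφ in
/-- Equality of the values of `u` along two parallel arcs, up to a constant, gives equality of the
tangential derivatives. -/
theorem tangential_eq {W W' : ℝ → ℂ} {d : ℂ} {t p : ℝ} (hW : HasDerivAt W d t)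
    (hW' : HasDerivAt W' d t) (hm : W t ∈ closedCell) (hm' : W' t ∈ closedCell)
    (hn : W t ∉ closure S.lattice) (hn' : W' t ∉ closure S.lattice)
    (hjump : ∀ᶠ s in 𝓝 t, S.rep τ φ ξ (W' s) - S.rep τ φ ξ (W s) = p) :
    ((S.repGrad τ φ ξ (W' t) - S.repGrad τ φ ξ (W t)) * d).re = 0 := by
  have h1 := ((S.hasFDerivAt_rep hτ hφ ξ hm' hn').comp_hasDerivAt t hW').sub
    ((S.hasFDerivAt_rep hτ hφ ξ hm hn).comp_hasDerivAt t hW)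
  have h2 : HasDerivAt (fun s => S.rep τ φ ξ (W' s) - S.rep τ φ ξ (W s)) 0 t :=
    (hasDerivAt_const t p).congr_of_eventuallyEq hjump
  have h3 := h1.unique h2
  rw [gradCLM_apply, gradCLM_apply] at h3
  rw [sub_mul, sub_re, h3]

include hτ hφ in
-- On the uncovered part of L the flux condition gives equality of the normal derivatives and the
-- constant jump gives equality of the tangential ones, so the complex gradients agree there. Their
-- difference is analytic along all of L by telescoping, and the identity theorem extends the
-- equality across the covered parts.
theorem eventually_repGrad_add_one {p₁ p₂ : ℝ} (hu : S.SolvesCellBVP (S.rep τ φ ξ) p₁ p₂) :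
    ∀ t ∈ Icc (-(1 / 2) : ℝ) (1 / 2), ∀ᶠ x in 𝓝 (wallL t),
      S.repGrad τ φ ξ (x + 1) - S.repGrad τ φ ξ x = 0 := by
  have hshift : ∀ t, wallL t ∉ closure S.lattice → wallR t ∉ closure S.lattice := fun t h => by
    rwa [← wallL_add_one, ← latticeVec_one_zero, S.add_mem_closure_lattice]
  refine eventually_eq_zero_of_segment isClosed_closure continuous_wallL wallL_injective ?_
    (S.exists_notMem_closure_lattice continuous_wallL (m := 0) (n := 1) (by simp) ?_) ?_
  · intro t ht
    rw [funext (S.repGrad_add_one_sub φ ξ)]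
    have hre : ∀ (m n : ℤ), |(-(1 / 2) - m : ℝ)| = 3 / 2 →
        wallL t - latticeVec m n ∉ superCell := fun m n h hm => by
      have := hm.1
      rw [sub_re, latticeVec_re, show (wallL t).re = -(1 / 2) by simp [wallL], h] at this
      exact lt_irrefl _ this
    refine AnalyticAt.add (AnalyticAt.sub ?_ ?_) (AnalyticAt.sub ?_ ?_)
    · exact Finset.analyticAt_fun_sum _ fun n _ => Finset.analyticAt_fun_sum _ fun i _ =>
        S.analyticAt_curveGrad_sub hτ (S.notMem_closure_of_notMem_superCell
          (hre _ _ (by norm_num [abs_of_pos])))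
    · exact Finset.analyticAt_fun_sum _ fun n _ => Finset.analyticAt_fun_sum _ fun i _ =>
        S.analyticAt_curveGrad_sub hτ (S.notMem_closure_of_notMem_superCell
          (hre _ _ (by norm_num [abs_of_neg])))
    · refine AnalyticAt.fun_comp (f := fun x => x + 1) ?_ (analyticAt_id.add analyticAt_const)
      rw [wallL_add_one]
      exact analyticAt_proxyGrad hφ ξ (wallR_mem ht)
    · exact analyticAt_proxyGrad hφ ξ (wallL_mem ht)
  · rw [latticeVec_zero_one]; simp only [wallL]; push_cast; ring
  · intro t ht hn
    have ht' := Ioo_subset_Icc_self ht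
    have hn' := hshift t hn
    have h1 := hu.flux_LR t ht' hn
    rw [S.fderiv_rep hτ hφ ξ (wallR_mem ht') hn', S.fderiv_rep hτ hφ ξ (wallL_mem ht') hn,
      mul_one, mul_one, ← sub_re] at h1
    have h2 := S.tangential_eq hτ hφ ξ (hasDerivAt_wallL t)
      (W' := wallR) (by
        have := (hasDerivAt_wallL t).add_const 1
        rwa [funext wallL_add_one] at this) (wallL_mem ht') (wallR_mem ht') hn hn' (p := p₁)
      (by
        filter_upwards [(isClosed_closure.isOpen_compl.preimage continuous_wallL).mem_nhds hn,
          isOpen_Ioo.mem_nhds ht] with s hs hs'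
        exact hu.jump_LR s (Ioo_subset_Icc_self hs') hs)
    rw [wallL_add_one]
    refine Complex.ext (by simpa using h1) ?_
    rw [mul_I_re] at h2
    exact neg_eq_zero.1 h2

include hτ hφ in
theorem eventually_repGrad_add_I {p₁ p₂ : ℝ} (hu : S.SolvesCellBVP (S.rep τ φ ξ) p₁ p₂) :
    ∀ t ∈ Icc (-(1 / 2) : ℝ) (1 / 2), ∀ᶠ x in 𝓝 (wallD t),
      S.repGrad τ φ ξ (x + I) - S.repGrad τ φ ξ x = 0 := by
  have hshift : ∀ t, wallD t ∉ closure S.lattice → wallU t ∉ closure S.lattice := fun t h => by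
    rwa [← wallD_add_I, ← latticeVec_zero_one, S.add_mem_closure_lattice]
  refine eventually_eq_zero_of_segment isClosed_closure continuous_wallD wallD_injective ?_
    (S.exists_notMem_closure_lattice continuous_wallD (m := 1) (n := 0) (by simp) ?_) ?_
  · intro t ht
    rw [funext (S.repGrad_add_I_sub φ ξ)]
    have him : ∀ (m n : ℤ), |(-(1 / 2) - n : ℝ)| = 3 / 2 →
        wallD t - latticeVec m n ∉ superCell := fun m n h hm => by
      have := hm.2
      rw [sub_im, latticeVec_im, show (wallD t).im = -(1 / 2) by simp [wallD], h] at this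
      exact lt_irrefl _ this
    refine AnalyticAt.add (AnalyticAt.sub ?_ ?_) (AnalyticAt.sub ?_ ?_)
    · exact Finset.analyticAt_fun_sum _ fun n _ => Finset.analyticAt_fun_sum _ fun i _ =>
        S.analyticAt_curveGrad_sub hτ (S.notMem_closure_of_notMem_superCell
          (him _ _ (by norm_num [abs_of_pos])))
    · exact Finset.analyticAt_fun_sum _ fun n _ => Finset.analyticAt_fun_sum _ fun i _ =>
        S.analyticAt_curveGrad_sub hτ (S.notMem_closure_of_notMem_superCell
          (him _ _ (by norm_num [abs_of_neg])))
    · refine AnalyticAt.fun_comp (f := fun x => x + I) ?_ (analyticAt_id.add analyticAt_const)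
      rw [wallD_add_I]
      exact analyticAt_proxyGrad hφ ξ (wallU_mem ht)
    · exact analyticAt_proxyGrad hφ ξ (wallD_mem ht)
  · rw [latticeVec_one_zero]; simp only [wallD]; push_cast; ring
  · intro t ht hn
    have ht' := Ioo_subset_Icc_self ht
    have hn' := hshift t hn
    have h1 := hu.flux_DU t ht' hn
    rw [S.fderiv_rep hτ hφ ξ (wallU_mem ht') hn', S.fderiv_rep hτ hφ ξ (wallD_mem ht') hn,
      ← sub_re, ← sub_mul, mul_I_re] at h1
    have h2 := S.tangential_eq hτ hφ ξ (hasDerivAt_wallD t)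
      (W' := wallU) (by
        have := (hasDerivAt_wallD t).add_const I
        rwa [funext wallD_add_I] at this) (wallD_mem ht') (wallU_mem ht') hn hn' (p := p₂)
      (by
        filter_upwards [(isClosed_closure.isOpen_compl.preimage continuous_wallD).mem_nhds hn,
          isOpen_Ioo.mem_nhds ht] with s hs hs'
        exact hu.jump_DU s (Ioo_subset_Icc_self hs') hs)
    rw [wallD_add_I]
    refine Complex.ext (by simpa using h2) ?_
    exact neg_eq_zero.1 h1

variable (τ φ) in
/-- The complex gradient of `u` on the unit cell, continued periodically to the plane. -/
def periodicGrad (x : ℂ) : ℂ :=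
  S.repGrad τ φ ξ (x - latticeVec (round x.re) (round x.im))

theorem int_eq_of_mem_cell {a : ℝ} {m m' : ℤ} (h : |a - m| ≤ 1 / 2) (h' : |a - m'| ≤ 1 / 2) :
    m' = m ∨ (m' = m + 1 ∧ a - m' = -(1 / 2)) ∨ (m = m' + 1 ∧ a - m = -(1 / 2)) := by
  rw [abs_le] at h h'
  have h1 : (m' : ℝ) - m ≤ 1 := by linarith
  have h2 : (m : ℝ) - m' ≤ 1 := by linarith
  have h1' : m' - m ≤ 1 := by exact_mod_cast h1
  have h2' : m - m' ≤ 1 := by exact_mod_cast h2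
  have h3 : m' = m ∨ m' = m + 1 ∨ m = m' + 1 := by omega
  rcases h3 with h3 | h3 | h3
  · exact Or.inl h3
  · refine Or.inr (Or.inl ⟨h3, ?_⟩)
    have : (m' : ℝ) = m + 1 := by exact_mod_cast h3
    linarith
  · refine Or.inr (Or.inr ⟨h3, ?_⟩)
    have : (m : ℝ) = m' + 1 := by exact_mod_cast h3
    linarith

include hτ hφ in
theorem eventually_repGrad_re_shift {p₁ p₂ : ℝ} (hu : S.SolvesCellBVP (S.rep τ φ ξ) p₁ p₂)
    {x₀ : ℂ} {m m' n : ℤ} (h : x₀ - latticeVec m n ∈ closedCell)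
    (h' : x₀ - latticeVec m' n ∈ closedCell) : ∀ᶠ x in 𝓝 x₀,
      S.repGrad τ φ ξ (x - latticeVec m n) = S.repGrad τ φ ξ (x - latticeVec m' n) := by
  have core : ∀ k : ℤ, x₀ - latticeVec (k + 1) n ∈ closedCell →
      x₀.re - (k + 1 : ℤ) = -(1 / 2) → ∀ᶠ x in 𝓝 x₀,
      S.repGrad τ φ ξ (x - latticeVec k n) = S.repGrad τ φ ξ (x - latticeVec (k + 1) n) := by
    intro k hk hk'
    have him := hk.2
    have hL : x₀ - latticeVec (k + 1) n = wallL (x₀ - latticeVec (k + 1) n).im := by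
      apply Complex.ext
      · rw [sub_re, latticeVec_re, hk']; simp [wallL]
      · simp [wallL]
    have h1 := S.eventually_repGrad_add_one hτ hφ ξ hu _ (abs_le.1 him)
    rw [← hL] at h1
    have h2 : Tendsto (fun x => x - latticeVec (k + 1) n) (𝓝 x₀)
        (𝓝 (x₀ - latticeVec (k + 1) n)) := (continuous_id.sub continuous_const).tendsto _
    filter_upwards [h2.eventually h1] with x hx
    rw [← sub_eq_zero.1 hx]
    congr 1
    simp only [latticeVec]; push_cast; ring
  have hr := h.1
  have hr' := h'.1
  rw [sub_re, latticeVec_re] at hr hr'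
  rcases int_eq_of_mem_cell hr hr' with rfl | ⟨rfl, he⟩ | ⟨rfl, he⟩
  · exact Eventually.of_forall fun _ => rfl
  · exact core m h' he
  · filter_upwards [core m' h he] with x hx using hx.symm

include hτ hφ in
theorem eventually_repGrad_im_shift {p₁ p₂ : ℝ} (hu : S.SolvesCellBVP (S.rep τ φ ξ) p₁ p₂)
    {x₀ : ℂ} {m n n' : ℤ} (h : x₀ - latticeVec m n ∈ closedCell)
    (h' : x₀ - latticeVec m n' ∈ closedCell) : ∀ᶠ x in 𝓝 x₀,
      S.repGrad τ φ ξ (x - latticeVec m n) = S.repGrad τ φ ξ (x - latticeVec m n') := by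
  have core : ∀ k : ℤ, x₀ - latticeVec m (k + 1) ∈ closedCell →
      x₀.im - (k + 1 : ℤ) = -(1 / 2) → ∀ᶠ x in 𝓝 x₀,
      S.repGrad τ φ ξ (x - latticeVec m k) = S.repGrad τ φ ξ (x - latticeVec m (k + 1)) := by
    intro k hk hk'
    have hre := hk.1
    have hD : x₀ - latticeVec m (k + 1) = wallD (x₀ - latticeVec m (k + 1)).re := by
      apply Complex.ext
      · simp [wallD]
      · rw [sub_im, latticeVec_im, hk']; simp [wallD]
    have h1 := S.eventually_repGrad_add_I hτ hφ ξ hu _ (abs_le.1 hre)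
    rw [← hD] at h1
    have h2 : Tendsto (fun x => x - latticeVec m (k + 1)) (𝓝 x₀)
        (𝓝 (x₀ - latticeVec m (k + 1))) := (continuous_id.sub continuous_const).tendsto _
    filter_upwards [h2.eventually h1] with x hx
    rw [← sub_eq_zero.1 hx]
    congr 1
    simp only [latticeVec]; push_cast; ring
  have hr := h.2
  have hr' := h'.2
  rw [sub_im, latticeVec_im] at hr hr'
  rcases int_eq_of_mem_cell hr hr' with rfl | ⟨rfl, he⟩ | ⟨rfl, he⟩
  · exact Eventually.of_forall fun _ => rfl
  · exact core n h' he
  · filter_upwards [core n' h he] with x hx using hx.symm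

include hτ hφ in
/-- Near any point, the periodic gradient is the translate of the gradient of `u` from any of the
closed cells containing the point. -/
theorem eventually_periodicGrad_eq {p₁ p₂ : ℝ} (hu : S.SolvesCellBVP (S.rep τ φ ξ) p₁ p₂)
    {x₀ : ℂ} {m n : ℤ} (h : x₀ - latticeVec m n ∈ closedCell) : ∀ᶠ x in 𝓝 x₀,
      S.periodicGrad τ φ ξ x = S.repGrad τ φ ξ (x - latticeVec m n) := by
  have h1 : ∀ᶠ x in 𝓝 x₀, ∀ p ∈ {p : ℤ × ℤ | x₀ - latticeVec p.1 p.2 ∈ closedCell},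
      S.repGrad τ φ ξ (x - latticeVec p.1 p.2) = S.repGrad τ φ ξ (x - latticeVec m n) := by
    rw [(finite_cells x₀).eventually_all]
    rintro ⟨m', n'⟩ hp
    -- Two cells through x₀ are linked by a third sharing a column with one and a row with the
    -- other; this settles the corners.
    have hmid : x₀ - latticeVec m n' ∈ closedCell := by
      refine ⟨?_, ?_⟩
      · have := h.1; rwa [sub_re, latticeVec_re] at this ⊢
      · have := hp.2; rwa [sub_im, latticeVec_im] at this ⊢
    filter_upwards [S.eventually_repGrad_re_shift hτ hφ ξ hu hp hmid,
      S.eventually_repGrad_im_shift hτ hφ ξ hu hmid h] with x hx hx'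
    exact hx.trans hx'
  filter_upwards [h1, eventually_mem_cells x₀] with x hx hx'
  exact hx (round x.re, round x.im) (hx' _ _ (sub_round_mem_closedCell x))

end Inclusions

namespace Inclusions

variable {K : ℕ} (S : Inclusions K) {τ : ℂ → ℝ} (hτ : ContinuousOn τ S.bdry) {M : ℕ}
  {φ : Fin M → ℂ → ℝ} (hφ : ∀ j, HarmonicOnNhd (φ j) closedCell) (ξ : Fin M → ℝ)
  {p₁ p₂ : ℝ} (hu : S.SolvesCellBVP (S.rep τ φ ξ) p₁ p₂)

include hτ hφ hu

/-! ### Structure of the periodic gradient near an inclusion -/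

theorem analyticAt_periodicGrad {x₀ : ℂ} (hx : x₀ ∉ closure S.lattice) :
    AnalyticAt ℂ (S.periodicGrad τ φ ξ) x₀ := by
  have hc := sub_round_mem_closedCell x₀
  have hn := mt (S.sub_latticeVec_mem_closure_lattice (round x₀.re) (round x₀.im)).1 hx
  have h1 : AnalyticAt ℂ (fun x => S.repGrad τ φ ξ
      (x - latticeVec (round x₀.re) (round x₀.im))) x₀ :=
    (S.analyticAt_repGrad hτ hφ ξ hc hn).fun_comp
      (f := fun x => x - latticeVec (round x₀.re) (round x₀.im))
      (analyticAt_id.sub analyticAt_const)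
  exact h1.congr ((S.eventually_periodicGrad_eq hτ hφ ξ hu hc).mono fun _ hx => hx.symm)

/-- Since `Ω i` lies in the super-cell, a cell containing a point of its closure has indices in {-1,
0, 1}, so the layer of `Ω i` itself is one of the nine images used there. Once it is removed, every
other image is evaluated off its own inclusion, because the point avoids all other closed inclusions
of the lattice. -/
theorem analyticAt_periodicGrad_sub_curveGrad {i : Fin K} {x₀ : ℂ} (hx : x₀ ∈ S.isolatingNhd i) :
    AnalyticAt ℂ (fun x => S.periodicGrad τ φ ξ x - S.curveGrad τ i x) x₀ := by
  by_cases hxi : x₀ ∈ closure (S.Ω i)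
  swap
  · refine (S.analyticAt_periodicGrad hτ hφ ξ hu ?_).sub (S.analyticAt_curveGrad hτ hxi)
    have : x₀ ∈ S.isolatingNhd i \ closure (S.Ω i) := ⟨hx, hxi⟩
    rwa [isolatingNhd_diff_closure] at this
  have hc := sub_round_mem_closedCell x₀
  set m := round x₀.re with hm
  set n := round x₀.im with hn
  have hsc := S.subset_superCell i hxi
  have key : ∀ (a : ℝ) (k : ℤ), |a| < 3 / 2 → |a - k| ≤ 1 / 2 → -k ∈ Finset.Icc (-1 : ℤ) 1 := by
    intro a k h1 h2
    rw [abs_lt] at h1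
    rw [abs_le] at h2
    have h3 : (k : ℝ) < 2 := by linarith
    have h4 : (-2 : ℝ) < k := by linarith
    have h3' : k < 2 := by exact_mod_cast h3
    have h4' : -2 < k := by exact_mod_cast h4
    rw [Finset.mem_Icc]
    omega
  have hmN : -m ∈ Finset.Icc (-1 : ℤ) 1 :=
    key x₀.re m hsc.1 (by have := hc.1; rwa [sub_re, latticeVec_re] at this)
  have hnN : -n ∈ Finset.Icc (-1 : ℤ) 1 :=
    key x₀.im n hsc.2 (by have := hc.2; rwa [sub_im, latticeVec_im] at this)
  -- The self-term is the summand with m' = -m, n' = -n, j = i; it is subtracted inside the sum so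
  -- that analyticity can be checked term by term.
  have heq : ∀ x, S.repGrad τ φ ξ (x - latticeVec m n) - S.curveGrad τ i x =
      (∑ m' ∈ Finset.Icc (-1 : ℤ) 1, ∑ n' ∈ Finset.Icc (-1 : ℤ) 1, ∑ j,
        (S.curveGrad τ j (x - latticeVec (m + m') (n + n')) -
          if m' = -m ∧ n' = -n ∧ j = i then S.curveGrad τ i x else 0)) +
        proxyGrad φ ξ (x - latticeVec m n) := by
    intro x
    have h1 : ∑ m' ∈ Finset.Icc (-1 : ℤ) 1, ∑ n' ∈ Finset.Icc (-1 : ℤ) 1, ∑ j,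
        (if m' = -m ∧ n' = -n ∧ j = i then S.curveGrad τ i x else 0) = S.curveGrad τ i x := by
      simp only [ite_and]
      rw [Finset.sum_eq_single_of_mem _ hmN (fun k _ hk => by simp [hk]),
        Finset.sum_eq_single_of_mem _ hnN (fun k _ hk => by simp [hk])]
      simp
    simp only [Finset.sum_sub_distrib, h1, repGrad, sub_sub, latticeVec_add]
    ring
  have h2 : AnalyticAt ℂ
      (fun x => S.repGrad τ φ ξ (x - latticeVec m n) - S.curveGrad τ i x) x₀ := by
    rw [funext heq]
    refine AnalyticAt.add ?_ ((analyticAt_proxyGrad hφ ξ hc).fun_comp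
      (f := fun x => x - latticeVec m n) (analyticAt_id.sub analyticAt_const))
    refine Finset.analyticAt_fun_sum _ fun m' _ => Finset.analyticAt_fun_sum _ fun n' _ =>
      Finset.analyticAt_fun_sum _ fun j _ => ?_
    by_cases hcond : m' = -m ∧ n' = -n ∧ j = i
    · obtain ⟨rfl, rfl, rfl⟩ := hcond
      simp only [add_neg_cancel, latticeVec_zero, sub_zero, and_self, if_true, sub_self]
      exact analyticAt_const
    · simp only [if_neg hcond, sub_zero]
      refine S.analyticAt_curveGrad_sub hτ (S.mem_isolatingNhd.1 hx j _ _ fun h => hcond ?_)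
      simp only [Prod.mk.injEq] at h
      exact ⟨by linarith [h.2.1], by linarith [h.2.2], h.1⟩
  refine h2.congr ?_
  filter_upwards [S.eventually_periodicGrad_eq hτ hφ ξ hu hc] with x hx
  rw [hx]

theorem integrableOn_periodicGrad {i : Fin K} {k : Set ℂ} (hk : IsCompact k)
    (hki : k ⊆ S.isolatingNhd i) : IntegrableOn (S.periodicGrad τ φ ξ) k := by
  have h1 : IntegrableOn (S.curveGrad τ i) k :=
    (locallyIntegrable_layerGrad (S.continuous_γ i) (S.continuous_density hτ i)).integrableOn_isCompact
      hk
  have h2 : IntegrableOn (fun x => S.periodicGrad τ φ ξ x - S.curveGrad τ i x) k :=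
    ContinuousOn.integrableOn_compact hk fun x hx =>
      (S.analyticAt_periodicGrad_sub_curveGrad hτ hφ ξ hu (hki hx)).continuousAt.continuousWithinAt
  refine (h1.add h2).congr (ae_of_all _ fun x => ?_)
  simp

/-! ### The Neumann condition for the periodic gradient -/

omit hu in
-- The Neumann hypothesis gives limits from the open cell only, whereas gluing neighbouring cells
-- also requires points on the walls. There g is continuous off the inclusions and hence a limit of
-- values from the open cell, so the same limit persists.
theorem tendsto_repGrad {q : ℂ} {A : ℂ →L[ℝ] ℝ}
    (hA : Tendsto (fderiv ℝ (S.rep τ φ ξ)) (𝓝[openCell \ closure S.lattice] q) (𝓝 A)) :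
    Tendsto (S.repGrad τ φ ξ) (𝓝[closedCell \ closure S.lattice] q) (𝓝 (A 1 - I * A I)) := by
  have h1 : Tendsto (S.repGrad τ φ ξ) (𝓝[openCell \ closure S.lattice] q)
      (𝓝 (A 1 - I * A I)) := by
    have hcont : Continuous fun B : ℂ →L[ℝ] ℝ => ((B 1 : ℝ) : ℂ) - I * ((B I : ℝ) : ℂ) := by
      fun_prop
    refine ((hcont.tendsto A).comp hA).congr' ?_
    filter_upwards [self_mem_nhdsWithin] with x hx
    simp only [Function.comp_apply]
    rw [S.fderiv_rep hτ hφ ξ (openCell_subset_closedCell hx.1) hx.2,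
      S.fderiv_rep hτ hφ ξ (openCell_subset_closedCell hx.1) hx.2]
    apply Complex.ext <;> simp
  refine (nhds_basis_closedBall.tendsto_right_iff).2 fun ε hε => ?_
  have h2 := h1.eventually (closedBall_mem_nhds _ hε)
  obtain ⟨W, hW, hqW, hWsub⟩ := mem_nhdsWithin.1 h2
  filter_upwards [mem_nhdsWithin_of_mem_nhds (hW.mem_nhds hqW), self_mem_nhdsWithin] with x hxW hx
  have hopen : IsOpen (W ∩ (closure S.lattice)ᶜ) := hW.inter isClosed_closure.isOpen_compl
  have hcl : x ∈ closure (W ∩ (closure S.lattice)ᶜ ∩ openCell) :=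
    hopen.inter_closure ⟨⟨hxW, hx.2⟩, closedCell_subset_closure_openCell hx.1⟩
  have hne := mem_closure_iff_nhdsWithin_neBot.1 hcl
  have hct : Tendsto (S.repGrad τ φ ξ) (𝓝[W ∩ (closure S.lattice)ᶜ ∩ openCell] x)
      (𝓝 (S.repGrad τ φ ξ x)) :=
    (S.analyticAt_repGrad hτ hφ ξ hx.1 hx.2).continuousAt.tendsto.mono_left nhdsWithin_le_nhds
  refine isClosed_closedBall.mem_of_tendsto hct ?_
  filter_upwards [self_mem_nhdsWithin] with y hy
  exact hWsub ⟨hy.1.1, hy.2, hy.1.2⟩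

/-- At each boundary point in the closed cell the gradient has a limit, with zero normal part. -/
theorem exists_tendsto_repGrad (i : Fin K) (t : ℝ) (m n : ℤ)
    (h : S.γ i t + latticeVec m n ∈ closedCell) : ∃ a : ℂ,
      Tendsto (S.repGrad τ φ ξ) (𝓝[closedCell \ closure S.lattice] (S.γ i t + latticeVec m n))
        (𝓝 a) ∧ (a * S.normal i t).re = 0 := by
  obtain ⟨A, hA, hn⟩ := hu.neumann i t m n h
  refine ⟨_, S.tendsto_repGrad hτ hφ ξ hA, ?_⟩
  rwa [eq_complex_partial A, gradCLM_apply] at hn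

theorem eventually_periodicGrad {p : ℂ} {P : ℂ → Prop}
    (hP : ∀ m n, p - latticeVec m n ∈ closedCell →
      ∀ᶠ y in 𝓝[closedCell \ closure S.lattice] (p - latticeVec m n), P (S.repGrad τ φ ξ y)) :
    ∀ᶠ x in 𝓝[(closure S.lattice)ᶜ] p, P (S.periodicGrad τ φ ξ x) := by
  have h1 : ∀ᶠ x in 𝓝 p, ∀ q ∈ {q : ℤ × ℤ | p - latticeVec q.1 q.2 ∈ closedCell},
      x - latticeVec q.1 q.2 ∈ closedCell → x ∉ closure S.lattice →
        P (S.periodicGrad τ φ ξ x) := by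
    rw [(finite_cells p).eventually_all]
    rintro ⟨m, n⟩ hq
    have h2 := eventually_nhdsWithin_iff.1 (hP m n hq)
    have h3 : Tendsto (fun x => x - latticeVec m n) (𝓝 p) (𝓝 (p - latticeVec m n)) :=
      (continuous_id.sub continuous_const).tendsto _
    filter_upwards [h3.eventually h2, S.eventually_periodicGrad_eq hτ hφ ξ hu hq]
      with x hx hx' hxc hxn
    rw [hx']
    exact hx ⟨hxc, mt (S.sub_latticeVec_mem_closure_lattice m n).1 hxn⟩
  rw [eventually_nhdsWithin_iff]
  filter_upwards [h1, eventually_mem_cells p] with x hx hx' hxn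
  have hc := sub_round_mem_closedCell x
  exact hx (round x.re, round x.im) (hx' _ _ hc) hc hxn

theorem periodicGrad_bounded (i : Fin K) (t : ℝ) : ∃ C,
    ∀ᶠ x in 𝓝[(closure S.lattice)ᶜ] (S.γ i t), ‖S.periodicGrad τ φ ξ x‖ ≤ C := by
  have h1 : ∀ q : ℤ × ℤ, ∃ C : ℝ, 0 ≤ C ∧ (S.γ i t - latticeVec q.1 q.2 ∈ closedCell →
      ∀ᶠ y in 𝓝[closedCell \ closure S.lattice] (S.γ i t - latticeVec q.1 q.2),
        ‖S.repGrad τ φ ξ y‖ ≤ C) := by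
    rintro ⟨m, n⟩
    by_cases hq : S.γ i t - latticeVec m n ∈ closedCell
    · rw [sub_eq_add_neg, latticeVec_neg] at hq
      obtain ⟨a, ha, -⟩ := S.exists_tendsto_repGrad hτ hφ ξ hu i t _ _ hq
      refine ⟨‖a‖ + 1, by positivity, fun _ => ?_⟩
      rw [sub_eq_add_neg, latticeVec_neg]
      filter_upwards [ha.norm.eventually (gt_mem_nhds (lt_add_one _))] with y hy using hy.le
    · exact ⟨0, le_rfl, fun h => absurd h hq⟩
  choose C hC0 hC using h1
  refine ⟨∑ q ∈ (finite_cells (S.γ i t)).toFinset, C q,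
    S.eventually_periodicGrad hτ hφ ξ hu (P := fun z => ‖z‖ ≤ _) fun m n hq => ?_⟩
  filter_upwards [hC (m, n) hq] with y hy
  exact hy.trans (Finset.single_le_sum (fun q _ => hC0 q) ((finite_cells _).mem_toFinset.2 hq))

theorem tendsto_periodicGrad_normal (i : Fin K) (t : ℝ) :
    Tendsto (fun x => (S.periodicGrad τ φ ξ x * S.normal i t).re)
      (𝓝[(closure S.lattice)ᶜ] (S.γ i t)) (𝓝 0) := by
  refine (nhds_basis_ball.tendsto_right_iff).2 fun ε hε => ?_
  refine S.eventually_periodicGrad hτ hφ ξ hu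
    (P := fun z => (z * S.normal i t).re ∈ ball (0 : ℝ) ε) fun m n hq => ?_
  rw [sub_eq_add_neg, latticeVec_neg] at hq ⊢
  obtain ⟨a, ha, hn⟩ := S.exists_tendsto_repGrad hτ hφ ξ hu i t _ _ hq
  have h1 : Tendsto (fun y => (S.repGrad τ φ ξ y * S.normal i t).re)
      (𝓝[closedCell \ closure S.lattice] (S.γ i t + latticeVec (-m) (-n))) (𝓝 0) := by
    rw [← hn]
    exact (continuous_re.tendsto _).comp (ha.mul_const _)
  exact h1.eventually (ball_mem_nhds _ hε)

/-! ### The flux identity inside an inclusion -/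

omit hτ hφ hu in
theorem volume_frontier (i : Fin K) : volume (frontier (S.Ω i)) = 0 := by
  rw [S.frontier_eq i]
  exact volume_range_eq_zero (S.contDiff_one_γ i) Real.two_pi_pos (S.periodic i)

/-- This weak jump relation identifies the interior flux with the density. After localizing ψ near
`Ω i`, G is split into the layer gradient of `∂Ω i`, which yields the curve integral, and a
holomorphic remainder, which yields zero. The exterior part of the total vanishes by the Neumann
condition, leaving the integral over `Ω i`. -/
theorem setIntegral_inclusion (i : Fin K) {ψ : ℂ → ℝ} (hψ : ContDiff ℝ ∞ ψ) :
    ∫ x in S.Ω i, fderiv ℝ ψ x (conj (S.periodicGrad τ φ ξ x)) =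
      ∫ t in (0 : ℝ)..(2 * Real.pi), S.density τ i t * ψ (S.γ i t) := by
  set G := S.periodicGrad τ φ ξ with hG
  set H := fun x => G x - S.curveGrad τ i x with hH
  have hcpt := S.isCompact_closure i
  have hO := S.isOpen_isolatingNhd i
  have hsubO := S.closure_subset_isolatingNhd i
  obtain ⟨χ, hχ, hχc, hχU, hχ1, -⟩ := exists_smooth_cutoff hcpt hO hsubO
  set θ := fun x => χ x * ψ x with hθdef
  have hθ : ContDiff ℝ ∞ θ := hχ.mul hψ
  have hθc : HasCompactSupport θ := hχc.mul_right
  have hθU : tsupport θ ⊆ S.isolatingNhd i := (tsupport_mul_subset_left).trans hχU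
  have hHan : DifferentiableOn ℂ H (S.isolatingNhd i) := fun x hx =>
    (S.analyticAt_periodicGrad_sub_curveGrad hτ hφ ξ hu hx).differentiableAt.differentiableWithinAt
  have hnhds : ∀ t, 𝓝[(closure (S.Ω i))ᶜ] (S.γ i t) = 𝓝[(closure S.lattice)ᶜ] (S.γ i t) := by
    intro t
    have hmem : S.γ i t ∈ S.isolatingNhd i :=
      hsubO (frontier_subset_closure (S.γ_mem_frontier i t))
    rw [← S.isolatingNhd_diff_closure i, Set.sdiff_eq,
      nhdsWithin_inter_of_mem (mem_nhdsWithin_of_mem_nhds (hO.mem_nhds hmem))]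
  have hfd0 : ∀ x, x ∉ tsupport θ → fderiv ℝ θ x = 0 := fun x hx =>
    image_eq_zero_of_notMem_tsupport fun h => hx (tsupport_fderiv_subset ℝ h)
  have hfdc : Continuous (fderiv ℝ θ) := hθ.continuous_fderiv (by simp)
  obtain ⟨C, hC⟩ := hfdc.bounded_above_of_compact_support (hθc.fderiv ℝ)
  have hint : ∀ F : ℂ → ℂ, IntegrableOn F (tsupport θ) →
      Integrable fun x => fderiv ℝ θ x (conj (F x)) := by
    intro F hF
    have h1 : IntegrableOn (fun x => fderiv ℝ θ x (conj (F x))) (tsupport θ) := by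
      refine (hF.norm.const_mul C).mono' ?_ (ae_of_all _ fun x => ?_)
      · simp only [clm_conj_apply]
        exact ((continuous_re.comp_aestronglyMeasurable hF.aestronglyMeasurable).mul
          (hfdc.clm_apply continuous_const).aestronglyMeasurable).sub
          ((continuous_im.comp_aestronglyMeasurable hF.aestronglyMeasurable).mul
          (hfdc.clm_apply continuous_const).aestronglyMeasurable)
      · refine ((fderiv ℝ θ x).le_opNorm _).trans ?_
        rw [norm_conj]
        gcongr
        exact hC x
    refine (integrableOn_iff_integrable_of_support_subset fun x hx => ?_).1 h1
    by_contra hn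
    exact hx (by simp [hfd0 x hn])
  have hGint := hint G (S.integrableOn_periodicGrad hτ hφ ξ hu hθc.isCompact hθU)
  have hVint := hint (S.curveGrad τ i)
    ((locallyIntegrable_layerGrad (S.continuous_γ i)
      (S.continuous_density hτ i)).integrableOn_isCompact hθc.isCompact)
  have hHint := hint H (ContinuousOn.integrableOn_compact hθc.isCompact (hHan.continuousOn.mono hθU))
  have hext := integral_compl_closure_pairing_eq_zero (S.contDiff_one_γ i) Real.two_pi_pos
    (S.periodic i) (S.regular i) (S.frontier_eq i) hO
    (H := G) (fun x hx => by
      rw [S.isolatingNhd_diff_closure] at hx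
      exact (S.analyticAt_periodicGrad hτ hφ ξ hu hx).differentiableAt.differentiableWithinAt)
    (fun t => by rw [hnhds]; exact S.periodicGrad_bounded hτ hφ ξ hu i t)
    (fun t => by rw [hnhds]; exact S.tendsto_periodicGrad_normal hτ hφ ξ hu i t)
    hθ hθc hθU hGint.integrableOn
  have hHzero : ∫ x, fderiv ℝ θ x (conj (H x)) = 0 := by
    -- With η = 1 the pairing lemma says that a holomorphic field has zero distributional
    -- divergence.
    have := integral_lipschitz_pairing hO hHan (η := fun _ => 1) (C := 0)
      (LipschitzWith.const 1) hθ hθc (inter_subset_left.trans hθU)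
    simp only [one_mul] at this
    rw [eq_comm, neg_eq_iff_eq_neg] at this
    rw [this]
    simp
  have hV : ∫ x, fderiv ℝ θ x (conj (S.curveGrad τ i x)) =
      ∫ t in (0 : ℝ)..(2 * Real.pi), S.density τ i t * ψ (S.γ i t) := by
    rw [curveGrad, integral_fderiv_layerGrad (S.continuous_γ i) (S.continuous_density hτ i)
      (hθ.of_le (by simp)) hθc]
    refine intervalIntegral.integral_congr fun t _ => ?_
    have : χ (S.γ i t) = 1 :=
      hχ1.self_of_nhdsSet _ (frontier_subset_closure (S.γ_mem_frontier i t))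
    simp only [hθdef, this, one_mul]
  have htotal : ∫ x, fderiv ℝ θ x (conj (G x)) =
      ∫ t in (0 : ℝ)..(2 * Real.pi), S.density τ i t * ψ (S.γ i t) := by
    rw [← hV, ← add_zero (∫ x, fderiv ℝ θ x (conj (S.curveGrad τ i x))), ← hHzero,
      ← integral_add hVint hHint]
    congr 1
    funext x
    rw [← map_add, ← map_add, hH, add_sub_cancel]
  have hsplit := integral_add_compl (isClosed_closure (s := S.Ω i)).measurableSet hGint
  rw [hext, add_zero] at hsplit
  have hae : (closure (S.Ω i) : Set ℂ) =ᵐ[volume] S.Ω i := by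
    have : closure (S.Ω i) = S.Ω i ∪ frontier (S.Ω i) := closure_eq_self_union_frontier _
    rw [this]
    exact union_ae_eq_left_of_ae_eq_empty (ae_eq_empty.2 (S.volume_frontier i))
  rw [← htotal, ← hsplit, setIntegral_congr_set hae]
  refine setIntegral_congr_fun (S.isOpen i).measurableSet fun x hx => ?_
  have : θ =ᶠ[𝓝 x] ψ := by
    filter_upwards [eventually_nhdsSet_iff_forall.1 hχ1 x (subset_closure hx)] with y hy
    simp [hθdef, hy]
  simp only [this.fderiv_eq]

end Inclusions

/-! ### Integration over rectangles and folding onto the unit cell -/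

theorem setIntegral_reProdIm {A B : Set ℝ} {f : ℂ → ℝ} (hf : IntegrableOn f (A ×ℂ B)) :
    ∫ x in A ×ℂ B, f x = ∫ s in A, ∫ t in B, f (s + t * I) := by
  have hmp := Complex.volume_preserving_equiv_real_prod.symm
  have hemb := measurableEquivRealProd.symm.measurableEmbedding
  have hpre : measurableEquivRealProd.symm ⁻¹' (A ×ℂ B) = A ×ˢ B := by
    ext p
    simp [mem_reProdIm, measurableEquivRealProd_symm_apply]
  rw [← hmp.setIntegral_preimage_emb hemb, hpre]
  have h1 : IntegrableOn (f ∘ measurableEquivRealProd.symm) (A ×ˢ B) := by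
    rw [← hpre]; exact (hmp.integrableOn_comp_preimage hemb).2 hf
  rw [Measure.volume_eq_prod] at h1 ⊢
  rw [setIntegral_prod (fun p => f (measurableEquivRealProd.symm p)) h1]
  refine integral_congr_ae (ae_of_all _ fun s => integral_congr_ae (ae_of_all _ fun t => ?_))
  simp only
  congr 1
  apply Complex.ext <;> simp [measurableEquivRealProd_symm_apply]

theorem superCell_eq : superCell = Ioo (-(3 / 2)) (3 / 2) ×ℂ Ioo (-(3 / 2)) (3 / 2) := by
  ext x; simp [superCell, mem_reProdIm, abs_lt]

theorem openCell_eq : openCell = Ioo (-(1 / 2)) (1 / 2) ×ℂ Ioo (-(1 / 2)) (1 / 2) := by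
  ext x; simp [openCell, mem_reProdIm, abs_lt]

theorem ae_re_ne (a : ℝ) : ∀ᵐ x : ℂ, x.re ≠ a := by
  have h := Complex.volume_preserving_equiv_real_prod.quasiMeasurePreserving.ae
    (p := fun p : ℝ × ℝ => p.1 ≠ a) (by
      have h1 : ∀ᵐ s : ℝ, s ≠ a := Measure.ae_ne volume a
      rw [Measure.volume_eq_prod]
      exact Measure.quasiMeasurePreserving_fst.ae h1)
  exact h

theorem ae_im_ne (a : ℝ) : ∀ᵐ x : ℂ, x.im ≠ a := by
  have h := Complex.volume_preserving_equiv_real_prod.quasiMeasurePreserving.ae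
    (p := fun p : ℝ × ℝ => p.2 ≠ a) (by
      have h1 : ∀ᵐ s : ℝ, s ≠ a := Measure.ae_ne volume a
      rw [Measure.volume_eq_prod]
      exact Measure.quasiMeasurePreserving_snd.ae h1)
  exact h

theorem int_mem_of_lt {a : ℝ} {m : ℤ} (h1 : |a| < 3 / 2) (h2 : |a - m| < 1 / 2) :
    m ∈ Finset.Icc (-1 : ℤ) 1 := by
  rw [abs_lt] at h1 h2
  have h3 : (m : ℝ) < 2 := by linarith
  have h4 : (-2 : ℝ) < m := by linarith
  have h3' : m < 2 := by exact_mod_cast h3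
  have h4' : -2 < m := by exact_mod_cast h4
  rw [Finset.mem_Icc]
  omega

theorem int_eq_of_lt {a : ℝ} {m m' : ℤ} (h1 : |a - m| < 1 / 2) (h2 : |a - m'| < 1 / 2) :
    m = m' := by
  rw [abs_lt] at h1 h2
  have h3 : (m : ℝ) < m' + 1 := by linarith
  have h4 : (m' : ℝ) < m + 1 := by linarith
  have h3' : m < m' + 1 := by exact_mod_cast h3
  have h4' : m' < m + 1 := by exact_mod_cast h4
  omega

theorem setIntegral_superCell_eq_sum {f : ℂ → ℝ} (hf : IntegrableOn f superCell) :
    ∫ x in superCell, f x = ∑ m ∈ Finset.Icc (-1 : ℤ) 1, ∑ n ∈ Finset.Icc (-1 : ℤ) 1,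
      ∫ x in openCell, f (x + latticeVec m n) := by
  set N := Finset.Icc (-1 : ℤ) 1 ×ˢ Finset.Icc (-1 : ℤ) 1 with hN
  set T : ℤ × ℤ → Set ℂ := fun p => (fun x => x + latticeVec p.1 p.2) '' openCell with hT
  have hTmem : ∀ p x, x ∈ T p ↔ |x.re - p.1| < 1 / 2 ∧ |x.im - p.2| < 1 / 2 := by
    intro p x
    rw [hT, mem_translate_iff]
    simp [openCell, latticeVec_re, latticeVec_im]
  have hTmeas : ∀ p, MeasurableSet (T p) := fun p =>
    ((Homeomorph.addRight (latticeVec p.1 p.2)).isOpenMap _ isOpen_openCell).measurableSet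
  have hsub : ∀ p ∈ N, T p ⊆ superCell := by
    rintro ⟨m, n⟩ hp x hx
    obtain ⟨h1, h2⟩ := (hTmem _ _).1 hx
    have key : ∀ (a : ℝ) (k : ℤ), k ∈ Finset.Icc (-1 : ℤ) 1 → |a - k| < 1 / 2 → |a| < 3 / 2 := by
      intro a k hk hak
      rw [Finset.mem_Icc] at hk
      rw [abs_lt] at hak ⊢
      have h3 : (-1 : ℝ) ≤ k := by exact_mod_cast hk.1
      have h4 : (k : ℝ) ≤ 1 := by exact_mod_cast hk.2
      constructor <;> linarith
    obtain ⟨hm, hn⟩ := Finset.mem_product.1 hp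
    exact ⟨key _ _ hm h1, key _ _ hn h2⟩
  have hdisj : Pairwise (Function.onFun Disjoint T) := by
    rintro ⟨m, n⟩ ⟨m', n'⟩ hne
    refine Set.disjoint_left.2 fun x hx hx' => hne ?_
    obtain ⟨h1, h2⟩ := (hTmem _ _).1 hx
    obtain ⟨h3, h4⟩ := (hTmem _ _).1 hx'
    exact Prod.ext (int_eq_of_lt h1 h3) (int_eq_of_lt h2 h4)
  have hae : superCell =ᵐ[volume] ⋃ p ∈ N, T p := by
    have h1 : ∀ᵐ x : ℂ, ∀ m : ℤ, x.re ≠ m + 1 / 2 := ae_all_iff.2 fun m => ae_re_ne _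
    have h2 : ∀ᵐ x : ℂ, ∀ m : ℤ, x.im ≠ m + 1 / 2 := ae_all_iff.2 fun m => ae_im_ne _
    have key : ∀ a : ℝ, (∀ m : ℤ, a ≠ m + 1 / 2) → |a - round a| < 1 / 2 := by
      intro a ha
      refine lt_of_le_of_ne (abs_sub_round a) fun h => ?_
      rcases eq_or_eq_neg_of_abs_eq h with h | h
      · exact ha (round a) (by linarith)
      · exact ha (round a - 1) (by push_cast; linarith)
    filter_upwards [h1, h2] with x hx1 hx2
    refine propext ⟨fun hx => ?_, fun hx => ?_⟩
    · have h3 := key _ hx1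
      have h4 := key _ hx2
      exact mem_iUnion₂.2 ⟨(round x.re, round x.im), Finset.mem_product.2
        ⟨int_mem_of_lt hx.1 h3, int_mem_of_lt hx.2 h4⟩, (hTmem _ _).2 ⟨h3, h4⟩⟩
    · obtain ⟨p, hp, hxp⟩ := mem_iUnion₂.1 hx
      exact hsub p hp hxp
  rw [setIntegral_congr_set hae, integral_biUnion_finset N (fun p _ => hTmeas p)
    (fun p _ q _ h => hdisj h) (fun p hp => hf.mono_set (hsub p hp)), hN, Finset.sum_product]
  refine Finset.sum_congr rfl fun m _ => Finset.sum_congr rfl fun n _ => ?_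
  exact (measurePreserving_add_right volume (latticeVec m n)).setIntegral_image_emb
    (measurableEmbedding_addRight _) f openCell

/-! ### The staircase function -/

/-- A smooth approximation of the staircase with steps at `-1/2 - 1`, `-1/2`, `-1/2 + 1`. -/
def stair (ε t : ℝ) : ℝ := ∑ k ∈ Finset.Icc (-1 : ℤ) 1, ramp ((t + 1 / 2 - k) / ε)

/-- The derivative of `stair ε`. -/
def stairDeriv (ε t : ℝ) : ℝ := ∑ k ∈ Finset.Icc (-1 : ℤ) 1, deriv ramp ((t + 1 / 2 - k) / ε) / ε

theorem contDiff_stair (ε : ℝ) : ContDiff ℝ ∞ (stair ε) :=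
  ContDiff.sum fun _ _ => contDiff_ramp.comp
    (((contDiff_id.add contDiff_const).sub contDiff_const).div_const ε)

theorem hasDerivAt_stair (ε t : ℝ) : HasDerivAt (stair ε) (stairDeriv ε t) t := by
  refine HasDerivAt.fun_sum fun k _ => ?_
  have h1 : HasDerivAt (fun t : ℝ => (t + 1 / 2 - k) / ε) (1 / ε) t :=
    (((hasDerivAt_id t).add_const (1 / 2)).sub_const (k : ℝ)).div_const ε
  have := (hasDerivAt_ramp ((t + 1 / 2 - k) / ε)).comp t h1
  rwa [mul_one_div] at this

theorem continuous_stairDeriv (ε : ℝ) : Continuous (stairDeriv ε) :=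
  continuous_finsetSum _ fun k _ => (continuous_deriv_ramp.comp (by fun_prop)).div_const ε

theorem contDiff_stair_re (ε : ℝ) : ContDiff ℝ ∞ fun x : ℂ => stair ε x.re :=
  (contDiff_stair ε).comp reCLM.contDiff

theorem fderiv_stair_re (ε : ℝ) (x a : ℂ) :
    fderiv ℝ (fun x : ℂ => stair ε x.re) x a = stairDeriv ε x.re * a.re := by
  have := (hasDerivAt_stair ε x.re).comp_hasFDerivAt (f := fun x : ℂ => x.re) x
    reCLM.hasFDerivAt
  have h2 : HasFDerivAt (fun x : ℂ => stair ε x.re) (stairDeriv ε x.re • reCLM) x := this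
  rw [h2.fderiv]
  simp

/-- In the column with index m only the step k = m is active: earlier steps are complete since ε ≤
1, later ones have not begun. The derivative of the staircase is thus the same in all nine cells,
which is what permits folding. -/
theorem stairDeriv_add_int {ε t : ℝ} (hε : ε ∈ Ioc (0 : ℝ) 1) (ht : |t| < 1 / 2) {m : ℤ}
    (hm : m ∈ Finset.Icc (-1 : ℤ) 1) :
    stairDeriv ε (t + m) = deriv ramp ((t + 1 / 2) / ε) / ε := by
  rw [abs_lt] at ht
  rw [stairDeriv, Finset.sum_eq_single_of_mem m hm]
  · congr 3; ring
  · intro k _ hk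
    rcases lt_or_gt_of_ne hk with h | h
    · have h' : (k : ℝ) + 1 ≤ m := by exact_mod_cast h
      rw [deriv_ramp_of_ge, zero_div]
      rw [one_le_div hε.1]
      linarith [hε.2]
    · have h' : (m : ℝ) + 1 ≤ k := by exact_mod_cast h
      rw [deriv_ramp_of_le, zero_div]
      refine (div_nonpos_of_nonpos_of_nonneg ?_ hε.1.le).trans (by norm_num)
      linarith

theorem stair_add_int {ε t : ℝ} (hε : ε ∈ Ioc (0 : ℝ) 1) (ht : |t| ≤ 1 / 2) {m : ℤ}
    (hm : m ∈ Finset.Icc (-1 : ℤ) 1) :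
    stair ε (t + m) = (m + 1) + ramp ((t + 1 / 2) / ε) := by
  rw [abs_le] at ht
  have h0 : ∀ k : ℤ, m < k → ramp ((t + m + 1 / 2 - k) / ε) = 0 := fun k h => by
    have h' : (m : ℝ) + 1 ≤ k := by exact_mod_cast h
    refine ramp_of_le ((div_nonpos_of_nonpos_of_nonneg ?_ hε.1.le).trans (by norm_num))
    linarith
  have h1 : ∀ k : ℤ, k < m → ramp ((t + m + 1 / 2 - k) / ε) = 1 := fun k h => by
    have h' : (k : ℝ) + 1 ≤ m := by exact_mod_cast h
    refine ramp_of_ge ?_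
    rw [one_le_div hε.1]
    linarith [hε.2]
  have hd : ramp ((t + m + 1 / 2 - m) / ε) = ramp ((t + 1 / 2) / ε) := by congr 2; ring
  rw [stair, show Finset.Icc (-1 : ℤ) 1 = {-1, 0, 1} from rfl,
    Finset.sum_insert (by decide), Finset.sum_insert (by decide), Finset.sum_singleton]
  rw [show Finset.Icc (-1 : ℤ) 1 = {-1, 0, 1} from rfl] at hm
  simp only [Finset.mem_insert, Finset.mem_singleton] at hm
  rcases hm with rfl | rfl | rfl
  · rw [hd, h0 0 (by norm_num), h0 1 (by norm_num)]; push_cast; ring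
  · rw [hd, h1 (-1) (by norm_num), h0 1 (by norm_num)]; push_cast; ring
  · rw [hd, h1 (-1) (by norm_num), h1 0 (by norm_num)]; push_cast; ring

theorem stair_left {ε t : ℝ} (hε : 0 < ε) (ht : t ≤ -(3 / 2)) : stair ε t = 0 := by
  refine Finset.sum_eq_zero fun k hk => ?_
  have : (-1 : ℝ) ≤ k := by exact_mod_cast (Finset.mem_Icc.1 hk).1
  refine ramp_of_le ((div_nonpos_of_nonpos_of_nonneg ?_ hε.le).trans (by norm_num))
  linarith

theorem stair_right {ε t : ℝ} (hε : ε ∈ Ioc (0 : ℝ) 1) (ht : 3 / 2 ≤ t) : stair ε t = 3 := by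
  have : ∀ k ∈ Finset.Icc (-1 : ℤ) 1, ramp ((t + 1 / 2 - k) / ε) = 1 := fun k hk => by
    have : (k : ℝ) ≤ 1 := by exact_mod_cast (Finset.mem_Icc.1 hk).2
    refine ramp_of_ge ?_
    rw [one_le_div hε.1]
    linarith [hε.2]
  rw [stair, Finset.sum_congr rfl this]
  simp

/-! ### Divergence theorem on the super-cell -/

/-- The divergence theorem on a rectangle for the product of a real function and a function that is
holomorphic near its support. -/
theorem setIntegral_rect_pairing {V : ℂ → ℂ} {K : Set ℂ} (hV : ∀ x ∉ K, AnalyticAt ℂ V x)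
    {θ : ℂ → ℝ} (hθ : ContDiff ℝ ∞ θ) (hθK : ∀ x ∈ K, θ =ᶠ[𝓝 x] fun _ => 0)
    {a b : ℝ} (hab : a ≤ b) :
    IntegrableOn (fun x => fderiv ℝ θ x (conj (V x))) (Ioo a b ×ℂ Ioo a b) ∧
    ∫ x in Ioo a b ×ℂ Ioo a b, fderiv ℝ θ x (conj (V x)) =
      ((∫ t in a..b, θ (t + b * I) * (V (t + b * I) * I).re) -
        ∫ t in a..b, θ (t + a * I) * (V (t + a * I) * I).re) +
      ((∫ t in a..b, θ (b + t * I) * (V (b + t * I)).re) -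
        ∫ t in a..b, θ (a + t * I) * (V (a + t * I)).re) := by
  -- As θ vanishes near K, the product is smooth everywhere. The imaginary part of i ∂ₓF - ∂ᵧF is
  -- the pairing of ∇θ with conj V, the derivative of V dropping out by holomorphy.
  set F : ℂ → ℂ := fun x => θ x • V x with hF
  have hFsm : ContDiff ℝ ∞ F := by
    refine contDiff_iff_contDiffAt.2 fun x => ?_
    by_cases hx : x ∈ K
    · have : F =ᶠ[𝓝 x] fun _ => 0 := by
        filter_upwards [hθK x hx] with z hz
        simp [hF, hz]
      exact contDiffAt_const.congr_of_eventuallyEq this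
    · exact hθ.contDiffAt.smul ((hV x hx).contDiffAt.restrict_scalars ℝ)
  have hdF : Continuous (fderiv ℝ F) := hFsm.continuous_fderiv (by simp)
  have hcont : Continuous fun z => I • fderiv ℝ F z 1 - fderiv ℝ F z I := by fun_prop
  have hpt : ∀ x, (I • fderiv ℝ F x 1 - fderiv ℝ F x I).im = fderiv ℝ θ x (conj (V x)) := by
    intro x
    by_cases hx : x ∈ K
    · have h1 : F =ᶠ[𝓝 x] fun _ => 0 := by
        filter_upwards [hθK x hx] with z hz
        simp [hF, hz]
      rw [h1.fderiv_eq, (hθK x hx).fderiv_eq]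
      simp
    · have hd := (hV x hx).differentiableAt.hasDerivAt
      have hfd : HasFDerivAt V ((ContinuousLinearMap.mul ℝ ℂ) (deriv V x)) x := by
        refine (hd.hasFDerivAt.restrictScalars ℝ).congr_fderiv ?_
        ext w
        simp [mul_comm]
      have h1 : HasFDerivAt F _ x := ((hθ.differentiable (by simp) x).hasFDerivAt).smul hfd
      rw [h1.fderiv, clm_conj_apply]
      simp
      ring
  have hIccInt : ∀ f : ℂ → ℝ, Continuous f → IntegrableOn f (Ioo a b ×ℂ Ioo a b) := fun f hf =>
    (hf.continuousOn.integrableOn_compact (isCompact_Icc.reProdIm isCompact_Icc)).mono_set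
      (reProdIm_subset_iff'.2 (Or.inl ⟨Ioo_subset_Icc_self, Ioo_subset_Icc_self⟩))
  have hdiv := integral_boundary_rect_of_differentiableOn_real F (a + a * I) (b + b * I)
    (hFsm.differentiable (by simp)).differentiableOn
    (hcont.continuousOn.integrableOn_compact (isCompact_uIcc.reProdIm isCompact_uIcc))
  have hpt' : (fun x => fderiv ℝ θ x (conj (V x))) =
      fun x => (I • fderiv ℝ F x 1 - fderiv ℝ F x I).im := funext fun x => (hpt x).symm
  have hci : Continuous fun x => fderiv ℝ θ x (conj (V x)) := by
    rw [hpt']; exact continuous_im.comp hcont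
  refine ⟨hIccInt _ hci, ?_⟩
  have him := congrArg im hdiv
  have hre1 : ∀ u v : ℝ, ((u : ℂ) + v * I).re = u := fun u v => by simp
  have him1 : ∀ u v : ℝ, ((u : ℂ) + v * I).im = v := fun u v => by simp
  simp only [hre1, him1] at him
  have hintim : ∀ f : ℝ → ℂ, Continuous f → (∫ t in a..b, f t).im = ∫ t in a..b, (f t).im :=
    fun f hf => (imCLM.intervalIntegral_comp_comm (hf.intervalIntegrable a b)).symm
  have hintre : ∀ f : ℝ → ℂ, Continuous f → (∫ t in a..b, f t).re = ∫ t in a..b, (f t).re :=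
    fun f hf => (reCLM.intervalIntegral_comp_comm (hf.intervalIntegrable a b)).symm
  have hFc := hFsm.continuous
  have hinner : Continuous fun s : ℝ => ∫ t in a..b,
      (I • fderiv ℝ F (s + t * I) 1 - fderiv ℝ F (s + t * I) I) :=
    intervalIntegral.continuous_parametric_intervalIntegral_of_continuous'
      (f := fun s t : ℝ => I • fderiv ℝ F (s + t * I) 1 - fderiv ℝ F (s + t * I) I)
      (hcont.comp (by fun_prop : Continuous fun p : ℝ × ℝ => (p.1 : ℂ) + p.2 * I)) a b
  rw [hintim _ hinner] at him
  simp only [add_im, sub_im, smul_eq_mul, mul_im (z := I), I_re, I_im, zero_mul, one_mul,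
    zero_add] at him
  rw [hintim _ (by fun_prop), hintim _ (by fun_prop), hintre _ (by fun_prop),
    hintre _ (by fun_prop)] at him
  rw [setIntegral_reProdIm (hIccInt _ hci)]
  have hlhs : ∫ s in Ioo a b, ∫ t in Ioo a b, fderiv ℝ θ (s + t * I) (conj (V (s + t * I))) =
      ∫ s in a..b, (∫ t in a..b,
        (I • fderiv ℝ F (s + t * I) 1 - fderiv ℝ F (s + t * I) I)).im := by
    rw [intervalIntegral.integral_of_le hab, integral_Ioc_eq_integral_Ioo]
    refine integral_congr_ae (ae_of_all _ fun s => ?_)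
    simp only
    have hs : Continuous fun t : ℝ =>
        I • fderiv ℝ F (s + t * I) 1 - fderiv ℝ F (s + t * I) I :=
      hcont.comp (by fun_prop : Continuous fun t : ℝ => (s : ℂ) + t * I)
    rw [hintim _ hs, intervalIntegral.integral_of_le hab,
      integral_Ioc_eq_integral_Ioo]
    exact integral_congr_ae (ae_of_all _ fun t => (hpt _).symm)
  rw [hlhs]
  simp only [smul_eq_mul]
  rw [← him]
  simp only [hF, real_smul, im_ofReal_mul, re_ofReal_mul, mul_I_re, mul_neg,
    intervalIntegral.integral_neg]
  ring

namespace Inclusions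

variable {K : ℕ} (S : Inclusions K) {τ : ℂ → ℝ} (hτ : ContinuousOn τ S.bdry)

variable (τ) in
/-- The complex gradient of the single-layer potential `v`. -/
def layerSumGrad (x : ℂ) : ℂ := ∑ i, S.curveGrad τ i x

include hτ

theorem analyticAt_layerSumGrad {x : ℂ} (hx : x ∉ ⋃ i, closure (S.Ω i)) :
    AnalyticAt ℂ (S.layerSumGrad τ) x :=
  Finset.analyticAt_fun_sum _ fun i _ =>
    S.analyticAt_curveGrad hτ fun h => hx (mem_iUnion.2 ⟨i, h⟩)

theorem locallyIntegrable_curveGrad (i : Fin K) : LocallyIntegrable (S.curveGrad τ i) volume :=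
  locallyIntegrable_layerGrad (S.continuous_γ i) (S.continuous_density hτ i)

theorem locallyIntegrable_layerSumGrad : LocallyIntegrable (S.layerSumGrad τ) volume := by
  have : S.layerSumGrad τ = fun x => ∑ i ∈ Finset.univ, S.curveGrad τ i x := rfl
  rw [this]
  exact locallyIntegrable_finsetSum _ fun i _ => S.locallyIntegrable_curveGrad hτ i

/-- With a cutoff χ equal to 1 near the inclusions, χψ is compactly supported in the super-cell and
sees only the sources, while (1 - χ)ψ vanishes near the inclusions and sees only the outer boundary,
where it equals ψ. -/
theorem setIntegral_superCell_pairing {ψ : ℂ → ℝ} (hψ : ContDiff ℝ ∞ ψ) :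
    ∫ x in superCell, fderiv ℝ ψ x (conj (S.layerSumGrad τ x)) =
      (∑ i, ∫ t in (0 : ℝ)..(2 * Real.pi), S.density τ i t * ψ (S.γ i t)) +
      (((∫ t in (-(3 / 2) : ℝ)..(3 / 2), ψ (t + (3 / 2 : ℝ) * I) *
          (S.layerSumGrad τ (t + (3 / 2 : ℝ) * I) * I).re) -
        ∫ t in (-(3 / 2) : ℝ)..(3 / 2), ψ (t + (-(3 / 2) : ℝ) * I) *
          (S.layerSumGrad τ (t + (-(3 / 2) : ℝ) * I) * I).re) +
      ((∫ t in (-(3 / 2) : ℝ)..(3 / 2), ψ ((3 / 2 : ℝ) + t * I) *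
          (S.layerSumGrad τ ((3 / 2 : ℝ) + t * I)).re) -
        ∫ t in (-(3 / 2) : ℝ)..(3 / 2), ψ ((-(3 / 2) : ℝ) + t * I) *
          (S.layerSumGrad τ ((-(3 / 2) : ℝ) + t * I)).re)) := by
  set V := S.layerSumGrad τ with hV
  have hK : IsCompact (⋃ i, closure (S.Ω i)) := isCompact_iUnion fun i => S.isCompact_closure i
  have hKs : (⋃ i, closure (S.Ω i)) ⊆ superCell := iUnion_subset S.subset_superCell
  obtain ⟨χ, hχ, hχc, hχU, hχ1, -⟩ := exists_smooth_cutoff hK isOpen_superCell hKs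
  set θ₁ : ℂ → ℝ := fun x => χ x * ψ x with hθ₁def
  set θ₂ : ℂ → ℝ := fun x => (1 - χ x) * ψ x with hθ₂def
  have hθ₁ : ContDiff ℝ ∞ θ₁ := hχ.mul hψ
  have hθ₂ : ContDiff ℝ ∞ θ₂ := (contDiff_const.sub hχ).mul hψ
  have hθ₁c : HasCompactSupport θ₁ := hχc.mul_right
  have hθ₁U : tsupport θ₁ ⊆ superCell := (tsupport_mul_subset_left).trans hχU
  have hθ₂K : ∀ x ∈ ⋃ i, closure (S.Ω i), θ₂ =ᶠ[𝓝 x] fun _ => 0 := by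
    intro x hx
    filter_upwards [eventually_nhdsSet_iff_forall.1 hχ1 x hx] with y hy
    simp [hθ₂def, hy]
  obtain ⟨hint₂, hrect⟩ := setIntegral_rect_pairing
    (fun x hx => S.analyticAt_layerSumGrad hτ hx) hθ₂ hθ₂K
    (a := -(3 / 2)) (b := 3 / 2) (by norm_num)
  rw [← superCell_eq, ← hV] at hint₂ hrect
  have hsum : ∀ x, fderiv ℝ ψ x (conj (V x)) =
      fderiv ℝ θ₁ x (conj (V x)) + fderiv ℝ θ₂ x (conj (V x)) := by
    intro x
    have h1 : ψ = fun x => θ₁ x + θ₂ x := by funext y; simp only [hθ₁def, hθ₂def]; ring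
    conv_lhs => rw [h1]
    rw [fderiv_fun_add (hθ₁.differentiable (by simp) x) (hθ₂.differentiable (by simp) x)]
    rfl
  have hfdc : Continuous (fderiv ℝ θ₁) := hθ₁.continuous_fderiv (by simp)
  obtain ⟨C, hC⟩ := hfdc.bounded_above_of_compact_support (hθ₁c.fderiv ℝ)
  have hfd0 : ∀ x, x ∉ tsupport θ₁ → fderiv ℝ θ₁ x = 0 := fun x hx =>
    image_eq_zero_of_notMem_tsupport fun h => hx (tsupport_fderiv_subset ℝ h)
  have hint₁ : ∀ i, Integrable fun x => fderiv ℝ θ₁ x (conj (S.curveGrad τ i x)) := by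
    intro i
    have hF := (S.locallyIntegrable_curveGrad hτ i).integrableOn_isCompact hθ₁c.isCompact
    have h1 : IntegrableOn (fun x => fderiv ℝ θ₁ x (conj (S.curveGrad τ i x))) (tsupport θ₁) := by
      refine (hF.norm.const_mul C).mono' ?_ (ae_of_all _ fun x => ?_)
      · simp only [clm_conj_apply]
        exact ((continuous_re.comp_aestronglyMeasurable hF.aestronglyMeasurable).mul
          (hfdc.clm_apply continuous_const).aestronglyMeasurable).sub
          ((continuous_im.comp_aestronglyMeasurable hF.aestronglyMeasurable).mul
          (hfdc.clm_apply continuous_const).aestronglyMeasurable)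
      · refine ((fderiv ℝ θ₁ x).le_opNorm _).trans ?_
        rw [norm_conj]
        gcongr
        exact hC x
    refine (integrableOn_iff_integrable_of_support_subset fun x hx => ?_).1 h1
    by_contra hn
    exact hx (by simp [hfd0 x hn])
  have hVsum : ∀ x, fderiv ℝ θ₁ x (conj (V x)) =
      ∑ i, fderiv ℝ θ₁ x (conj (S.curveGrad τ i x)) := by
    intro x
    rw [hV, layerSumGrad, map_sum, map_sum]
  have hθ₁tot : ∫ x in superCell, fderiv ℝ θ₁ x (conj (V x)) =
      ∑ i, ∫ t in (0 : ℝ)..(2 * Real.pi), S.density τ i t * ψ (S.γ i t) := by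
    rw [setIntegral_eq_integral_of_forall_compl_eq_zero fun x hx => by
      rw [hfd0 x fun h => hx (hθ₁U h)]; rfl]
    simp only [hVsum]
    rw [integral_finsetSum _ fun i _ => hint₁ i]
    refine Finset.sum_congr rfl fun i _ => ?_
    rw [curveGrad, integral_fderiv_layerGrad (S.continuous_γ i) (S.continuous_density hτ i)
      (hθ₁.of_le (by simp)) hθ₁c]
    refine intervalIntegral.integral_congr fun t _ => ?_
    have : χ (S.γ i t) = 1 := hχ1.self_of_nhdsSet _
      (mem_iUnion.2 ⟨i, frontier_subset_closure (S.γ_mem_frontier i t)⟩)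
    simp only [hθ₁def, this, one_mul]
  have hθ₂ψ : ∀ x ∉ superCell, θ₂ x = ψ x := fun x hx => by
    have : χ x = 0 := image_eq_zero_of_notMem_tsupport fun h => hx (hχU h)
    simp [hθ₂def, this]
  have hint₁' : IntegrableOn (fun x => fderiv ℝ θ₁ x (conj (V x))) superCell := by
    simp only [hVsum]
    exact (integrable_finsetSum _ fun i _ => hint₁ i).integrableOn
  simp only [hsum]
  rw [integral_add hint₁' hint₂, hθ₁tot, hrect]
  have hout1 : ∀ t : ℝ, ((t : ℂ) + (3 / 2 : ℝ) * I) ∉ superCell := fun t h => by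
    have := h.2
    simp [abs_of_pos] at this
  have hout2 : ∀ t : ℝ, ((t : ℂ) + (-(3 / 2) : ℝ) * I) ∉ superCell := fun t h => by
    have := h.2
    simp [abs_of_pos] at this
  have hout3 : ∀ t : ℝ, (((3 / 2 : ℝ) : ℂ) + t * I) ∉ superCell := fun t h => by
    have := h.1
    simp [abs_of_pos] at this
  have hout4 : ∀ t : ℝ, (((-(3 / 2) : ℝ) : ℂ) + t * I) ∉ superCell := fun t h => by
    have := h.1
    simp [abs_of_pos] at this
  simp only [hθ₂ψ _ (hout1 _), hθ₂ψ _ (hout2 _), hθ₂ψ _ (hout3 _), hθ₂ψ _ (hout4 _)]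

end Inclusions

/-- The weight on the unit cell that concentrates at the left wall as `ε → 0`. -/
def cellWeight (ε : ℝ) (x : ℂ) : ℝ := deriv ramp ((x.re + 1 / 2) / ε) / ε

theorem continuous_cellWeight (ε : ℝ) : Continuous (cellWeight ε) :=
  (continuous_deriv_ramp.comp (by fun_prop)).div_const ε

theorem sum_Icc_neg {α : Type*} [AddCommMonoid α] (f : ℤ → α) :
    ∑ m ∈ Finset.Icc (-1 : ℤ) 1, f (-m) = ∑ m ∈ Finset.Icc (-1 : ℤ) 1, f m := by
  refine Finset.sum_nbij' (fun m => -m) (fun m => -m) ?_ ?_ ?_ ?_ ?_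
  all_goals intro m hm
  all_goals simp only [Finset.mem_Icc, neg_neg] at *
  all_goals omega

theorem integrableOn_comp_add {f : ℂ → ℂ} (hf : LocallyIntegrable f volume) {k : Set ℂ}
    (hk : IsCompact k) (c : ℂ) : IntegrableOn (fun x => f (x + c)) k := by
  have h1 := hf.integrableOn_isCompact (hk.image (f := fun x => x + c) (by fun_prop))
  have h2 := ((measurePreserving_add_right volume c).integrableOn_comp_preimage
    (measurableEmbedding_addRight c)).2 h1
  exact h2.mono_set (subset_preimage_image _ _)

/-! ### The weighted flux identity on the unit cell -/

namespace Inclusions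

variable {K : ℕ} (S : Inclusions K) {τ : ℂ → ℝ} (hτ : ContinuousOn τ S.bdry) {M : ℕ}
  {φ : Fin M → ℂ → ℝ} (hφ : ∀ j, HarmonicOnNhd (φ j) closedCell) (ξ : Fin M → ℝ)

variable (τ) in
/-- The flux of the single-layer gradient through the boundary of the super-cell, weighted with
the smooth staircase. -/
def stairFlux (ε : ℝ) : ℝ :=
  ((∫ t in (-(3 / 2) : ℝ)..(3 / 2), stair ε t * (S.layerSumGrad τ (t + (3 / 2 : ℝ) * I) * I).re) -
    ∫ t in (-(3 / 2) : ℝ)..(3 / 2),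
      stair ε t * (S.layerSumGrad τ (t + (-(3 / 2) : ℝ) * I) * I).re) +
  3 * ∫ t in (-(3 / 2) : ℝ)..(3 / 2), (S.layerSumGrad τ ((3 / 2 : ℝ) + t * I)).re

include hτ

/-- The staircase is 0 on the left side of the super-cell and 3 on the right side, so the left flux
drops out and the right one acquires the factor 3. -/
theorem setIntegral_superCell_stairDeriv {ε : ℝ} (hε : ε ∈ Ioc (0 : ℝ) 1) :
    ∫ x in superCell, stairDeriv ε x.re * (S.layerSumGrad τ x).re =
      (∑ i, ∫ t in (0 : ℝ)..(2 * Real.pi), S.density τ i t * stair ε (S.γ i t).re) +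
        S.stairFlux τ ε := by
  have h := S.setIntegral_superCell_pairing hτ (contDiff_stair_re ε)
  simp only [fderiv_stair_re, conj_re] at h
  rw [h, stairFlux, ← intervalIntegral.integral_const_mul]
  have hre : ∀ u v : ℝ, ((u : ℂ) + v * I).re = u := fun u v => by simp
  simp only [hre, stair_left hε.1 le_rfl, stair_right hε le_rfl, zero_mul,
    intervalIntegral.integral_zero, sub_zero]

theorem integrableOn_weight_layer (ε : ℝ) (c : ℂ) :
    IntegrableOn (fun x => cellWeight ε x * (S.layerSumGrad τ (x + c)).re) openCell :=
  (IntegrableOn.continuousOn_mul (continuous_cellWeight ε).continuousOn (integrableOn_comp_add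
    (S.locallyIntegrable_layerSumGrad hτ) isCompact_closedCell c).re isCompact_closedCell).mono_set
    openCell_subset_closedCell

theorem setIntegral_superCell_stairDeriv_eq_sum {ε : ℝ} (hε : ε ∈ Ioc (0 : ℝ) 1) :
    ∫ x in superCell, stairDeriv ε x.re * (S.layerSumGrad τ x).re =
      ∑ m ∈ Finset.Icc (-1 : ℤ) 1, ∑ n ∈ Finset.Icc (-1 : ℤ) 1,
        ∫ x in openCell, cellWeight ε x * (S.layerSumGrad τ (x + latticeVec m n)).re := by
  have hint : IntegrableOn (fun x => stairDeriv ε x.re * (S.layerSumGrad τ x).re) superCell := by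
    have hk := isBounded_superCell.isCompact_closure
    exact (IntegrableOn.continuousOn_mul ((continuous_stairDeriv ε).comp continuous_re).continuousOn
      ((S.locallyIntegrable_layerSumGrad hτ).integrableOn_isCompact hk).re hk).mono_set
      subset_closure
  rw [setIntegral_superCell_eq_sum hint]
  refine Finset.sum_congr rfl fun m hm => Finset.sum_congr rfl fun n _ => ?_
  refine setIntegral_congr_fun isOpen_openCell.measurableSet fun x hx => ?_
  rw [add_re, latticeVec_re, stairDeriv_add_int hε hx.1 hm, cellWeight]

include hφ

omit hτ in
theorem integrableOn_weight_proxy (ε : ℝ) :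
    IntegrableOn (fun x => cellWeight ε x * (proxyGrad φ ξ x).re) openCell := by
  refine (ContinuousOn.integrableOn_compact isCompact_closedCell fun x hx => ?_).mono_set
    openCell_subset_closedCell
  exact (continuous_cellWeight ε).continuousWithinAt.mul
    (continuous_re.continuousAt.comp
      (analyticAt_proxyGrad hφ ξ hx).continuousAt).continuousWithinAt

omit hτ hφ in
theorem weight_repGrad_eq (ε : ℝ) (x : ℂ) :
    cellWeight ε x * (S.repGrad τ φ ξ x).re =
      (∑ m ∈ Finset.Icc (-1 : ℤ) 1, ∑ n ∈ Finset.Icc (-1 : ℤ) 1,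
        cellWeight ε x * (S.layerSumGrad τ (x + latticeVec m n)).re) +
        cellWeight ε x * (proxyGrad φ ξ x).re := by
  have h1 : ∑ m ∈ Finset.Icc (-1 : ℤ) 1, ∑ n ∈ Finset.Icc (-1 : ℤ) 1, ∑ i,
      S.curveGrad τ i (x - latticeVec m n) = ∑ m ∈ Finset.Icc (-1 : ℤ) 1,
        ∑ n ∈ Finset.Icc (-1 : ℤ) 1, S.layerSumGrad τ (x + latticeVec m n) := by
    -- The index range is symmetric, so images at -(m e₁ + n e₂) may be replaced by images at the
    -- opposite vector; this matches the folding of the super-cell.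
    rw [← sum_Icc_neg]
    refine Finset.sum_congr rfl fun m _ => ?_
    rw [← sum_Icc_neg]
    refine Finset.sum_congr rfl fun n _ => ?_
    rw [layerSumGrad, sub_eq_add_neg, latticeVec_neg, neg_neg, neg_neg]
  rw [repGrad, h1, add_re, re_sum, mul_add, Finset.mul_sum]
  simp only [re_sum, Finset.mul_sum]

theorem integrableOn_weight_repGrad (ε : ℝ) :
    IntegrableOn (fun x => cellWeight ε x * (S.repGrad τ φ ξ x).re) openCell := by
  rw [funext (S.weight_repGrad_eq ξ ε)]
  exact (integrable_finsetSum _ fun m _ => integrable_finsetSum _ fun n _ =>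
    S.integrableOn_weight_layer hτ ε _).add (integrableOn_weight_proxy hφ ξ ε)

theorem setIntegral_openCell_repGrad {ε : ℝ} (hε : ε ∈ Ioc (0 : ℝ) 1) :
    ∫ x in openCell, cellWeight ε x * (S.repGrad τ φ ξ x).re =
      ((∑ i, ∫ t in (0 : ℝ)..(2 * Real.pi), S.density τ i t * stair ε (S.γ i t).re) +
        S.stairFlux τ ε) + ∫ x in openCell, cellWeight ε x * (proxyGrad φ ξ x).re := by
  rw [← S.setIntegral_superCell_stairDeriv hτ hε, S.setIntegral_superCell_stairDeriv_eq_sum hτ hε]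
  simp only [S.weight_repGrad_eq ξ ε]
  have hint := fun m n => S.integrableOn_weight_layer hτ ε (latticeVec m n)
  rw [integral_add (integrable_finsetSum _ fun m _ => integrable_finsetSum _ fun n _ => hint m n)
    (integrableOn_weight_proxy hφ ξ ε), integral_finsetSum _ fun m _ =>
      integrable_finsetSum _ fun n _ => hint m n]
  congr 1
  exact Finset.sum_congr rfl fun m _ => integral_finsetSum _ fun n _ => hint m n

omit hτ hφ in
theorem closure_lattice_ae_eq : (closure S.lattice : Set ℂ) =ᵐ[volume] S.lattice := by
  have h1 : volume (⋃ p : Fin K × ℤ × ℤ,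
      (fun x => x + latticeVec p.2.1 p.2.2) '' frontier (S.Ω p.1)) = 0 := by
    refine measure_iUnion_null fun p => ?_
    rw [image_add_right, measure_preimage_add_right]
    exact S.volume_frontier p.1
  have h2 : closure S.lattice \ S.lattice ⊆ ⋃ p : Fin K × ℤ × ℤ,
      (fun x => x + latticeVec p.2.1 p.2.2) '' frontier (S.Ω p.1) := by
    rintro x ⟨hx, hx'⟩
    obtain ⟨i, m, n, h⟩ := S.mem_closure_lattice.1 hx
    refine mem_iUnion.2 ⟨(i, m, n), mem_translate_iff.2 ⟨h, fun hin => ?_⟩⟩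
    rw [(S.isOpen i).interior_eq] at hin
    exact hx' (S.mem_lattice.2 ⟨i, m, n, hin⟩)
  refine (ae_eq_set).2 ⟨measure_mono_null h2 h1, ?_⟩
  rw [sdiff_eq_empty.2 subset_closure, measure_empty]

variable {p₁ p₂ : ℝ} (hu : S.SolvesCellBVP (S.rep τ φ ξ) p₁ p₂)

include hu

/-- The pieces of translated inclusions in the cell are, up to null sets, the pieces into which the
nine cells cut each `Ω i`. Periodicity of G and of the weight reassembles them into an integral over
`Ω i` against the gradient of the staircase, to which the weak jump relation applies. -/
theorem setIntegral_lattice_repGrad {ε : ℝ} (hε : ε ∈ Ioc (0 : ℝ) 1) :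
    ∫ x in openCell ∩ S.lattice, cellWeight ε x * (S.repGrad τ φ ξ x).re =
      ∑ i, ∫ t in (0 : ℝ)..(2 * Real.pi), S.density τ i t * stair ε (S.γ i t).re := by
  set N := (Finset.univ : Finset (Fin K)) ×ˢ (Finset.Icc (-1 : ℤ) 1 ×ˢ Finset.Icc (-1 : ℤ) 1)
    with hN
  set T : Fin K × ℤ × ℤ → Set ℂ := fun p =>
    openCell ∩ {x | x + latticeVec p.2.1 p.2.2 ∈ S.Ω p.1} with hT
  have hpre : ∀ p : Fin K × ℤ × ℤ, MeasurableSet {x | x + latticeVec p.2.1 p.2.2 ∈ S.Ω p.1} :=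
    fun p => ((S.isOpen p.1).preimage (continuous_id.add continuous_const)).measurableSet
  have hTmeas : ∀ p, MeasurableSet (T p) := fun p =>
    isOpen_openCell.measurableSet.inter (hpre p)
  have hunion : openCell ∩ S.lattice = ⋃ p ∈ N, T p := by
    ext x
    simp only [mem_iUnion, exists_prop]
    constructor
    · rintro ⟨hx, hxl⟩
      obtain ⟨i, m, n, h⟩ := S.mem_lattice.1 hxl
      have hs := S.subset_superCell i (subset_closure h)
      have key : ∀ (a : ℝ) (k : ℤ), |a| < 1 / 2 → |a - k| < 3 / 2 →
          -k ∈ Finset.Icc (-1 : ℤ) 1 := by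
        intro a k h1 h2
        refine int_mem_of_lt h2 ?_
        push_cast
        simpa using h1
      refine ⟨(i, -m, -n), Finset.mem_product.2 ⟨Finset.mem_univ _, Finset.mem_product.2
        ⟨key _ _ hx.1 ?_, key _ _ hx.2 ?_⟩⟩, hx, ?_⟩
      · have := hs.1; rwa [sub_re, latticeVec_re] at this
      · have := hs.2; rwa [sub_im, latticeVec_im] at this
      · rw [sub_eq_add_neg, latticeVec_neg] at h
        exact h
    · rintro ⟨⟨i, m, n⟩, -, hx, h⟩
      refine ⟨hx, S.mem_lattice.2 ⟨i, -m, -n, ?_⟩⟩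
      rw [sub_eq_add_neg, latticeVec_neg, neg_neg, neg_neg]
      exact h
  have hdisj : ∀ p q, p ≠ q → Disjoint (T p) (T q) := by
    rintro ⟨i, m, n⟩ ⟨j, m', n'⟩ hne
    refine Set.disjoint_left.2 fun x hx hx' => ?_
    have h1 : x + latticeVec m n ∈ closure (S.Ω i) := subset_closure hx.2
    have h2 : x + latticeVec m' n' ∈ closure (S.Ω j) := subset_closure hx'.2
    refine S.mem_isolatingNhd.1 (S.closure_subset_isolatingNhd i h1) j (m - m') (n - n') ?_ ?_
    · intro h
      simp only [Prod.mk.injEq, sub_eq_zero] at h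
      exact hne (by rw [h.1, h.2.1, h.2.2])
    · convert h2 using 1
      simp only [latticeVec]; push_cast; ring
  have hG : ∀ x ∈ openCell, ∀ m n, S.periodicGrad τ φ ξ (x + latticeVec m n) =
      S.repGrad τ φ ξ x := by
    intro x hx m n
    have := (S.eventually_periodicGrad_eq hτ hφ ξ hu (x₀ := x + latticeVec m n) (m := m) (n := n)
      (by rw [add_sub_cancel_right]; exact openCell_subset_closedCell hx)).self_of_nhds
    rwa [add_sub_cancel_right] at this
  have hint := S.integrableOn_weight_repGrad hτ hφ ξ ε
  rw [hunion, integral_biUnion_finset N (fun p _ => hTmeas p) (fun p _ q _ h => hdisj p q h)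
    (fun p _ => hint.mono_set inter_subset_left), hN, Finset.sum_product]
  refine Finset.sum_congr rfl fun i _ => ?_
  rw [← S.setIntegral_inclusion hτ hφ ξ hu i (contDiff_stair_re ε), Finset.sum_product]
  have hsub : S.Ω i ⊆ superCell := subset_closure.trans (S.subset_superCell i)
  set f : ℂ → ℝ := fun x => stairDeriv ε x.re * (S.periodicGrad τ φ ξ x).re with hf
  have hfint : IntegrableOn f (S.Ω i) :=
    (IntegrableOn.continuousOn_mul ((continuous_stairDeriv ε).comp continuous_re).continuousOn
      (S.integrableOn_periodicGrad hτ hφ ξ hu (S.isCompact_closure i)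
        (S.closure_subset_isolatingNhd i)).re (S.isCompact_closure i)).mono_set subset_closure
  have hlhs : ∫ x in S.Ω i, fderiv ℝ (fun x : ℂ => stair ε x.re) x
      (conj (S.periodicGrad τ φ ξ x)) = ∫ x in superCell, (S.Ω i).indicator f x := by
    rw [setIntegral_indicator (S.isOpen i).measurableSet, inter_eq_right.2 hsub]
    simp only [fderiv_stair_re, conj_re, hf]
  rw [hlhs, setIntegral_superCell_eq_sum
    ((hfint.integrable_indicator (S.isOpen i).measurableSet).integrableOn)]
  refine Finset.sum_congr rfl fun m hm => Finset.sum_congr rfl fun n _ => ?_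
  have hind : ∀ x : ℂ, (S.Ω i).indicator f (x + latticeVec m n) =
      {x | x + latticeVec m n ∈ S.Ω i}.indicator (fun x => f (x + latticeVec m n)) x :=
    fun x => rfl
  simp only [hind]
  rw [setIntegral_indicator (hpre (i, m, n))]
  refine setIntegral_congr_fun (hTmeas (i, m, n)) fun x hx => ?_
  simp only [hf]
  rw [hG x hx.1, add_re, latticeVec_re, stairDeriv_add_int hε hx.1.1 hm, cellWeight]

/-- The flux identity: the weighted horizontal flux outside the inclusions is the flux of the layer
through the boundary of the super-cell plus the contribution of the proxy functions. -/
theorem setIntegral_exterior_repGrad {ε : ℝ} (hε : ε ∈ Ioc (0 : ℝ) 1) :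
    ∫ x in openCell \ closure S.lattice, cellWeight ε x * (S.repGrad τ φ ξ x).re =
      S.stairFlux τ ε + ∫ x in openCell, cellWeight ε x * (proxyGrad φ ξ x).re := by
  have h1 := S.setIntegral_openCell_repGrad hτ hφ ξ hε
  have h2 := S.setIntegral_lattice_repGrad hτ hφ ξ hu hε
  have h3 := integral_inter_add_sdiff (s := openCell)
    (isClosed_closure (s := S.lattice)).measurableSet (S.integrableOn_weight_repGrad hτ hφ ξ ε)
  have h4 : (openCell ∩ closure S.lattice : Set ℂ) =ᵐ[volume] (openCell ∩ S.lattice : Set ℂ) :=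
    (ae_eq_refl _).inter S.closure_lattice_ae_eq
  rw [setIntegral_congr_set h4, h2, h1] at h3
  -- The curve integrals of the density occur both in the whole-cell integral and in its part inside
  -- the inclusions, and cancel.
  linarith

end Inclusions

/-! ### Concentration of the weight at the left wall -/

/-- The weight is at most C/ε and lives on an interval of length ε, so the bound does not depend on
ε. Only values of h close to the wall matter. -/
theorem abs_setIntegral_weight_le {C : NNReal} (hC : ∀ t, ‖deriv ramp t‖ ≤ C) {ε D : ℝ}
    (hε : ε ∈ Ioc (0 : ℝ) 1) {h : ℝ → ℝ}
    (hh : ∀ s ∈ Ioo (-(1 / 2) : ℝ) (-(1 / 2) + ε), |h s| ≤ D) :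
    |∫ s in Ioo (-(1 / 2) : ℝ) (1 / 2), deriv ramp ((s + 1 / 2) / ε) / ε * h s| ≤ C * D := by
  have h1 : ∫ s in Ioo (-(1 / 2) : ℝ) (1 / 2), deriv ramp ((s + 1 / 2) / ε) / ε * h s =
      ∫ s in Ioo (-(1 / 2) : ℝ) (-(1 / 2) + ε), deriv ramp ((s + 1 / 2) / ε) / ε * h s := by
    refine setIntegral_eq_of_subset_of_forall_sdiff_eq_zero measurableSet_Ioo
      (Ioo_subset_Ioo_right (by linarith [hε.2])) fun s hs => ?_
    have h2 : ε ≤ s + 1 / 2 := by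
      by_contra hlt
      exact hs.2 ⟨hs.1.1, by linarith⟩
    rw [deriv_ramp_of_ge ((one_le_div hε.1).2 h2), zero_div, zero_mul]
  rw [h1]
  have h3 := norm_setIntegral_le_of_norm_le_const (μ := volume)
    (s := Ioo (-(1 / 2) : ℝ) (-(1 / 2) + ε)) (C := C / ε * D)
    (f := fun s => deriv ramp ((s + 1 / 2) / ε) / ε * h s) (by simp) fun s hs => by
      rw [norm_mul, norm_div, Real.norm_of_nonneg hε.1.le]
      exact mul_le_mul (div_le_div_of_nonneg_right (hC _) hε.1.le) (hh s hs) (norm_nonneg _)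
        (div_nonneg C.2 hε.1.le)
  rw [Real.norm_eq_abs, Real.volume_real_Ioo_of_le (by linarith [hε.1])] at h3
  refine h3.trans (le_of_eq ?_)
  have := hε.1.ne'
  field_simp
  ring

theorem setIntegral_weight {ε : ℝ} (hε : ε ∈ Ioc (0 : ℝ) 1) :
    ∫ s in Ioo (-(1 / 2) : ℝ) (1 / 2), deriv ramp ((s + 1 / 2) / ε) / ε = 1 := by
  have hd : ∀ s : ℝ, HasDerivAt (fun s => ramp ((s + 1 / 2) / ε))
      (deriv ramp ((s + 1 / 2) / ε) / ε) s := fun s => by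
    have := (hasDerivAt_ramp ((s + 1 / 2) / ε)).comp s
      (((hasDerivAt_id s).add_const (1 / 2 : ℝ)).div_const ε)
    simpa [Function.comp_def, div_eq_mul_inv] using this
  rw [← integral_Ioc_eq_integral_Ioo, ← intervalIntegral.integral_of_le (by norm_num),
    intervalIntegral.integral_eq_sub_of_hasDerivAt (fun s _ => hd s)
      (((continuous_deriv_ramp.comp (by fun_prop)).div_const ε).intervalIntegrable _ _),
    ramp_of_ge, ramp_of_le]
  · norm_num
  · norm_num
  · rw [le_div_iff₀ hε.1]; linarith [hε.2]

theorem tendsto_setIntegral_weight {h : ℝ → ℝ} (hm : Measurable h) {D : ℝ} (hD : ∀ s, |h s| ≤ D)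
    {a : ℝ} (ha : Tendsto h (𝓝[>] (-(1 / 2))) (𝓝 a)) :
    Tendsto (fun ε : ℝ => ∫ s in Ioo (-(1 / 2) : ℝ) (1 / 2),
      deriv ramp ((s + 1 / 2) / ε) / ε * h s) (𝓝[>] 0) (𝓝 a) := by
  obtain ⟨C, hC⟩ := exists_deriv_ramp_bound
  rw [Metric.tendsto_nhds]
  intro η hη
  have hη' : 0 < η / (C + 1) := by positivity
  obtain ⟨δ, hδ, hs⟩ := mem_nhdsGT_iff_exists_Ioo_subset.1
    ((Metric.tendsto_nhds.1 ha) _ hη')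
  have hδ' : 0 < min 1 (δ + 1 / 2) := lt_min one_pos (by have : -(1 / 2) < δ := hδ; linarith)
  filter_upwards [Ioo_mem_nhdsGT hδ'] with ε hε
  have hε1 : ε ∈ Ioc (0 : ℝ) 1 := ⟨hε.1, hε.2.le.trans (min_le_left _ _)⟩
  have hw : Continuous fun s : ℝ => deriv ramp ((s + 1 / 2) / ε) / ε :=
    (continuous_deriv_ramp.comp (by fun_prop)).div_const ε
  have hwi : IntegrableOn (fun s : ℝ => deriv ramp ((s + 1 / 2) / ε) / ε)
      (Ioo (-(1 / 2)) (1 / 2)) := (hw.integrableOn_Icc).mono_set Ioo_subset_Icc_self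
  have hi : IntegrableOn (fun s => deriv ramp ((s + 1 / 2) / ε) / ε * h s)
      (Ioo (-(1 / 2)) (1 / 2)) := by
    refine Integrable.mul_bdd (c := D) hwi hm.aestronglyMeasurable (ae_of_all _ hD)
  have h1 : (∫ s in Ioo (-(1 / 2) : ℝ) (1 / 2), deriv ramp ((s + 1 / 2) / ε) / ε * h s) - a =
      ∫ s in Ioo (-(1 / 2) : ℝ) (1 / 2), deriv ramp ((s + 1 / 2) / ε) / ε * (h s - a) := by
    simp only [mul_sub]
    rw [integral_sub hi (hwi.mul_const a), integral_mul_const, setIntegral_weight hε1, one_mul]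
  rw [Real.dist_eq, h1]
  refine (abs_setIntegral_weight_le hC hε1 (D := η / (C + 1)) fun s hs' => ?_).trans_lt ?_
  · have : s < δ := by linarith [hs'.2, hε.2.trans_le (min_le_right _ _)]
    have h2 := hs ⟨hs'.1, this⟩
    exact (show dist (h s) a < _ from h2).le
  · rw [mul_div_assoc', div_lt_iff₀ (by positivity)]
    nlinarith

/-- At each height the weight is an approximate identity for the right-hand limit at the wall;
dominated convergence in the height then needs these limits only almost everywhere. -/
theorem tendsto_setIntegral_cellWeight {f : ℂ → ℝ} (hf : Measurable f) {D : ℝ}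
    (hD : ∀ x, |f x| ≤ D) {f₀ : ℝ → ℝ}
    (h : ∀ᵐ t : ℝ ∂volume.restrict (Ioo (-(1 / 2) : ℝ) (1 / 2)),
      Tendsto (fun s : ℝ => f (s + t * I)) (𝓝[>] (-(1 / 2))) (𝓝 (f₀ t))) :
    Tendsto (fun ε => ∫ x in openCell, cellWeight ε x * f x) (𝓝[>] 0)
      (𝓝 (∫ t in Ioo (-(1 / 2) : ℝ) (1 / 2), f₀ t)) := by
  obtain ⟨C, hC⟩ := exists_deriv_ramp_bound
  have hmeas : Measurable fun p : ℝ × ℝ => f (p.1 + p.2 * I) := hf.comp (by fun_prop)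
  have hslice : ∀ t : ℝ, Measurable fun s : ℝ => f (s + t * I) := fun t => hf.comp (by fun_prop)
  have key : ∀ ε ∈ Ioc (0 : ℝ) 1, ∫ x in openCell, cellWeight ε x * f x =
      ∫ t in Ioo (-(1 / 2) : ℝ) (1 / 2), ∫ s in Ioo (-(1 / 2) : ℝ) (1 / 2),
        deriv ramp ((s + 1 / 2) / ε) / ε * f (s + t * I) := by
    intro ε hε
    have hwi : IntegrableOn (fun x => cellWeight ε x * f x) openCell :=
      Integrable.mul_bdd (c := D) (((continuous_cellWeight ε).continuousOn.integrableOn_compact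
        isCompact_closedCell).mono_set openCell_subset_closedCell) hf.aestronglyMeasurable
        (ae_of_all _ hD)
    rw [openCell_eq] at hwi ⊢
    have hre : ∀ s t : ℝ, ((s : ℂ) + t * I).re = s := fun s t => by simp
    rw [setIntegral_reProdIm hwi]
    simp only [cellWeight, hre]
    refine integral_integral_swap ?_
    rw [Measure.prod_restrict]
    refine Integrable.mul_bdd (c := D) ?_ hmeas.aestronglyMeasurable (ae_of_all _ fun p => hD _)
    refine (ContinuousOn.integrableOn_compact
      (isCompact_Icc (a := (-(1 / 2) : ℝ)) (b := 1 / 2) |>.prod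
        (isCompact_Icc (a := (-(1 / 2) : ℝ)) (b := 1 / 2))) ?_).mono_set
      (prod_mono Ioo_subset_Icc_self Ioo_subset_Icc_self)
    exact ((continuous_deriv_ramp.comp (by fun_prop)).div_const ε).continuousOn
  refine Tendsto.congr' (f₁ := fun ε => ∫ t in Ioo (-(1 / 2) : ℝ) (1 / 2),
    ∫ s in Ioo (-(1 / 2) : ℝ) (1 / 2), deriv ramp ((s + 1 / 2) / ε) / ε * f (s + t * I)) ?_ ?_
  · filter_upwards [Ioc_mem_nhdsGT one_pos] with ε hε using (key ε hε).symm
  refine tendsto_integral_filter_of_dominated_convergence (fun _ => C * D) ?_ ?_ ?_ ?_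
  · refine Eventually.of_forall fun ε => ?_
    refine (StronglyMeasurable.integral_prod_right
      (f := fun (t s : ℝ) => deriv ramp ((s + 1 / 2) / ε) / ε * f (s + t * I))
      ?_).aestronglyMeasurable
    refine Measurable.stronglyMeasurable ?_
    exact ((continuous_deriv_ramp.comp (by fun_prop)).div_const ε).measurable.mul
      (hf.comp (by fun_prop))
  · filter_upwards [Ioc_mem_nhdsGT one_pos] with ε hε
    exact ae_of_all _ fun t => abs_setIntegral_weight_le hC hε fun s _ => hD _
  · exact integrableOn_const (by simp)
  · filter_upwards [h] with t ht
    exact tendsto_setIntegral_weight (hslice t) (fun s => hD _) ht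

/-- The level set of a function is countable away from the critical points. -/
theorem countable_level_set {g : ℝ → ℝ} (hg : Differentiable ℝ g) (c : ℝ) :
    {s | g s = c ∧ deriv g s ≠ 0}.Countable := by
  have : DiscreteTopology {s | g s = c ∧ deriv g s ≠ 0} := by
    -- A point with nonzero derivative is isolated in its level set, and a discrete Lindelöf space
    -- is countable.
    refine discreteTopology_subtype_iff.2 fun s hs => ?_
    refine inf_principal_eq_bot.2 ?_
    filter_upwards [(hg s).hasDerivAt.eventually_ne hs.2 (c := c)] with x hx hx'
    exact hx hx'.1
  exact Set.countable_coe_iff.1 (countable_of_Lindelof_of_discrete)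

theorem tendsto_wallL (t : ℝ) :
    Tendsto (fun s : ℝ => (s : ℂ) + t * I) (𝓝[>] (-(1 / 2))) (𝓝 (wallL t)) := by
  have h : Continuous fun s : ℝ => (s : ℂ) + t * I := by fun_prop
  convert (h.tendsto (-(1 / 2))).mono_left (nhdsWithin_le_nhds (s := Ioi (-(1 / 2)))) using 2
  simp [wallL]

/-! ### The exterior horizontal derivative near the left wall -/

namespace Inclusions

variable {K : ℕ} (S : Inclusions K) {τ : ℂ → ℝ} (hτ : ContinuousOn τ S.bdry) {M : ℕ}
  {φ : Fin M → ℂ → ℝ} (hφ : ∀ j, HarmonicOnNhd (φ j) closedCell) (ξ : Fin M → ℝ)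

variable (τ φ) in
/-- The horizontal derivative of the representation in the cell outside the inclusions, extended
by zero. -/
def exteriorDeriv (x : ℂ) : ℝ :=
  (closedCell \ closure S.lattice).indicator (fun x => (S.repGrad τ φ ξ x).re) x

theorem measurableSet_exterior : MeasurableSet (closedCell \ closure S.lattice) :=
  isClosed_closedCell.measurableSet.inter isClosed_closure.isOpen_compl.measurableSet

theorem mem_closure_lattice_cases {x : ℂ} (hx : x ∈ closure S.lattice) :
    x ∈ S.lattice ∨ ∃ i t m n, x = S.γ i t + latticeVec m n := by
  obtain ⟨i, m, n, h⟩ := S.mem_closure_lattice.1 hx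
  by_cases h' : x - latticeVec m n ∈ S.Ω i
  · exact Or.inl (S.mem_lattice.2 ⟨i, m, n, h'⟩)
  · have h1 : x - latticeVec m n ∈ frontier (S.Ω i) := ⟨h, by rwa [(S.isOpen i).interior_eq]⟩
    rw [S.frontier_eq] at h1
    obtain ⟨t, ht⟩ := h1
    exact Or.inr ⟨i, t, m, n, by rw [ht, sub_add_cancel]⟩

theorem eventually_notMem_exterior {x : ℂ} (hx : x ∈ S.lattice) :
    ∀ᶠ y in 𝓝 x, y ∉ closedCell \ closure S.lattice := by
  filter_upwards [S.isOpen_lattice.mem_nhds hx] with y hy h using h.2 (subset_closure hy)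

include hτ hφ

theorem measurable_exteriorDeriv : Measurable (S.exteriorDeriv τ φ ξ) := by
  classical
  have h1 : ContinuousOn (fun x => (S.repGrad τ φ ξ x).re) (closedCell \ closure S.lattice) :=
    fun x hx => (continuous_re.continuousAt.comp
      (S.analyticAt_repGrad hτ hφ ξ hx.1 hx.2).continuousAt).continuousWithinAt
  have h2 := h1.measurable_piecewise (g := (0 : ℂ → ℝ)) continuousOn_const
    S.measurableSet_exterior
  rw [piecewise_eq_indicator] at h2
  exact h2

variable {p₁ p₂ : ℝ} (hu : S.SolvesCellBVP (S.rep τ φ ξ) p₁ p₂)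

include hu

theorem exists_tendsto_exterior {x : ℂ} (hx : x ∈ closedCell) :
    ∃ a, Tendsto (S.repGrad τ φ ξ) (𝓝[closedCell \ closure S.lattice] x) (𝓝 a) := by
  by_cases h : x ∈ closure S.lattice
  · rcases S.mem_closure_lattice_cases h with h | ⟨i, t, m, n, rfl⟩
    · refine ⟨0, ?_⟩
      -- Inside an inclusion the exterior filter is trivial, so any value serves as the limit.
      rw [nhdsWithin, inf_principal_eq_bot.2 (S.eventually_notMem_exterior h)]
      exact tendsto_bot
    · obtain ⟨a, ha, -⟩ := S.exists_tendsto_repGrad hτ hφ ξ hu i t m n hx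
      exact ⟨a, ha⟩
  · exact ⟨_, (S.analyticAt_repGrad hτ hφ ξ hx h).continuousAt.tendsto.mono_left
      nhdsWithin_le_nhds⟩

theorem exists_bound_exteriorDeriv : ∃ D, ∀ x, |S.exteriorDeriv τ φ ξ x| ≤ D := by
  have h : ∃ D, 0 ≤ D ∧ ∀ x ∈ closedCell, |S.exteriorDeriv τ φ ξ x| ≤ D := by
    refine isCompact_closedCell.induction_on
      (p := fun s => ∃ D, 0 ≤ D ∧ ∀ x ∈ s, |S.exteriorDeriv τ φ ξ x| ≤ D) ⟨0, le_rfl, by simp⟩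
      (fun s t hst ⟨D, h0, hD⟩ => ⟨D, h0, fun x hx => hD x (hst hx)⟩)
      (fun s t ⟨D, h0, hD⟩ ⟨D', h0', hD'⟩ => ⟨max D D', h0.trans (le_max_left _ _), ?_⟩) ?_
    · rintro x (hx | hx)
      · exact (hD x hx).trans (le_max_left _ _)
      · exact (hD' x hx).trans (le_max_right _ _)
    · intro x hx
      obtain ⟨a, ha⟩ := S.exists_tendsto_exterior hτ hφ ξ hu hx
      have h1 := eventually_nhdsWithin_iff.1 (ha.norm.eventually (gt_mem_nhds (lt_add_one _)))
      refine ⟨_, mem_nhdsWithin_of_mem_nhds h1, ‖a‖ + 1, by positivity, fun y hy => ?_⟩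
      rw [exteriorDeriv]
      by_cases hE : y ∈ closedCell \ closure S.lattice
      · rw [indicator_of_mem hE]
        exact (abs_re_le_norm _).trans (hy hE).le
      · rw [indicator_of_notMem hE, abs_zero]
        positivity
  obtain ⟨D, h0, hD⟩ := h
  refine ⟨D, fun x => ?_⟩
  by_cases hx : x ∈ closedCell
  · exact hD x hx
  · rw [exteriorDeriv, indicator_of_notMem fun h => hx h.1, abs_zero]
    exact h0

omit hτ hφ hu in
-- These are the heights at which a boundary curve crosses L transversally, where the extension of
-- u_x by zero may jump. They form a null set, so no limit is needed there.
theorem countable_vertical_crossings : {t : ℝ | ∃ i s m n, wallL t = S.γ i s + latticeVec m n ∧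
    (deriv (S.γ i) s).re ≠ 0}.Countable := by
  have hd : ∀ i s, HasDerivAt (fun s => (S.γ i s).re) (deriv (S.γ i) s).re s := fun i s =>
    reCLM.hasFDerivAt.comp_hasDerivAt s ((S.contDiff i).differentiable (by simp) s).hasDerivAt
  have h : (⋃ p : Fin K × ℤ × ℤ, (fun s => (S.γ p.1 s + latticeVec p.2.1 p.2.2).im) ''
      {s | (S.γ p.1 s).re = -(1 / 2) - p.2.1 ∧
        deriv (fun s => (S.γ p.1 s).re) s ≠ 0}).Countable :=
    countable_iUnion fun p => (countable_level_set
      (fun s => (hd p.1 s).differentiableAt) _).image _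
  refine h.mono ?_
  rintro t ⟨i, s, m, n, h, hne⟩
  refine mem_iUnion.2 ⟨(i, m, n), s, ⟨?_, by rwa [(hd i s).deriv]⟩, ?_⟩
  · have := congrArg re h
    simp only [add_re, latticeVec_re] at this
    rw [eq_sub_iff_add_eq, ← this]
    simp [wallL]
  · simp only [← h]
    simp [wallL]

/-- Off the inclusions this is continuity, and inside them both sides are zero. At a boundary point
that is not a transversal crossing the tangent is vertical, so the normal is horizontal and the
Neumann condition says exactly that u_x tends to 0, matching the extension by zero. -/
theorem tendsto_exteriorDeriv_wallL : ∀ᵐ t : ℝ ∂volume.restrict (Ioo (-(1 / 2) : ℝ) (1 / 2)),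
    Tendsto (fun s : ℝ => S.exteriorDeriv τ φ ξ (s + t * I)) (𝓝[>] (-(1 / 2)))
      (𝓝 (S.exteriorDeriv τ φ ξ (wallL t))) := by
  rw [ae_restrict_iff' measurableSet_Ioo]
  filter_upwards [S.countable_vertical_crossings.ae_notMem volume] with t hcr ht
  have hcell := wallL_mem (Ioo_subset_Icc_self ht)
  have hpath := tendsto_wallL t
  by_cases h : wallL t ∈ closure S.lattice
  · have h0 : S.exteriorDeriv τ φ ξ (wallL t) = 0 := indicator_of_notMem (fun h' => h'.2 h) _
    rw [h0]
    rcases S.mem_closure_lattice_cases h with h | ⟨i, s, m, n, hs⟩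
    · refine tendsto_const_nhds.congr' ?_
      filter_upwards [hpath.eventually (S.eventually_notMem_exterior h)] with r hr
      exact (indicator_of_notMem hr _).symm
    · have hre : (deriv (S.γ i) s).re = 0 := by
        by_contra hne
        exact hcr ⟨i, s, m, n, hs, hne⟩
      obtain ⟨a, ha, hn⟩ := S.exists_tendsto_repGrad hτ hφ ξ hu i s m n (hs ▸ hcell)
      rw [← hs] at ha
      have hd : deriv (S.γ i) s = (deriv (S.γ i) s).im * I := by
        apply Complex.ext <;> simp [hre]
      have him : (deriv (S.γ i) s).im ≠ 0 := fun h0 => S.regular i s (by rw [hd, h0]; simp)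
      have ha0 : a.re = 0 := by
        have hnorm : S.normal i s =
            (((deriv (S.γ i) s).im / ‖deriv (S.γ i) s‖ : ℝ) : ℂ) := by
          rw [normal]
          nth_rewrite 1 [hd]
          push_cast
          linear_combination (-((deriv (S.γ i) s).im : ℂ) / ‖deriv (S.γ i) s‖) * I_sq
        rw [hnorm, re_mul_ofReal] at hn
        exact (mul_eq_zero.1 hn).resolve_right (div_ne_zero him (norm_ne_zero_iff.2
          (S.regular i s)))
      have hlim : Tendsto (fun y => (S.repGrad τ φ ξ y).re)
          (𝓝[closedCell \ closure S.lattice] (wallL t)) (𝓝 0) :=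
        ha0 ▸ (continuous_re.tendsto a).comp ha
      refine Tendsto.comp (y := 𝓝 (wallL t)) (Metric.tendsto_nhds.2 fun η hη => ?_) hpath
      filter_upwards [eventually_nhdsWithin_iff.1 (Metric.tendsto_nhds.1 hlim η hη)] with y hy
      by_cases hE : y ∈ closedCell \ closure S.lattice
      · rw [indicator_of_mem hE]
        exact hy hE
      · rw [indicator_of_notMem hE, dist_self]
        exact hη
  · have h1 := (continuous_re.continuousAt.comp
      (S.analyticAt_repGrad hτ hφ ξ hcell h).continuousAt).tendsto.comp hpath
    have h0 : S.exteriorDeriv τ φ ξ (wallL t) = (S.repGrad τ φ ξ (wallL t)).re :=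
      indicator_of_mem
        (show wallL t ∈ closedCell \ closure S.lattice from ⟨hcell, h⟩) _
    rw [h0]
    refine h1.congr' ?_
    filter_upwards [hpath.eventually ((isClosed_closure (s := S.lattice)).isOpen_compl.mem_nhds h),
      Ioo_mem_nhdsGT (show (-(1 / 2) : ℝ) < 1 / 2 by norm_num)] with s hs hs'
    refine (indicator_of_mem (show (s : ℂ) + t * I ∈ closedCell \ closure S.lattice from
      ⟨⟨?_, ?_⟩, hs⟩) _).symm
    · simpa using abs_le.2 ⟨hs'.1.le, hs'.2.le⟩
    · simpa using abs_le.2 ⟨ht.1.le, ht.2.le⟩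

end Inclusions

/-! ### Limits of the boundary and proxy fluxes -/

theorem intervalIntegral_eq_sum_unit {f : ℝ → ℝ}
    (hf : ContinuousOn f (Icc (-(3 / 2)) (3 / 2))) :
    ∫ t in (-(3 / 2) : ℝ)..(3 / 2), f t =
      ∑ m ∈ Finset.Icc (-1 : ℤ) 1, ∫ s in (-(1 / 2) : ℝ)..(1 / 2), f (s + m) := by
  have hi : ∀ a b : ℝ, -(3 / 2) ≤ a → a ≤ b → b ≤ 3 / 2 →
      IntervalIntegrable f volume a b := fun a b h1 h2 h3 =>
    ContinuousOn.intervalIntegrable (hf.mono (by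
      rw [uIcc_of_le h2]; exact Icc_subset_Icc h1 h3))
  rw [show Finset.Icc (-1 : ℤ) 1 = {-1, 0, 1} from rfl, Finset.sum_insert (by decide),
    Finset.sum_insert (by decide), Finset.sum_singleton]
  simp only [intervalIntegral.integral_comp_add_right]
  rw [← intervalIntegral.integral_add_adjacent_intervals (b := -(1 / 2))
    (hi _ _ (by norm_num) (by norm_num) (by norm_num))
    (hi _ _ (by norm_num) (by norm_num) (by norm_num)),
    ← intervalIntegral.integral_add_adjacent_intervals (a := -(1 / 2)) (b := 1 / 2) (c := 3 / 2)
    (hi _ _ (by norm_num) (by norm_num) (by norm_num))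
    (hi _ _ (by norm_num) (by norm_num) (by norm_num))]
  norm_num

/-- On the unit interval about m the staircase is m + 1 plus a ramp that tends to 1 at every
interior point as ε → 0; this produces the coefficient m + 2. -/
theorem tendsto_integral_stair {g : ℝ → ℝ} (hg : ContinuousOn g (Icc (-(3 / 2)) (3 / 2))) :
    Tendsto (fun ε => ∫ t in (-(3 / 2) : ℝ)..(3 / 2), stair ε t * g t) (𝓝[>] 0)
      (𝓝 (∑ m ∈ Finset.Icc (-1 : ℤ) 1,
        ((m : ℝ) + 2) * ∫ s in (-(1 / 2) : ℝ)..(1 / 2), g (s + m))) := by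
  have hmaps : ∀ m ∈ Finset.Icc (-1 : ℤ) 1, MapsTo (fun s : ℝ => s + m) (Icc (-(1 / 2)) (1 / 2))
      (Icc (-(3 / 2)) (3 / 2)) := fun m hm s hs => by
    have h1 : (-1 : ℝ) ≤ m := by exact_mod_cast (Finset.mem_Icc.1 hm).1
    have h2 : (m : ℝ) ≤ 1 := by exact_mod_cast (Finset.mem_Icc.1 hm).2
    constructor <;> linarith [hs.1, hs.2]
  have hgm : ∀ m ∈ Finset.Icc (-1 : ℤ) 1,
      ContinuousOn (fun s : ℝ => g (s + m)) (Icc (-(1 / 2)) (1 / 2)) := fun m hm =>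
    hg.comp (by fun_prop) (hmaps m hm)
  have key : ∀ ε ∈ Ioc (0 : ℝ) 1, ∫ t in (-(3 / 2) : ℝ)..(3 / 2), stair ε t * g t =
      ∑ m ∈ Finset.Icc (-1 : ℤ) 1, ∫ s in (-(1 / 2) : ℝ)..(1 / 2),
        ((m + 1) + ramp ((s + 1 / 2) / ε)) * g (s + m) := by
    intro ε hε
    rw [intervalIntegral_eq_sum_unit (f := fun t => stair ε t * g t)
      ((contDiff_stair ε).continuous.continuousOn.mul hg)]
    refine Finset.sum_congr rfl fun m hm => intervalIntegral.integral_congr fun s hs => ?_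
    rw [uIcc_of_le (by norm_num)] at hs
    rw [stair_add_int hε (abs_le.2 hs) hm]
  refine Tendsto.congr' (f₁ := fun ε => ∑ m ∈ Finset.Icc (-1 : ℤ) 1,
    ∫ s in (-(1 / 2) : ℝ)..(1 / 2), ((m + 1) + ramp ((s + 1 / 2) / ε)) * g (s + m)) ?_ ?_
  · filter_upwards [Ioc_mem_nhdsGT one_pos] with ε hε using (key ε hε).symm
  refine tendsto_finsetSum _ fun m hm => ?_
  rw [← intervalIntegral.integral_const_mul]
  have hgi : IntervalIntegrable (fun s : ℝ => g (s + m)) volume (-(1 / 2)) (1 / 2) :=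
    ContinuousOn.intervalIntegrable (by rw [uIcc_of_le (by norm_num)]; exact hgm m hm)
  refine intervalIntegral.tendsto_integral_filter_of_dominated_convergence
    (fun s => (|(m : ℝ) + 1| + 1) * |g (s + m)|) ?_ ?_ (hgi.abs.const_mul _) ?_
  · refine Eventually.of_forall fun ε => ?_
    refine AEStronglyMeasurable.mul ?_ (by
      rw [uIoc_of_le (by norm_num)]; exact hgi.1.aestronglyMeasurable)
    exact (continuous_const.add (contDiff_ramp.continuous.comp
      (by fun_prop))).aestronglyMeasurable
  · refine Eventually.of_forall fun ε => ae_of_all _ fun s _ => ?_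
    rw [norm_mul]
    refine mul_le_mul_of_nonneg_right ((norm_add_le _ _).trans ?_) (norm_nonneg _)
    refine add_le_add le_rfl ?_
    rw [Real.norm_of_nonneg (ramp_mem_Icc _).1]
    exact (ramp_mem_Icc _).2
  · refine ae_of_all _ fun s hs => ?_
    rw [uIoc_of_le (by norm_num)] at hs
    have hs' : 0 < s + 1 / 2 := by linarith [hs.1]
    refine tendsto_const_nhds.congr' ?_
    filter_upwards [Ioo_mem_nhdsGT hs'] with ε hε
    rw [ramp_of_ge ((one_le_div hε.1).2 hε.2.le)]
    ring

namespace Inclusions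

variable {K : ℕ} (S : Inclusions K) {τ : ℂ → ℝ} (hτ : ContinuousOn τ S.bdry) {M : ℕ}
  {φ : Fin M → ℂ → ℝ} (hφ : ∀ j, HarmonicOnNhd (φ j) closedCell) (ξ : Fin M → ℝ)

include hτ

theorem fderiv_singleLayer {x : ℂ} (hx : x ∉ superCell) (a : ℂ) :
    fderiv ℝ (S.singleLayer τ) x a = (S.layerSumGrad τ x * a).re := by
  rw [(S.hasFDerivAt_singleLayer hτ fun i =>
    S.notMem_closure_of_notMem_superCell hx).fderiv, gradCLM_apply, layerSumGrad]

theorem continuous_layerSumGrad_comp {p : ℝ → ℂ} (hp : Continuous p) (h : ∀ t, p t ∉ superCell)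
    (a : ℂ) : Continuous fun t => (S.layerSumGrad τ (p t) * a).re := by
  refine continuous_re.comp (Continuous.mul ?_ continuous_const)
  refine continuous_iff_continuousAt.2 fun t => ContinuousAt.comp
    (g := S.layerSumGrad τ) (S.analyticAt_layerSumGrad hτ ?_).continuousAt hp.continuousAt
  simp only [mem_iUnion, not_exists]
  exact fun i => S.notMem_closure_of_notMem_superCell (h t)

theorem tendsto_stairFlux : Tendsto (S.stairFlux τ) (𝓝[>] 0)
    (𝓝 (∑ m ∈ Finset.Icc (-1 : ℤ) 1, ((m : ℝ) + 2) *
        (wallFlux (S.singleLayer τ) wallU (latticeVec m 1) I -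
          wallFlux (S.singleLayer τ) wallD (latticeVec m (-1)) I) +
      3 * ∑ n ∈ Finset.Icc (-1 : ℤ) 1, wallFlux (S.singleLayer τ) wallR (latticeVec 1 n) 1)) := by
  have hU : ∀ t : ℝ, (t : ℂ) + (3 / 2 : ℝ) * I ∉ superCell := fun t h => by
    have := h.2; norm_num [abs_of_pos] at this
  have hD : ∀ t : ℝ, (t : ℂ) + (-(3 / 2) : ℝ) * I ∉ superCell := fun t h => by
    have := h.2; norm_num [abs_of_neg] at this
  have hR : ∀ t : ℝ, ((3 / 2 : ℝ) : ℂ) + t * I ∉ superCell := fun t h => by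
    have := h.1; norm_num [abs_of_pos] at this
  have hgU := S.continuous_layerSumGrad_comp hτ (by fun_prop) hU I
  have hgD := S.continuous_layerSumGrad_comp hτ (by fun_prop) hD I
  have hgR := S.continuous_layerSumGrad_comp hτ (by fun_prop) hR 1
  have hfU : ∀ m : ℤ, wallFlux (S.singleLayer τ) wallU (latticeVec m 1) I =
      ∫ s in (-(1 / 2) : ℝ)..(1 / 2),
        (S.layerSumGrad τ ((s + m : ℝ) + (3 / 2 : ℝ) * I) * I).re := fun m => by
    refine intervalIntegral.integral_congr fun s _ => ?_
    have : wallU s + latticeVec m 1 = (s + m : ℝ) + (3 / 2 : ℝ) * I := by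
      simp only [wallU, latticeVec]; push_cast; ring
    simp only [this]
    exact S.fderiv_singleLayer hτ (hU _) I
  have hfD : ∀ m : ℤ, wallFlux (S.singleLayer τ) wallD (latticeVec m (-1)) I =
      ∫ s in (-(1 / 2) : ℝ)..(1 / 2),
        (S.layerSumGrad τ ((s + m : ℝ) + (-(3 / 2) : ℝ) * I) * I).re := fun m => by
    refine intervalIntegral.integral_congr fun s _ => ?_
    have : wallD s + latticeVec m (-1) = (s + m : ℝ) + (-(3 / 2) : ℝ) * I := by
      simp only [wallD, latticeVec]; push_cast; ring
    simp only [this]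
    exact S.fderiv_singleLayer hτ (hD _) I
  have hfR : ∀ n : ℤ, wallFlux (S.singleLayer τ) wallR (latticeVec 1 n) 1 =
      ∫ s in (-(1 / 2) : ℝ)..(1 / 2),
        (S.layerSumGrad τ ((3 / 2 : ℝ) + (s + n : ℝ) * I) * 1).re := fun n => by
    refine intervalIntegral.integral_congr fun s _ => ?_
    have : wallR s + latticeVec 1 n = (3 / 2 : ℝ) + (s + n : ℝ) * I := by
      simp only [wallR, latticeVec]; push_cast; ring
    simp only [this]
    exact S.fderiv_singleLayer hτ (hR _) 1
  simp only [hfU, hfD, hfR, mul_sub, Finset.sum_sub_distrib]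
  rw [← intervalIntegral_eq_sum_unit hgR.continuousOn]
  simp only [mul_one]
  exact ((tendsto_integral_stair hgU.continuousOn).sub
    (tendsto_integral_stair hgD.continuousOn)).add_const _

omit hτ in
include hφ in
theorem tendsto_proxyFlux : Tendsto
    (fun ε => ∫ x in openCell, cellWeight ε x * (proxyGrad φ ξ x).re) (𝓝[>] 0)
    (𝓝 (∫ t in Ioo (-(1 / 2) : ℝ) (1 / 2), (proxyGrad φ ξ (wallL t)).re)) := by
  classical
  have hc : ContinuousOn (fun x => (proxyGrad φ ξ x).re) closedCell := fun x hx =>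
    (continuous_re.continuousAt.comp
      (analyticAt_proxyGrad hφ ξ hx).continuousAt).continuousWithinAt
  -- Outside the closed cell the proxy gradient is not controlled; extension by zero provides the
  -- global bound and measurability required for the limit.
  set f := closedCell.indicator fun x => (proxyGrad φ ξ x).re with hf
  have hm : Measurable f := by
    have h2 := hc.measurable_piecewise (g := (0 : ℂ → ℝ)) continuousOn_const
      isClosed_closedCell.measurableSet
    rw [piecewise_eq_indicator] at h2
    exact h2
  obtain ⟨D, hD⟩ := isCompact_closedCell.exists_bound_of_continuousOn hc
  have hb : ∀ x, |f x| ≤ max D 0 := fun x => by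
    by_cases hx : x ∈ closedCell
    · rw [hf, indicator_of_mem hx]
      exact (hD x hx).trans (le_max_left _ _)
    · rw [hf, indicator_of_notMem hx, abs_zero]
      exact le_max_right _ _
  have h := tendsto_setIntegral_cellWeight hm hb (f₀ := fun t => (proxyGrad φ ξ (wallL t)).re) (by
    rw [ae_restrict_iff' measurableSet_Ioo]
    refine ae_of_all _ fun t ht => ?_
    refine ((continuous_re.continuousAt.comp (analyticAt_proxyGrad hφ ξ
      (wallL_mem (Ioo_subset_Icc_self ht))).continuousAt).tendsto.comp
      (tendsto_wallL t)).congr' ?_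
    filter_upwards [Ioo_mem_nhdsGT (show (-(1 / 2) : ℝ) < 1 / 2 by norm_num)] with s hs
    refine (indicator_of_mem (show (s : ℂ) + t * I ∈ closedCell from ⟨?_, ?_⟩) _).symm
    · simpa using abs_le.2 ⟨hs.1.le, hs.2.le⟩
    · simpa using abs_le.2 ⟨ht.1.le, ht.2.le⟩)
  refine h.congr fun ε => setIntegral_congr_fun isOpen_openCell.measurableSet fun x hx => ?_
  simp only [hf]
  rw [indicator_of_mem (openCell_subset_closedCell hx)]

include hφ

variable {p₁ p₂ : ℝ} (hu : S.SolvesCellBVP (S.rep τ φ ξ) p₁ p₂)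

theorem fderiv_rep_wallL {t : ℝ} (ht : t ∈ S.openL) :
    fderiv ℝ (S.rep τ φ ξ) (wallL t) 1 = S.exteriorDeriv τ φ ξ (wallL t) := by
  have h : S.exteriorDeriv τ φ ξ (wallL t) = (S.repGrad τ φ ξ (wallL t)).re := indicator_of_mem
    (show wallL t ∈ closedCell \ closure S.lattice from ⟨wallL_mem ht.1, ht.2⟩) _
  rw [S.fderiv_rep hτ hφ ξ (wallL_mem ht.1) ht.2, mul_one, h]

omit hτ hφ in
theorem measurableSet_openL : MeasurableSet S.openL :=
  measurableSet_Icc.inter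
    ((isClosed_closure (s := S.lattice)).isOpen_compl.preimage continuous_wallL).measurableSet

include hu

theorem integrableOn_openL :
    IntegrableOn (fun t => fderiv ℝ (S.rep τ φ ξ) (wallL t) 1) S.openL := by
  obtain ⟨D, hD⟩ := S.exists_bound_exteriorDeriv hτ hφ ξ hu
  refine IntegrableOn.congr_fun (f := fun t => S.exteriorDeriv τ φ ξ (wallL t)) ?_
    (fun t ht => (S.fderiv_rep_wallL hτ hφ ξ ht).symm) S.measurableSet_openL
  refine Measure.integrableOn_of_bounded (M := D) ?_
    ((S.measurable_exteriorDeriv hτ hφ ξ).comp continuous_wallL.measurable).aestronglyMeasurable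
    (ae_of_all _ fun t => hD _)
  exact ((measure_mono fun t ht => ht.1).trans_lt (measure_Icc_lt_top (a := (-(1 / 2) : ℝ))
    (b := 1 / 2))).ne

omit hu in
theorem fluxJ₁_eq : S.fluxJ₁ (S.rep τ φ ξ) =
    ∫ t in Ioo (-(1 / 2) : ℝ) (1 / 2), S.exteriorDeriv τ φ ξ (wallL t) := by
  rw [fluxJ₁, setIntegral_congr_fun S.measurableSet_openL
    fun t ht => S.fderiv_rep_wallL hτ hφ ξ ht, ← integral_Icc_eq_integral_Ioo]
  refine (setIntegral_eq_of_subset_of_forall_sdiff_eq_zero measurableSet_Icc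
    (fun t ht => ht.1) fun t ht => ?_).symm
  exact indicator_of_notMem (fun h => ht.2 ⟨ht.1, h.2⟩) _

theorem tendsto_exteriorFlux : Tendsto
    (fun ε => ∫ x in openCell \ closure S.lattice, cellWeight ε x * (S.repGrad τ φ ξ x).re)
    (𝓝[>] 0) (𝓝 (S.fluxJ₁ (S.rep τ φ ξ))) := by
  obtain ⟨D, hD⟩ := S.exists_bound_exteriorDeriv hτ hφ ξ hu
  rw [S.fluxJ₁_eq hτ hφ ξ]
  refine (tendsto_setIntegral_cellWeight (S.measurable_exteriorDeriv hτ hφ ξ) hD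
    (S.tendsto_exteriorDeriv_wallL hτ hφ ξ hu)).congr fun ε => ?_
  rw [setIntegral_eq_of_subset_of_forall_sdiff_eq_zero isOpen_openCell.measurableSet
    (sdiff_subset (t := closure S.lattice)) fun x hx => ?_]
  · refine setIntegral_congr_fun (isOpen_openCell.measurableSet.inter
      isClosed_closure.isOpen_compl.measurableSet) fun x hx => ?_
    rw [show S.exteriorDeriv τ φ ξ x = (S.repGrad τ φ ξ x).re from indicator_of_mem
      (show x ∈ closedCell \ closure S.lattice from ⟨openCell_subset_closedCell hx.1, hx.2⟩) _]
  · rw [show S.exteriorDeriv τ φ ξ x = 0 from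
      indicator_of_notMem (fun h => hx.2 ⟨hx.1, h.2⟩) _, mul_zero]

/-- Both sides are limits, as ε → 0, of the two sides of the weighted flux identity, which holds for
every ε in (0, 1]. -/
theorem fluxJ₁_rep : S.fluxJ₁ (S.rep τ φ ξ) =
    ∑ m ∈ Finset.Icc (-1 : ℤ) 1, ((m : ℝ) + 2) *
        (wallFlux (S.singleLayer τ) wallU (latticeVec m 1) I -
          wallFlux (S.singleLayer τ) wallD (latticeVec m (-1)) I) +
      3 * ∑ n ∈ Finset.Icc (-1 : ℤ) 1, wallFlux (S.singleLayer τ) wallR (latticeVec 1 n) 1 +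
      ∫ t in (-(1 / 2) : ℝ)..(1 / 2), ∑ j, fderiv ℝ (φ j) (wallL t) 1 * ξ j := by
  have h1 := (S.tendsto_stairFlux hτ).add (tendsto_proxyFlux hφ ξ)
  have h2 := tendsto_nhds_unique ((S.tendsto_exteriorFlux hτ hφ ξ hu).congr' (by
    filter_upwards [Ioc_mem_nhdsGT one_pos] with ε hε
      using S.setIntegral_exterior_repGrad hτ hφ ξ hu hε)) h1
  rw [h2, intervalIntegral.integral_of_le (by norm_num), integral_Ioc_eq_integral_Ioo]
  congr 2
  funext t
  rw [proxyGrad, re_sum]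
  refine Finset.sum_congr rfl fun j _ => ?_
  rw [re_ofReal_mul, mul_comm]
  simp

end Inclusions

end PeriodicNeumann

end

theorem mainTheorem10 {K : ℕ} (S : PeriodicNeumann.Inclusions K)
    (τ : ℂ → ℝ) (hτ : ContinuousOn τ S.bdry)
    {M : ℕ} (φ : Fin M → ℂ → ℝ)
    (hφ : ∀ j, InnerProductSpace.HarmonicOnNhd (φ j) PeriodicNeumann.closedCell)
    (ξ : Fin M → ℝ) (p₁ p₂ : ℝ)
    (hu : S.SolvesCellBVP (S.rep τ φ ξ) p₁ p₂) :
    MeasureTheory.IntegrableOn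
        (fun t => fderiv ℝ (S.rep τ φ ξ) (PeriodicNeumann.wallL t) 1) S.openL ∧
      S.fluxJ₁ (S.rep τ φ ξ) =
        ∑ m ∈ Finset.Icc (-1 : ℤ) 1, ((m : ℝ) + 2) *
          (PeriodicNeumann.wallFlux (S.singleLayer τ) PeriodicNeumann.wallU
              (PeriodicNeumann.latticeVec m 1) Complex.I -
            PeriodicNeumann.wallFlux (S.singleLayer τ) PeriodicNeumann.wallD
              (PeriodicNeumann.latticeVec m (-1)) Complex.I) +
        3 * ∑ n ∈ Finset.Icc (-1 : ℤ) 1,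
          PeriodicNeumann.wallFlux (S.singleLayer τ) PeriodicNeumann.wallR
            (PeriodicNeumann.latticeVec 1 n) 1 +
        ∫ t in (-(1 / 2) : ℝ)..(1 / 2),
          ∑ j, fderiv ℝ (φ j) (PeriodicNeumann.wallL t) 1 * ξ j :=
  ⟨S.integrableOn_openL hτ hφ ξ hu, S.fluxJ₁_rep hτ hφ ξ hu⟩
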